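/- **Setting.** Let $I_1,\dots,I_N\subset\mathbb R$ ($N\ge 1$) be disjoint compact intervals, $A\in\{0,1\}^{N\times N}$ a matrix such that for some $T\ge 0$ all entries of $A^T$ are positive ($T$ is an exponent here), and write $i\rightsquigarrow j$ if $A_{i,j}=1$. For $i\rightsquigarrow j$ let $\phi_{i,j}:I_i\to \mathrm{Int}(I_j)$ be smooth with $0<\phi_{i,j}'\le\theta$ for a constant $\theta<1$, and assume $\phi_{i,j}(I_i)\cap\phi_{k,l}(I_k)=\emptyset$ for $(i,j)\ne(k,l)$. Let $K_0=I=\bigcup_i I_i$, $K_{n+1}=\phi(K_n)=\bigcup_{i\rightsquigarrow j}\phi_{i,j}(I_i\cap K_n)$; let $\phi^{-1}:\phi(I)\to I$ be the univalued inverse and $J=\log\frac{d\phi^{-1}}{dx}$. Let $\tau\in C^\infty(\phi(I);\mathbb R)$, $V\in C^\infty(\phi(I);\mathbb C)$, $\hbar>0$ and $\mathcal V=\tau-i\hbar V$. Fix $a\in\mathbb N$ and a real $\chi\in C_0^\infty(\mathbb R)$ with support in $K_a$ and $\chi>0$ on $\mathrm{Int}(K_a)$. The operator $$(\mathcal L_{\hbar,\chi}f)(x)=\chi(x)^{-1}e^{\frac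 i\hbar\mathcal V(x)}(\chi f)(\phi^{-1}(x))\ \text{ for } x\in\phi(I),\qquad 0\ \text{ otherwise}$$ ($0$ also where $\chi=0$) is extended to distributions by duality. For real $s$, $\|u\|_{H^{s}_\hbar}=\|\langle\xi\rangle^{s}\mathcal F_\hbar u\|_{L^2}$, where $\mathcal F_\hbar u(\xi)=(2\pi\hbar)^{-1/2}\int e^{-ix\xi/\hbar}u(x)\,dx$ and $\langle\xi\rangle=(1+\xi^2)^{1/2}$. *Words.* Words $w_{0,n}=(w_0,\dots,w_n)$ and bi-infinite words $w=(w_l)_{l\in\mathbb Z}$ are admissible if $w_l\rightsquigarrow w_{l+1}$ throughout; $L$ is the left shift, $(Lw)_l=w_{l+1}$; $\phi_{w_{i,j}}=\phi_{w_{j-1},w_j}\circ\dots\circ\phi_{w_i,w_{i+1}}$; $x_w$ is the point of $\bigcap_{n}\phi_{w_{-n,0}}(I_{w_{-n}})$. For a function $g$ on $\phi(I)$ put $g_{w_{0,n}}=\sum_{k=1}^n g(\phi_{w_{0,k}}(x_w))$, where $w$ is a chosen admissible extension of $w_{0,n}$. For a real continuous $g$ the topological pressure is $\mathrm{Pr}(g)=\lim_{n\to\infty}\frac1n\log\sum_{w_{0,n}}e^{g_{w_{0,n}}}$;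 the limit is required to exist and to be the same for every choice of the extensions. *States.* For an admissible bi-infinite $w$ let $\Upsilon_w(y)=-\sum_{k\ge0}\big(\mathcal V(\phi_{w_{0,k+1}}(y))-\mathcal V(x_{L^{k+1}w})\big)$, $y\in I_{w_0}$, and let $H_w$ be the inverse of the map $z\mapsto\lim_{n\to\infty}e^{J_{w_{0,n}}}\big(\phi_{w_{0,n}}(x_w+z)-x_{L^nw}\big)$, $z\in I_{w_0}-x_w$. Let $(\widehat{\mathcal T}_wf)(y)=e^{\frac i\hbar\Upsilon_w(y)}f(H_w^{-1}(y-x_w))$, extended to distributions by duality. Write $\delta^{(k)}$ for the functional $\psi\mapsto\psi^{(k)}(0)$, and set $$\mathcal U_w^{(k)}=\chi^{-1}\widehat{\mathcal T}_w\big(\tfrac1{k!}\delta^{(k)}\big),\qquad \langle\mathcal S_w^{(k)}|u\rangle=\langle x^k,\widehat{\mathcal T}_w^{-1}\chi u\rangle,\qquad \Pi_{k,w,n}=|\mathcal U^{(k)}_{L^n w}\rangle\langle\mathcal S^{(k)}_w|.$$ **Theorem.** Let $m\in\mathbb R$, let $d\ge0$ be an integer with $d<m-\frac32$, and let $\hbar_0>0$.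 Then the pressure $\mathrm{Pr}(\mathrm{Re}\,V-(d+2)J)$ exists, and there are a constant $C>0$ and a function $R(n)$ with $R(n)\to0$ as $n\to\infty$, both independent of $n$, $\hbar$ (that is, $R$ depends on $n$ only) and of the choices of extensions, such that for every $0<\hbar<\hbar_0$ the following holds. For all $k\le d$ and all admissible bi-infinite $w$, $\mathcal U_w^{(k)}$ is a well-defined element of $H_\hbar^{-m}(\mathbb R)$ and $\mathcal S_w^{(k)}$ is represented by a Schwartz function, which lies in $H_\hbar^{m}(\mathbb R)$. For every $n\ge1$ and every choice, for each admissible word $w_{0,n}$, of an admissible bi-infinite extension $w$, $$\Big\|\mathcal L_{\hbar,\chi}^n-\sum_{w_{0,n}}e^{\frac i\hbar\mathcal V_{w_{0,n}}}\sum_{k=0}^d e^{-(k+1)J_{w_{0,n}}}\,\Pi_{k,w,n}\Big\|_{H_\hbar^{-m}\to H_\hbar^{-m}}\le C\,\hbar^{-(d+\frac32)}\,e^{n\left(\mathrm{Pr}(\mathrm{Re}\,V-(d+2)J)+R(n)\right)} .$$ -/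

import Mathlib

open Set Filter Topology MeasureTheory
open scoped ContDiff SchwartzMap

noncomputable section

namespace CutComp

variable {a b : ℝ}

theorem hasDerivAt_cut {η f : ℝ → ℂ} (hη : ContDiff ℝ ∞ η)
    (hs : ∀ x, x ∉ Icc a b → η x = 0)
    (hf : ∀ x ∈ tsupport η, DifferentiableWithinAt ℝ f (Icc a b) x) (x : ℝ) :
    HasDerivAt (fun y => η y * f y)
      (deriv η x * f x + η x * derivWithin f (Icc a b) x) x := by
  have hηd : HasDerivAt η (deriv η x) x :=
    ((hη.differentiable (by simp)) x).hasDerivAt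
  by_cases hx : x ∈ tsupport η
  · have h1 : HasDerivWithinAt (fun y => η y * f y)
        (deriv η x * f x + η x * derivWithin f (Icc a b) x) (Icc a b) x :=
      hηd.hasDerivWithinAt.mul (hf x hx).hasDerivWithinAt
    have h2 : HasDerivWithinAt (fun y => η y * f y)
        (deriv η x * f x + η x * derivWithin f (Icc a b) x) (Icc a b)ᶜ x := by
      by_cases hc : x ∈ closure (Icc a b)ᶜ
      · have e0 : η x = 0 := by
          have : closure (Icc a b)ᶜ ⊆ {y | η y = 0} :=
            closure_minimal (fun y hy => hs y hy) (isClosed_eq hη.continuous continuous_const)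
          exact this hc
        have e1 : deriv η x = 0 := by
          have hcd : Continuous (deriv η) := hη.continuous_deriv (by simp)
          have : closure (Icc a b)ᶜ ⊆ {y | deriv η y = 0} := by
            refine closure_minimal (fun y hy => ?_) (isClosed_eq hcd continuous_const)
            have : η =ᶠ[𝓝 y] fun _ => 0 := by
              filter_upwards [isClosed_Icc.isOpen_compl.mem_nhds hy] with z hz using hs z hz
            simpa using this.deriv_eq
          exact this hc
        rw [e0, e1]
        simp only [zero_mul, add_zero]
        refine (hasDerivWithinAt_const x _ (0 : ℂ)).congr (fun y hy => ?_) ?_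
        · simp [hs y hy]
        · simp [e0]
      · exact HasFDerivWithinAt.of_notMem_closure hc
    have := h1.union h2
    rwa [union_compl_self, hasDerivWithinAt_univ] at this
  · have h0 : η =ᶠ[𝓝 x] fun _ => 0 := notMem_tsupport_iff_eventuallyEq.mp hx
    have e0 : η x = 0 := h0.eq_of_nhds
    have e1 : deriv η x = 0 := by simpa using h0.deriv_eq
    rw [e0, e1]
    simp only [zero_mul, add_zero]
    refine (hasDerivAt_const x (0 : ℂ)).congr_of_eventuallyEq ?_
    filter_upwards [h0] with y hy
    simp [hy]

theorem deriv_zero_off {η : ℝ → ℂ} (hs : ∀ x, x ∉ Icc a b → η x = 0) :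
    ∀ x, x ∉ Icc a b → deriv η x = 0 := by
  intro y hy
  have : η =ᶠ[𝓝 y] fun _ => 0 := by
    filter_upwards [isClosed_Icc.isOpen_compl.mem_nhds hy] with z hz using hs z hz
  simpa using this.deriv_eq

theorem contDiff_cut (hab : a < b) (n : ℕ) : ∀ {η f : ℝ → ℂ}, ContDiff ℝ ∞ η →
    (∀ x, x ∉ Icc a b → η x = 0) →
    (∀ x ∈ tsupport η, ContDiffWithinAt ℝ ∞ f (Icc a b) x) →
    ContDiff ℝ n (fun y => η y * f y) := by
  have key : ∀ {η f : ℝ → ℂ}, ContDiff ℝ ∞ η → (∀ x, x ∉ Icc a b → η x = 0) →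
      (∀ x ∈ tsupport η, ContDiffWithinAt ℝ ∞ f (Icc a b) x) → ∀ x,
      HasDerivAt (fun y => η y * f y)
      (deriv η x * f x + η x * derivWithin f (Icc a b) x) x := fun hη hs hf =>
    hasDerivAt_cut hη hs (fun x hx => (hf x hx).differentiableWithinAt (by simp))
  induction n with
  | zero =>
    intro η f hη hs hf
    have : Differentiable ℝ (fun y => η y * f y) := fun x => (key hη hs hf x).differentiableAt
    simpa using this.continuous
  | succ n ih =>
    intro η f hη hs hf
    push_cast
    rw [contDiff_succ_iff_deriv]
    refine ⟨fun x => (key hη hs hf x).differentiableAt, by simp, ?_⟩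
    have e : deriv (fun y => η y * f y) =
        fun x => deriv η x * f x + η x * derivWithin f (Icc a b) x :=
      funext fun x => (key hη hs hf x).deriv
    rw [e]
    refine (ih (η := deriv η) (f := f) ?_ (deriv_zero_off hs) ?_).add
      (ih (η := η) (f := derivWithin f (Icc a b)) hη hs ?_)
    · exact (contDiff_infty_iff_deriv.mp hη).2
    · exact fun x hx => hf x (closure_minimal support_deriv_subset (isClosed_tsupport η) hx)
    · intro x hx
      have hxs : x ∈ Icc a b := by
        refine (closure_minimal ?_ isClosed_Icc : tsupport η ⊆ Icc a b) hx
        intro y hy; by_contra h; exact hy (hs y h)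
      exact (hf x hx).derivWithin (uniqueDiffOn_Icc hab) (by simp) hxs

theorem iteratedDeriv_bound (hab : a < b) {φ : ℝ → ℝ} (hφ : ContDiffOn ℝ ∞ φ (Icc a b)) (l : ℕ) :
    ∀ {η f : ℝ → ℂ}, ContDiff ℝ ∞ η →
    (∀ x, x ∉ Icc a b → η x = 0) →
    (∀ x ∈ tsupport η, ContDiffWithinAt ℝ ∞ f (Icc a b) x) →
    ∃ C : ℝ, 0 ≤ C ∧ ∀ (ψ : 𝓢(ℝ, ℂ)) (x : ℝ),
      ‖iteratedDeriv l (fun y => η y * (f y * ψ (φ y))) x‖ ≤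
        C * ((Finset.range (l + 1)).image fun j => ((0 : ℕ), j)).sup
          (schwartzSeminormFamily ℂ ℝ ℂ) ψ := by
  induction l with
  | zero =>
    intro η f hη hs hf
    have hc : Continuous (fun y => η y * f y) := by
      have := contDiff_cut hab 0 hη hs hf
      simpa using this
    obtain ⟨C, hC⟩ := (isCompact_Icc (a := a) (b := b)).exists_bound_of_continuousOn hc.continuousOn
    refine ⟨max C 0, le_max_right _ _, fun ψ x => ?_⟩
    have hψ : ‖ψ (φ x)‖ ≤ (({0} : Finset ℕ).image fun j => ((0 : ℕ), j)).sup
          (schwartzSeminormFamily ℂ ℝ ℂ) ψ := by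
      simpa using SchwartzMap.norm_le_seminorm ℂ ψ (φ x)
    simp only [iteratedDeriv_zero, zero_add, Finset.range_one, ← mul_assoc, norm_mul (η x * f x)]
    refine mul_le_mul ?_ hψ (norm_nonneg _) (le_max_right _ _)
    by_cases hx : x ∈ Icc a b
    · exact (hC x hx).trans (le_max_left _ _)
    · simp [hs x hx]
  | succ l ih =>
    intro η f hη hs hf
    have hts : tsupport η ⊆ Icc a b := by
      refine closure_minimal ?_ isClosed_Icc
      intro y hy; by_contra h; exact hy (hs y h)
    have hts' : tsupport (deriv η) ⊆ tsupport η :=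
      closure_minimal support_deriv_subset (isClosed_tsupport η)
    have hη' : ContDiff ℝ ∞ (deriv η) := (contDiff_infty_iff_deriv.mp hη).2
    have hf2 : ∀ x ∈ tsupport η, ContDiffWithinAt ℝ ∞ (derivWithin f (Icc a b)) (Icc a b) x :=
      fun x hx => (hf x hx).derivWithin (uniqueDiffOn_Icc hab) (by simp) (hts hx)
    have hf3 : ∀ x ∈ tsupport η, ContDiffWithinAt ℝ ∞
        (fun y => f y * ((derivWithin φ (Icc a b) y : ℝ) : ℂ)) (Icc a b) x := fun x hx => by
      refine (hf x hx).mul ?_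
      exact Complex.ofRealCLM.contDiff.contDiffAt.comp_contDiffWithinAt x
        (((hφ x (hts hx)).derivWithin (uniqueDiffOn_Icc hab) (m := ∞) (by simp) (hts hx)))
    obtain ⟨C1, hC1, h1⟩ := ih hη' (deriv_zero_off hs) (fun x hx => hf x (hts' hx))
    obtain ⟨C2, hC2, h2⟩ := ih hη hs hf2
    obtain ⟨C3, hC3, h3⟩ := ih hη hs hf3
    refine ⟨C1 + C2 + C3, by positivity, fun ψ x => ?_⟩
    set ψ' : 𝓢(ℝ, ℂ) := SchwartzMap.derivCLM ℂ ℂ ψ with hψ'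
    have hcomp : ∀ (θ : 𝓢(ℝ, ℂ)) (g : ℝ → ℂ) (y : ℝ), y ∈ Icc a b →
        ContDiffWithinAt ℝ ∞ g (Icc a b) y →
        ContDiffWithinAt ℝ ∞ (fun y => g y * θ (φ y)) (Icc a b) y := fun θ g y hy hg =>
      hg.mul ((θ.smooth ⊤).contDiffAt.comp_contDiffWithinAt y (hφ y hy))
    have e : deriv (fun y => η y * (f y * ψ (φ y))) = fun y =>
        (deriv η y * (f y * ψ (φ y)) + η y * (derivWithin f (Icc a b) y * ψ (φ y))) +
        η y * ((f y * ((derivWithin φ (Icc a b) y : ℝ) : ℂ)) * ψ' (φ y)) := by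
      funext y
      rw [(hasDerivAt_cut hη hs (fun z hz =>
        (hcomp ψ f z (hts hz) (hf z hz)).differentiableWithinAt (by simp)) y).deriv]
      by_cases hy : y ∈ tsupport η
      · have hd1 := ((hf y hy).differentiableWithinAt (by simp)).hasDerivWithinAt
        have hd2 := ((hφ y (hts hy)).differentiableWithinAt (by simp)).hasDerivWithinAt
        have hd3 : HasDerivAt ψ (deriv ψ (φ y)) (φ y) := (ψ.differentiableAt).hasDerivAt
        have hd4 := HasDerivAt.scomp_hasDerivWithinAt y hd3 hd2
        have hd5 := (hd1.mul hd4).derivWithin ((uniqueDiffOn_Icc hab) y (hts hy))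
        have : derivWithin (fun y => f y * ψ (φ y)) (Icc a b) y = _ := hd5
        rw [this]
        simp only [hψ', SchwartzMap.derivCLM_apply, Function.comp, Complex.real_smul]
        ring
      · have : η y = 0 := image_eq_zero_of_notMem_tsupport hy
        simp [this]
    rw [iteratedDeriv_succ', e]
    have c1 : ContDiff ℝ l (fun y => deriv η y * (f y * ψ (φ y))) :=
      contDiff_cut hab l hη' (deriv_zero_off hs)
        (fun z hz => hcomp ψ f z (hts (hts' hz)) (hf z (hts' hz)))
    have c2 : ContDiff ℝ l (fun y => η y * (derivWithin f (Icc a b) y * ψ (φ y))) :=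
      contDiff_cut hab l hη hs (fun z hz => hcomp ψ _ z (hts hz) (hf2 z hz))
    have c3 : ContDiff ℝ l (fun y =>
        η y * ((f y * ((derivWithin φ (Icc a b) y : ℝ) : ℂ)) * ψ' (φ y))) :=
      contDiff_cut hab l hη hs (fun z hz => hcomp ψ' _ z (hts hz) (hf3 z hz))
    have s1 := iteratedDeriv_fun_add (c1.add c2).contDiffAt (c3.contDiffAt (x := x))
    have s2 := iteratedDeriv_fun_add (c1.contDiffAt (x := x)) c2.contDiffAt
    rw [s1, s2]
    set P : Seminorm ℂ 𝓢(ℝ, ℂ) := ((Finset.range (l + 1 + 1)).image fun j => ((0 : ℕ), j)).sup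
          (schwartzSeminormFamily ℂ ℝ ℂ) with hP
    have m1 : ((Finset.range (l + 1)).image fun j => ((0 : ℕ), j)).sup
          (schwartzSeminormFamily ℂ ℝ ℂ) ψ ≤ P ψ := by
      refine (Finset.sup_mono (Finset.image_subset_image ?_) : _ ≤ P) ψ
      exact Finset.range_mono (by omega)
    have m2 : ((Finset.range (l + 1)).image fun j => ((0 : ℕ), j)).sup
          (schwartzSeminormFamily ℂ ℝ ℂ) ψ' ≤ P ψ := by
      refine Seminorm.finset_sup_apply_le (apply_nonneg _ _) ?_
      intro i hi
      obtain ⟨j, hj, rfl⟩ := Finset.mem_image.mp hi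
      have : SchwartzMap.seminorm ℂ 0 j ψ' ≤ SchwartzMap.seminorm ℂ 0 (j + 1) ψ := by
        refine SchwartzMap.seminorm_le_bound' ℂ 0 j ψ' (apply_nonneg _ _) fun y => ?_
        have hh := SchwartzMap.le_seminorm' ℂ 0 (j + 1) ψ y
        rw [iteratedDeriv_succ'] at hh
        exact hh
      refine this.trans ?_
      have : schwartzSeminormFamily ℂ ℝ ℂ (0, j + 1) ≤ P :=
        Finset.le_sup (f := schwartzSeminormFamily ℂ ℝ ℂ)
          (Finset.mem_image.mpr ⟨j + 1, by simpa using hj, rfl⟩)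
      exact this ψ
    calc _ ≤ _ := (norm_add_le _ _).trans (add_le_add_left (norm_add_le _ _) _)
      _ ≤ C1 * P ψ + C2 * P ψ + C3 * P ψ := by
        refine add_le_add (add_le_add ((h1 ψ x).trans ?_) ((h2 ψ x).trans ?_)) ((h3 ψ' x).trans ?_)
        · exact mul_le_mul_of_nonneg_left m1 hC1
        · exact mul_le_mul_of_nonneg_left m1 hC2
        · exact mul_le_mul_of_nonneg_left m2 hC3
      _ = _ := by ring

theorem exists_clm (hab : a < b) {φ : ℝ → ℝ} (hφ : ContDiffOn ℝ ∞ φ (Icc a b))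
    {η f : ℝ → ℂ} (hη : ContDiff ℝ ∞ η) (hs : ∀ x, x ∉ Icc a b → η x = 0)
    (hf : ∀ x ∈ tsupport η, ContDiffWithinAt ℝ ∞ f (Icc a b) x) :
    ∃ T : 𝓢(ℝ, ℂ) →L[ℂ] 𝓢(ℝ, ℂ), ∀ ψ y, T ψ y = η y * (f y * ψ (φ y)) := by
  have hts : tsupport η ⊆ Icc a b := by
    refine closure_minimal ?_ isClosed_Icc
    intro y hy; by_contra h; exact hy (hs y h)
  refine ⟨SchwartzMap.mkCLM (fun ψ y => η y * (f y * ψ (φ y))) ?_ ?_ ?_ ?_, fun ψ y => rfl⟩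
  · intro u v x; simp; ring
  · intro c u x; simp; ring
  · intro ψ
    refine contDiff_infty.mpr fun n => contDiff_cut hab n hη hs fun z hz => ?_
    exact (hf z hz).mul ((ψ.smooth ⊤).contDiffAt.comp_contDiffWithinAt z (hφ z (hts hz)))
  · rintro ⟨k, l⟩
    obtain ⟨C, hC, h⟩ := iteratedDeriv_bound hab hφ l hη hs hf
    refine ⟨(Finset.range (l + 1)).image fun j => ((0 : ℕ), j), (max |a| |b|) ^ k * C, by positivity, fun ψ x => ?_⟩
    simp only
    rw [norm_iteratedFDeriv_eq_norm_iteratedDeriv, mul_assoc]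
    by_cases hx : x ∈ Icc a b
    · refine mul_le_mul (pow_le_pow_left₀ (norm_nonneg _) ?_ k) (h ψ x) (norm_nonneg _)
        (by positivity)
      rw [Real.norm_eq_abs]
      exact abs_le_max_abs_abs hx.1 hx.2
    · have : (fun y => η y * (f y * ψ (φ y))) =ᶠ[𝓝 x] fun _ => 0 := by
        filter_upwards [isClosed_Icc.isOpen_compl.mem_nhds hx] with z hz
        simp [hs z hz]
      rw [(this.iteratedDeriv l).eq_of_nhds, iteratedDeriv_const]
      have : (if l = 0 then (0:ℂ) else 0) = 0 := by simp
      rw [this, norm_zero, mul_zero]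
      exact mul_nonneg (by positivity) (mul_nonneg hC (apply_nonneg _ _))

end CutComp

/-- An iterated function scheme on the disjoint closed intervals `[lo i, hi i]`. -/
structure IFS where
  N : ℕ
  N_pos : 1 ≤ N
  lo : Fin N → ℝ
  hi : Fin N → ℝ
  lo_lt_hi : ∀ i, lo i < hi i
  disjoint : ∀ i j, i ≠ j → Disjoint (Icc (lo i) (hi i)) (Icc (lo j) (hi j))
  /-- the adjacency matrix; `i ⇝ j` means `adj i j = 1` -/
  adj : Matrix (Fin N) (Fin N) ℕ
  adj_mem : ∀ i j, adj i j = 0 ∨ adj i j = 1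
  transitive : ∃ T : ℕ, ∀ i j, 0 < (adj ^ T) i j
  /-- only the values of `φ i j` on `[lo i, hi i]`, for `i ⇝ j`, are relevant -/
  φ : Fin N → Fin N → ℝ → ℝ
  smooth : ∀ i j, adj i j = 1 → ContDiffOn ℝ ∞ (φ i j) (Icc (lo i) (hi i))
  maps : ∀ i j, adj i j = 1 →
    φ i j '' Icc (lo i) (hi i) ⊆ interior (Icc (lo j) (hi j))
  contraction : ∃ θ : ℝ, 0 < θ ∧ θ < 1 ∧ ∀ i j, adj i j = 1 → ∀ x ∈ Icc (lo i) (hi i),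
    0 < derivWithin (φ i j) (Icc (lo i) (hi i)) x ∧
      derivWithin (φ i j) (Icc (lo i) (hi i)) x ≤ θ
  separated : ∀ i j k l, adj i j = 1 → adj k l = 1 → (i, j) ≠ (k, l) →
    Disjoint (φ i j '' Icc (lo i) (hi i)) (φ k l '' Icc (lo k) (hi k))

namespace IFS

/-- The interval `I_i`. -/
def interval (S : IFS) (i : Fin S.N) : Set ℝ := Icc (S.lo i) (S.hi i)

/-- The sets `K_n = φⁿ(I)`, where `I` is the union of the intervals. -/
def trap (S : IFS) : ℕ → Set ℝ
  | 0 => ⋃ i, S.interval i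
  | n + 1 => ⋃ (i) (j) (_ : S.adj i j = 1), S.φ i j '' (S.interval i ∩ trap S n)

theorem mem_trap_succ (S : IFS) {n : ℕ} {x : ℝ} : x ∈ S.trap (n + 1) ↔
    ∃ i j, S.adj i j = 1 ∧ ∃ y, (y ∈ S.interval i ∧ y ∈ S.trap n) ∧ S.φ i j y = x := by
  simp [trap]

theorem trap_subset (S : IFS) (n : ℕ) : S.trap n ⊆ S.trap 0 := by
  cases n with
  | zero => exact subset_rfl
  | succ n =>
    intro x hx
    obtain ⟨i, j, h, y, ⟨hy, -⟩, rfl⟩ := S.mem_trap_succ.mp hx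
    exact mem_iUnion.mpr ⟨j, interior_subset (S.maps i j h ⟨y, hy, rfl⟩)⟩

theorem mem_interior_interval (S : IFS) {n : ℕ} {x : ℝ} (i : Fin S.N) (hx : x ∈ S.trap (n + 1))
    (hi : x ∈ S.interval i) : x ∈ interior (S.interval i) := by
  obtain ⟨k, j, h, y, ⟨hy, -⟩, rfl⟩ := S.mem_trap_succ.mp hx
  have hj := S.maps k j h ⟨y, hy, rfl⟩
  by_cases e : j = i
  · subst e; exact hj
  · exact absurd hi (Set.disjoint_left.mp (S.disjoint j i e) (interior_subset hj))

theorem map_nhds (S : IFS) {i j : Fin S.N} (h : S.adj i j = 1) {y : ℝ}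
    (hy : y ∈ interior (S.interval i)) : Filter.map (S.φ i j) (𝓝 y) = 𝓝 (S.φ i j y) := by
  have hn : S.interval i ∈ 𝓝 y := mem_interior_iff_mem_nhds.mp hy
  have hc : ContDiffAt ℝ ∞ (S.φ i j) y := (S.smooth i j h).contDiffAt hn
  have hs : HasStrictDerivAt (S.φ i j) (deriv (S.φ i j) y) y :=
    hc.hasStrictDerivAt (by simp)
  obtain ⟨θ, -, -, hθ⟩ := S.contraction
  have hpos : 0 < derivWithin (S.φ i j) (S.interval i) y := (hθ i j h y (interior_subset hy)).1
  rw [derivWithin_of_mem_nhds hn] at hpos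
  exact hs.map_nhds_eq hpos.ne'

theorem trap_succ_subset_interior (S : IFS) (n : ℕ) : S.trap (n + 1) ⊆ interior (S.trap n) := by
  induction n with
  | zero =>
    intro x hx
    obtain ⟨i, j, h, y, ⟨hy, -⟩, rfl⟩ := S.mem_trap_succ.mp hx
    exact interior_mono (subset_iUnion S.interval j) (S.maps i j h ⟨y, hy, rfl⟩)
  | succ n ih =>
    intro x hx
    obtain ⟨i, j, h, y, ⟨hy, hy'⟩, rfl⟩ := S.mem_trap_succ.mp hx
    have h1 : y ∈ interior (S.interval i) := S.mem_interior_interval i hy' hy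
    have h2 : S.interval i ∩ S.trap n ∈ 𝓝 y :=
      inter_mem (mem_interior_iff_mem_nhds.mp h1) (mem_interior_iff_mem_nhds.mp (ih hy'))
    rw [mem_interior_iff_mem_nhds, ← S.map_nhds h h1]
    refine Filter.mem_of_superset (Filter.image_mem_map h2) ?_
    rintro _ ⟨z, hz, rfl⟩
    exact S.mem_trap_succ.mpr ⟨i, j, h, z, hz, rfl⟩

end IFS

/-- The data of a transfer operator: roof function `τ`, potential `V` (both smooth on
`φ(I) = K_1`) and a cut-off function `χ` supported in `K_a` and positive in its interior. -/
structure TransferData (S : IFS) where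
  τ : ℝ → ℝ
  τ_smooth : ContDiffOn ℝ ∞ τ (S.trap 1)
  V : ℝ → ℂ
  V_smooth : ContDiffOn ℝ ∞ V (S.trap 1)
  a : ℕ
  χ : ℝ → ℝ
  χ_smooth : ContDiff ℝ ∞ χ
  χ_supp : tsupport χ ⊆ S.trap a
  χ_pos : ∀ x ∈ interior (S.trap a), 0 < χ x

namespace TransferData

variable {S : IFS}

/-- `𝒱 = τ - i ħ V`. -/
def phase (D : TransferData S) (ħ : ℝ) (x : ℝ) : ℂ := D.τ x - Complex.I * ħ * D.V x

open Classical in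
/-- The component `L_{i,j,χ} = χ⁻¹ L_{i,j} χ` of the truncated transfer operator on functions.
It vanishes where `χ` does. -/
def branchFun (D : TransferData S) (ħ : ℝ) (i j : Fin S.N) (f : ℝ → ℂ) (x : ℝ) : ℂ :=
  if S.adj i j = 1 ∧ x ∈ S.φ i j '' S.interval i then
    (D.χ x : ℂ)⁻¹ * (Complex.exp (Complex.I / ħ * D.phase ħ x) *
      (D.χ (Function.invFunOn (S.φ i j) (S.interval i) x) *
        f (Function.invFunOn (S.φ i j) (S.interval i) x)))
  else 0

/-- The truncated transfer operator `L_{ħ,χ} = χ⁻¹ L_ħ χ` on functions. -/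
def transferFun (D : TransferData S) (ħ : ℝ) (f : ℝ → ℂ) (x : ℝ) : ℂ :=
  ∑ i, ∑ j, D.branchFun ħ i j f x

open Classical in
/-- The transpose of `branchFun`, for the pairing `∫ f ψ`. -/
def branchTranspose (D : TransferData S) (ħ : ℝ) (i j : Fin S.N) (ψ : ℝ → ℂ) (y : ℝ) : ℂ :=
  if S.adj i j = 1 ∧ y ∈ S.interval i then
    D.χ y * derivWithin (S.φ i j) (S.interval i) y *
      Complex.exp (Complex.I / ħ * D.phase ħ (S.φ i j y)) / D.χ (S.φ i j y) * ψ (S.φ i j y)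
  else 0

/-- The formal transpose of `L_{ħ,χ}`, for the pairing `∫ f ψ`. -/
def transposeFun (D : TransferData S) (ħ : ℝ) (ψ : ℝ → ℂ) (y : ℝ) : ℂ :=
  ∑ i, ∑ j, D.branchTranspose ħ i j ψ y

theorem exists_branchTranspose (D : TransferData S) (ħ : ℝ) (i j : Fin S.N)
    (h : S.adj i j = 1) : ∃ T : 𝓢(ℝ, ℂ) →L[ℂ] 𝓢(ℝ, ℂ),
    ∀ ψ y, T ψ y = D.branchTranspose ħ i j ψ y := by
  classical
  have hχ0 : ∀ x, x ∉ S.trap 0 → D.χ x = 0 := fun x hx =>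
    image_eq_zero_of_notMem_tsupport fun h => hx (S.trap_subset _ (D.χ_supp h))
  set η : ℝ → ℂ := fun y => if y ∈ S.interval i then (D.χ y : ℂ) else 0 with hη
  have hcl : IsClosed (⋃ k ∈ {k | k ≠ i}, S.interval k) :=
    (Set.toFinite _).isClosed_biUnion fun k _ => isClosed_Icc
  have hloc : ∀ y, y ∈ S.interval i → η =ᶠ[𝓝 y] fun z => (D.χ z : ℂ) := by
    intro y hy
    have : (⋃ k ∈ {k | k ≠ i}, S.interval k)ᶜ ∈ 𝓝 y := by
      refine hcl.isOpen_compl.mem_nhds ?_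
      simp only [mem_compl_iff, mem_iUnion, not_exists]
      intro k hk hk'
      exact Set.disjoint_left.mp (S.disjoint k i hk) hk' hy
    filter_upwards [this] with z hz
    by_cases hzi : z ∈ S.interval i
    · simp [hη, hzi]
    · have : z ∉ S.trap 0 := by
        intro h0
        obtain ⟨k, hk⟩ := mem_iUnion.mp h0
        by_cases e : k = i
        · exact hzi (e ▸ hk)
        · exact hz (mem_biUnion (by exact e) hk)
      simp [hη, hzi, hχ0 z this]
  have hoff : ∀ y, y ∉ S.interval i → η =ᶠ[𝓝 y] fun _ => 0 := by
    intro y hy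
    filter_upwards [(isClosed_Icc (a := S.lo i) (b := S.hi i)).isOpen_compl.mem_nhds hy]
      with z hz
    have : z ∉ S.interval i := hz
    simp [hη, this]
  have hηs : ContDiff ℝ ∞ η := by
    rw [contDiff_iff_contDiffAt]
    intro y
    by_cases hy : y ∈ S.interval i
    · refine ContDiffAt.congr_of_eventuallyEq ?_ (hloc y hy)
      exact (Complex.ofRealCLM.contDiff.comp D.χ_smooth).contDiffAt
    · exact contDiffAt_const.congr_of_eventuallyEq (hoff y hy)
  have hts : ∀ y ∈ tsupport η, y ∈ S.interval i ∧ y ∈ S.trap D.a := by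
    intro y hy
    have h1 : y ∈ S.interval i := by
      by_contra hn
      exact (notMem_tsupport_iff_eventuallyEq.mpr (hoff y hn)) hy
    refine ⟨h1, ?_⟩
    by_contra hn
    have h2 : y ∉ tsupport D.χ := fun hh => hn (D.χ_supp hh)
    refine (notMem_tsupport_iff_eventuallyEq.mpr ?_) hy
    filter_upwards [hloc y h1, notMem_tsupport_iff_eventuallyEq.mp h2] with z hz hz'
    simp [hz, hz']
  have hmaps : MapsTo (S.φ i j) (Icc (S.lo i) (S.hi i)) (S.trap 1) := fun y hy =>
    S.mem_trap_succ.mpr ⟨i, j, h, y, ⟨hy, mem_iUnion.mpr ⟨i, hy⟩⟩, rfl⟩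
  have hφ := S.smooth i j h
  have hf : ∀ y ∈ tsupport η, ContDiffWithinAt ℝ ∞ (fun y =>
      ((derivWithin (S.φ i j) (S.interval i) y : ℝ) : ℂ) *
      Complex.exp (Complex.I / ħ * D.phase ħ (S.φ i j y)) * ((D.χ (S.φ i j y) : ℝ) : ℂ)⁻¹)
      (Icc (S.lo i) (S.hi i)) y := by
    intro y hy
    obtain ⟨hyi, hya⟩ := hts y hy
    have hφy := hφ y hyi
    have c1 : ContDiffWithinAt ℝ ∞ (fun y =>
        ((derivWithin (S.φ i j) (S.interval i) y : ℝ) : ℂ)) (Icc (S.lo i) (S.hi i)) y :=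
      Complex.ofRealCLM.contDiff.contDiffAt.comp_contDiffWithinAt y
        (hφy.derivWithin (uniqueDiffOn_Icc (S.lo_lt_hi i)) (m := ∞) (by simp) hyi)
    have c2 : ContDiffWithinAt ℝ ∞ (fun y => ((D.τ (S.φ i j y) : ℝ) : ℂ))
        (Icc (S.lo i) (S.hi i)) y :=
      Complex.ofRealCLM.contDiff.contDiffAt.comp_contDiffWithinAt y
        ((D.τ_smooth.comp hφ hmaps) y hyi)
    have c3 : ContDiffWithinAt ℝ ∞ (fun y => D.V (S.φ i j y))
        (Icc (S.lo i) (S.hi i)) y := (D.V_smooth.comp hφ hmaps) y hyi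
    have c4 : ContDiffWithinAt ℝ ∞ (fun y => ((D.χ (S.φ i j y) : ℝ) : ℂ))
        (Icc (S.lo i) (S.hi i)) y :=
      (Complex.ofRealCLM.contDiff.comp D.χ_smooth).contDiffAt.comp_contDiffWithinAt y hφy
    have hne : ((D.χ (S.φ i j y) : ℝ) : ℂ) ≠ 0 := by
      have : S.φ i j y ∈ S.trap (D.a + 1) :=
        S.mem_trap_succ.mpr ⟨i, j, h, y, ⟨hyi, hya⟩, rfl⟩
      exact_mod_cast (D.χ_pos _ (S.trap_succ_subset_interior _ this)).ne'
    refine (c1.mul (ContDiffWithinAt.cexp ?_)).mul (c4.inv hne)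
    exact contDiffWithinAt_const.mul (c2.sub (contDiffWithinAt_const.mul c3))
  obtain ⟨T, hT⟩ := CutComp.exists_clm (S.lo_lt_hi i) hφ hηs
    (fun x hx => by
      have : x ∉ S.interval i := hx
      simp [hη, this]) hf
  refine ⟨T, fun ψ y => ?_⟩
  rw [hT, branchTranspose]
  by_cases hy : y ∈ S.interval i
  · simp only [hη, hy, h, and_self, if_true]
    ring
  · simp [hη, hy]

theorem exists_transpose (D : TransferData S) (ħ : ℝ) :
    ∃ T : 𝓢(ℝ, ℂ) →L[ℂ] 𝓢(ℝ, ℂ), ∀ ψ y, T ψ y = D.transposeFun ħ ψ y := by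
  classical
  have key := D.exists_branchTranspose ħ
  choose! T hT using key
  refine ⟨∑ i, ∑ j, if S.adj i j = 1 then T i j else 0, fun ψ y => ?_⟩
  simp only [transposeFun, sum_apply]
  refine Finset.sum_congr rfl fun i _ => Finset.sum_congr rfl fun j _ => ?_
  by_cases h : S.adj i j = 1
  · rw [if_pos h, hT i j h]
  · simp [h, branchTranspose]

/-- The transpose of `L_{ħ,χ}` on Schwartz functions. -/
noncomputable def transpose (D : TransferData S) (ħ : ℝ) : 𝓢(ℝ, ℂ) →L[ℂ] 𝓢(ℝ, ℂ) :=
  (D.exists_transpose ħ).choose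

theorem transpose_apply (D : TransferData S) (ħ : ℝ) (ψ : 𝓢(ℝ, ℂ)) (y : ℝ) :
    D.transpose ħ ψ y = D.transposeFun ħ ψ y :=
  (D.exists_transpose ħ).choose_spec ψ y

theorem branch_duality (D : TransferData S) (ħ : ℝ) (i j : Fin S.N) (f ψ : 𝓢(ℝ, ℂ)) :
    Integrable (fun x => D.branchFun ħ i j f x * ψ x) ∧
    Integrable (fun y => f y * D.branchTranspose ħ i j ψ y) ∧
    ∫ x, D.branchFun ħ i j f x * ψ x = ∫ y, f y * D.branchTranspose ħ i j ψ y := by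
  classical
  by_cases h : S.adj i j = 1
  swap
  · simp [branchFun, branchTranspose, h]
  obtain ⟨T, hT⟩ := D.exists_branchTranspose ħ i j h
  have hint : Integrable (fun y => f y * D.branchTranspose ħ i j ψ y) := by
    have := (f.integrable (μ := volume)).mul_bdd (c := SchwartzMap.seminorm ℂ 0 0 (T ψ))
      (g := fun y => (T ψ) y) (f := f) (T ψ).continuous.aestronglyMeasurable
      (Filter.Eventually.of_forall fun y => SchwartzMap.norm_le_seminorm ℂ _ _)
    refine this.congr (Filter.Eventually.of_forall fun y => ?_)
    simp [hT]
  have hmI : MeasurableSet (S.interval i) := measurableSet_Icc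
  obtain ⟨θ, -, -, hθ⟩ := S.contraction
  have hpos : ∀ y ∈ S.interval i, 0 < derivWithin (S.φ i j) (S.interval i) y :=
    fun y hy => (hθ i j h y hy).1
  have hcont : ContinuousOn (S.φ i j) (S.interval i) := (S.smooth i j h).continuousOn
  have hder : ∀ y ∈ S.interval i, HasDerivWithinAt (S.φ i j)
      (derivWithin (S.φ i j) (S.interval i) y) (S.interval i) y := fun y hy =>
    (((S.smooth i j h) y hy).differentiableWithinAt (by simp)).hasDerivWithinAt
  have hinj : InjOn (S.φ i j) (S.interval i) := by
    refine (strictMonoOn_of_deriv_pos (convex_Icc _ _) hcont fun y hy => ?_).injOn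
    have hn : S.interval i ∈ 𝓝 y := mem_interior_iff_mem_nhds.mp hy
    rw [← derivWithin_of_mem_nhds hn]
    exact hpos y (interior_subset hy)
  have hmφ : MeasurableSet (S.φ i j '' S.interval i) :=
    ((isCompact_Icc (a := S.lo i) (b := S.hi i)).image_of_continuousOn hcont).measurableSet
  set G : ℝ → ℂ := fun x => (D.χ x : ℂ)⁻¹ * (Complex.exp (Complex.I / ħ * D.phase ħ x) *
      (D.χ (Function.invFunOn (S.φ i j) (S.interval i) x) *
        f (Function.invFunOn (S.φ i j) (S.interval i) x))) * ψ x with hG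
  have e1 : (fun x => D.branchFun ħ i j f x * ψ x) = (S.φ i j '' S.interval i).indicator G := by
    funext x
    by_cases hx : x ∈ S.φ i j '' S.interval i
    · simp [branchFun, h, hx, hG, -mem_image]
    · simp [branchFun, hx, -mem_image]
  have e2 : (fun y => f y * D.branchTranspose ħ i j ψ y) =
      (S.interval i).indicator (fun y => |derivWithin (S.φ i j) (S.interval i) y| •
        G (S.φ i j y)) := by
    funext y
    by_cases hy : y ∈ S.interval i
    · have hl : Function.invFunOn (S.φ i j) (S.interval i) (S.φ i j y) = y :=
        hinj (Function.invFunOn_mem ⟨y, hy, rfl⟩) hy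
          (Function.invFunOn_eq ⟨y, hy, rfl⟩)
      simp only [branchTranspose, h, hy, and_self, if_true, indicator_of_mem, hG, hl,
        abs_of_pos (hpos y hy), Complex.real_smul]
      ring
    · simp [branchTranspose, hy]
  refine ⟨?_, hint, ?_⟩
  · rw [e1, integrable_indicator_iff hmφ,
      integrableOn_image_iff_integrableOn_abs_deriv_smul hmI hder hinj,
      ← integrable_indicator_iff hmI, ← e2]
    exact hint
  · rw [e1, e2, integral_indicator hmφ, integral_indicator hmI]
    exact integral_image_eq_integral_abs_deriv_smul hmI hder hinj G

/-- `transpose` is the transpose of `L_{ħ,χ}`. -/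
theorem duality (D : TransferData S) (ħ : ℝ) (f ψ : 𝓢(ℝ, ℂ)) :
    ∫ x, D.transferFun ħ f x * ψ x = ∫ y, f y * D.transpose ħ ψ y := by
  simp only [transpose_apply, transferFun, transposeFun, Finset.sum_mul, Finset.mul_sum]
  rw [integral_finsetSum _ fun i _ => integrable_finsetSum _ fun j _ =>
      (D.branch_duality ħ i j f ψ).1,
    integral_finsetSum _ fun i _ => integrable_finsetSum _ fun j _ =>
      (D.branch_duality ħ i j f ψ).2.1]
  refine Finset.sum_congr rfl fun i _ => ?_
  rw [integral_finsetSum _ fun j _ => (D.branch_duality ħ i j f ψ).1,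
    integral_finsetSum _ fun j _ => (D.branch_duality ħ i j f ψ).2.1]
  exact Finset.sum_congr rfl fun j _ => (D.branch_duality ħ i j f ψ).2.2

/-- The truncated transfer operator on distributions, the extension by duality. -/
noncomputable def transfer (D : TransferData S) (ħ : ℝ) : 𝓢'(ℝ, ℂ) →L[ℂ] 𝓢'(ℝ, ℂ) :=
  PointwiseConvergenceCLM.precomp ℂ (D.transpose ħ)

end TransferData

/-! ### Semiclassical Sobolev spaces -/

/-- The operator `Op_ħ(⟨ξ⟩ ^ s)` on tempered distributions. With Mathlib's normalization
`e^{-2πi x η}` of the Fourier transform, the semiclassical frequency is `ξ = 2π ħ η`. -/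
def semiclassicalBessel (ħ s : ℝ) : 𝓢'(ℝ, ℂ) →L[ℂ] 𝓢'(ℝ, ℂ) :=
  TemperedDistribution.fourierMultiplierCLM ℂ
    (fun η : ℝ => (((1 + (2 * Real.pi * ħ * η) ^ 2) ^ (s / 2) : ℝ) : ℂ))

/-- `u ∈ H_ħ^s(ℝ)`, i.e. `Op_ħ(⟨ξ⟩ ^ s) u ∈ L²(ℝ)`. -/
def MemHSobolev (ħ s : ℝ) (u : 𝓢'(ℝ, ℂ)) : Prop :=
  ∃ f : Lp ℂ 2 (volume : Measure ℝ),
    semiclassicalBessel ħ s u = MeasureTheory.Lp.toTemperedDistribution f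

open Classical in
/-- The norm of `u ∈ H_ħ^s(ℝ)`: the `L²` norm of `Op_ħ(⟨ξ⟩ ^ s) u`. (The value is `0` for
`u ∉ H_ħ^s(ℝ)`, which is never used.) -/
def hSobolevNorm (ħ s : ℝ) (u : 𝓢'(ℝ, ℂ)) : ℝ :=
  if h : MemHSobolev ħ s u then ‖h.choose‖ else 0

/-- `T` maps `H_ħ^s(ℝ)` to itself, with operator norm at most `B`. -/
def HSobolevOpNormLE (ħ s : ℝ) (T : 𝓢'(ℝ, ℂ) →ₗ[ℂ] 𝓢'(ℝ, ℂ)) (B : ℝ) : Prop :=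
  ∀ u, MemHSobolev ħ s u →
    MemHSobolev ħ s (T u) ∧ hSobolevNorm ħ s (T u) ≤ B * hSobolevNorm ħ s u

/-- The rank one operator `|U⟩⟨s|`, that is `u ↦ ⟨u, s⟩ U`. -/
def rankOne (U : 𝓢'(ℝ, ℂ)) (s : 𝓢(ℝ, ℂ)) : 𝓢'(ℝ, ℂ) →ₗ[ℂ] 𝓢'(ℝ, ℂ) where
  toFun u := u s • U
  map_add' u v := by ext; simp [add_mul]
  map_smul' c u := by simp [mul_smul]

/-! ### Symbolic dynamics, Birkhoff sums, pressure -/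

namespace IFS

variable (S : IFS)

/-- The bi-infinite sequence `w` is an admissible word. -/
def Admissible (w : ℤ → Fin S.N) : Prop := ∀ l, S.adj (w l) (w (l + 1)) = 1

/-- The finite admissible words `w_{0,n} = (w_0, …, w_n)`. -/
abbrev Word (n : ℕ) : Type :=
  {v : Fin (n + 1) → Fin S.N // ∀ k : Fin n, S.adj (v k.castSucc) (v k.succ) = 1}

/-- The bi-infinite word `w` is an admissible extension of `w_{0,n} = v`. -/
def Extends {n : ℕ} (w : ℤ → Fin S.N) (v : S.Word n) : Prop :=
  S.Admissible w ∧ ∀ k : Fin (n + 1), w (k : ℕ) = v.1 k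

/-- The shift `L^k`; `k` may be negative. -/
def shift {S : IFS} (w : ℤ → Fin S.N) (k : ℤ) : ℤ → Fin S.N := fun l => w (l + k)

/-- The composition `φ_{w_{0,n}} = φ_{w_{n-1},w_n} ∘ ⋯ ∘ φ_{w_0,w_1}`, on `I_{w_0}`. -/
def branch (w : ℤ → Fin S.N) : ℕ → ℝ → ℝ
  | 0 => id
  | n + 1 => S.φ (w n) (w (n + 1)) ∘ branch w n

/-- The point `x_w`, defined by `⋂ n, φ_{w_{-n,0}}(I_{w_{-n}}) = {x_w}`. -/
def point (w : ℤ → Fin S.N) : ℝ :=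
  Classical.epsilon fun x =>
    ⋂ n : ℕ, S.branch (shift w (-n)) n '' S.interval (w (-n)) = {x}

/-- The univalued inverse `φ⁻¹ : φ(I) → I`. -/
def phiInv (x : ℝ) : ℝ :=
  Classical.epsilon fun y => ∃ i j, S.adj i j = 1 ∧ y ∈ S.interval i ∧ S.φ i j y = x

/-- The Jacobian function `J = log (dφ⁻¹/dx)` on `φ(I)`. -/
def J (x : ℝ) : ℝ := Real.log (derivWithin S.phiInv (S.trap 1) x)

/-- The Birkhoff sum `g_{w_{0,n}}(x_w) = ∑_{k=1}^n g(φ_{w_{0,k}}(x_w))`. -/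
def birkhoff {E : Type*} [AddCommMonoid E] (g : ℝ → E) (n : ℕ) (w : ℤ → Fin S.N) : E :=
  ∑ k ∈ Finset.Icc 1 n, g (S.branch w k (S.point w))

/-- `P` is the topological pressure of `g`: the limit of
`n⁻¹ log ∑_{w_{0,n}} exp(g_{w_{0,n}}(x_w))`, whichever extensions `w` of the words `w_{0,n}`
are chosen. -/
def IsPressure (g : ℝ → ℝ) (P : ℝ) : Prop :=
  ∀ ext : ∀ n, S.Word n → ℤ → Fin S.N, (∀ n v, S.Extends (ext n v) v) →
    Tendsto (fun n : ℕ => (n : ℝ)⁻¹ *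
      Real.log (∑ v : S.Word n, Real.exp (S.birkhoff g n (ext n v)))) atTop (𝓝 P)

/-! ### The normal form coordinates -/

/-- The interval `I_{w_0} - x_w`. -/
def localInterval (w : ℤ → Fin S.N) : Set ℝ := {z | S.point w + z ∈ S.interval (w 0)}

/-- The inverse `H_w⁻¹` of the linearizing diffeomorphism, on `I_{w_0} - x_w`. With
`f_{w_{0,n}}(z) = φ_{w_{0,n}}(x_w + z) - x_{L^n w}` it is the limit of
`z ↦ exp(J_{w_{0,n}}(x_w)) f_{w_{0,n}}(z)`, so `H_w` is the limit of
`z ↦ f_{w_{0,n}}⁻¹(exp(-J_{w_{0,n}}(x_w)) z)`. -/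
def Hinv (w : ℤ → Fin S.N) (z : ℝ) : ℝ :=
  limUnder atTop fun n : ℕ => Real.exp (S.birkhoff S.J n w) *
    (S.branch w n (S.point w + z) - S.point (shift w n))

/-- The diffeomorphism `H_w`, on the image of `I_{w_0} - x_w` under `H_w⁻¹`; it satisfies
`H_w(0) = 0` and `H_w'(0) = 1`. -/
def H (w : ℤ → Fin S.N) : ℝ → ℝ := Function.invFunOn (S.Hinv w) (S.localInterval w)

end IFS

namespace TransferData

variable {S : IFS} (D : TransferData S)

/-- The function `Υ_w(y) = - ∑_{k ≥ 0} (𝒱(φ_{w_{0,k+1}}(y)) - 𝒱(x_{L^{k+1} w}))` on `I_{w_0}`. -/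
def upsilon (ħ : ℝ) (w : ℤ → Fin S.N) (y : ℝ) : ℂ :=
  -∑' k : ℕ, (D.phase ħ (S.branch w (k + 1) y) -
    D.phase ħ (S.point (IFS.shift w ((k : ℤ) + 1))))

/-! The operator `𝒯_w` is `(𝒯_w f)(y) = exp(i Υ_w(y) / ħ) f(H_w⁻¹(y - x_w))`. It acts on
distributions by duality: its transpose for the pairing `∫ f ψ` is
`(𝒯_wᵗ ψ)(z) = H_w'(z) exp(i Υ_w(x_w + H_w(z)) / ħ) ψ(x_w + H_w(z))`, and the transpose of
`𝒯_w⁻¹` is `((𝒯_w⁻¹)ᵗ g)(y) = (H_w⁻¹)'(y - x_w) exp(-i Υ_w(y) / ħ) g(H_w⁻¹(y - x_w))`. -/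

/-- The transpose of `𝒯_w`. -/
def conjTranspose (ħ : ℝ) (w : ℤ → Fin S.N) (ψ : ℝ → ℂ) (z : ℝ) : ℂ :=
  derivWithin (S.H w) (S.Hinv w '' S.localInterval w) z *
    Complex.exp (Complex.I / ħ * D.upsilon ħ w (S.point w + S.H w z)) *
    ψ (S.point w + S.H w z)

open Classical in
/-- The transpose of `𝒯_w⁻¹`, extended by `0` off `I_{w_0}`. -/
def conjInvTranspose (ħ : ℝ) (w : ℤ → Fin S.N) (g : ℝ → ℂ) (y : ℝ) : ℂ :=
  if y ∈ S.interval (w 0) then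
    derivWithin (S.Hinv w) (S.localInterval w) (y - S.point w) *
      Complex.exp (-(Complex.I / ħ * D.upsilon ħ w y)) * g (S.Hinv w (y - S.point w))
  else 0

/-- `U` is the state `χ⁻¹ 𝒯_w ((1 / k!) δ^(k))`, where `δ^(k)` is the functional
`ψ ↦ ψ^(k)(0)`. -/
def IsUnstableState (ħ : ℝ) (k : ℕ) (w : ℤ → Fin S.N) (U : 𝓢'(ℝ, ℂ)) : Prop :=
  ∀ ψ : 𝓢(ℝ, ℂ), U ψ = (k.factorial : ℂ)⁻¹ *
    iteratedDeriv k (D.conjTranspose ħ w fun y => (D.χ y : ℂ)⁻¹ * ψ y) 0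

/-- `s` is the state `⟨x^k| 𝒯_w⁻¹ χ`, as the function representing the functional
`u ↦ ∫ z^k (𝒯_w⁻¹ χ u)(z) dz`. -/
def IsStableState (ħ : ℝ) (k : ℕ) (w : ℤ → Fin S.N) (s : 𝓢(ℝ, ℂ)) : Prop :=
  ∀ y, s y = D.χ y * D.conjInvTranspose ħ w (fun z => (z : ℂ) ^ k) y

/-- The expansion of order `d`: the sum over the words `w_{0,n}`, with the chosen extensions
`w = ext w_{0,n}`, of
`exp(i 𝒱_{w_{0,n}} / ħ) ∑_{k=0}^d exp(-(k+1) J_{w_{0,n}}) |U_{L^n w}^(k)⟩⟨S_w^(k)|`. -/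
def expansion (ħ : ℝ) (n d : ℕ) (ext : S.Word n → ℤ → Fin S.N)
    (U : ℕ → (ℤ → Fin S.N) → 𝓢'(ℝ, ℂ)) (s : ℕ → (ℤ → Fin S.N) → 𝓢(ℝ, ℂ)) :
    𝓢'(ℝ, ℂ) →ₗ[ℂ] 𝓢'(ℝ, ℂ) :=
  ∑ v : S.Word n, Complex.exp (Complex.I / ħ * S.birkhoff (D.phase ħ) n (ext v)) •
    ∑ k ∈ Finset.range (d + 1),
      ((Real.exp (-((k : ℝ) + 1) * S.birkhoff S.J n (ext v)) : ℝ) : ℂ) •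
        rankOne (U k (IFS.shift (ext v) n)) (s k (ext v))

end TransferData

end

/-! The estimate is proved on test functions. Since $H_\hbar^{-m}$ is dual to $H_\hbar^m$, it is
enough to bound the transpose of the remainder on Schwartz functions in the $H_\hbar^m$ norm
(`hSobolevOpNormLE_of_transpose`). The transpose of $\mathcal L^n$ splits over the words
(`transpose_pow_eq_sum`), and a word $w$ acts by $\psi\mapsto e^{\frac i\hbar\mathcal
V_w}e^{-J_w}\cdot(\text{amplitude})\cdot\psi\circ\phi_w$ (`wordTransfer_eq`). The amplitudes and
their derivatives $(\hbar\,d/dx)^j$ are bounded uniformly in the word and its length, because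
contraction turns sums along orbits into geometric series (`exists_hbound_dbranch`,
`exists_hbound_orbitDiff`, `exists_hbound_amplitude`).

Fix a word and put $r=e^{-J_w}$. The coordinate `hcoord` linearizes $\phi_w$ exactly
(`hcoord_branch`) and the cocycle $\Upsilon$ absorbs the phase, so that in these coordinates the
word is $\tilde\psi(z)\mapsto\tilde\psi(rz)$ up to fixed factors (`wordTransfer_eq_conjugated`). The
states $\mathcal U^{(k)}$ are the Taylor coefficients of $\tilde\psi$ at $0$ and the states
$\mathcal S^{(k)}$ are the monomials $z^k$. Subtracting the rank one operators therefore leaves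
exactly a Taylor remainder of order $d+1$ at $rz$ (`wordRemainder_eq_taylorRem`), of size
$r^{d+1}\sup|\tilde\psi^{(d+1)}|$. The prefactor $e^{-J_w}$ supplies one more power of $r$. The
supremum is controlled by the $H_\hbar^m$ norm because $m>d+\frac32$, at the price $\hbar^{-(d+1)}$
for the derivatives and $\hbar^{-1/2}$ for the embedding (`exists_wienerENorm_le`).

The $H_\hbar^m$ norm of the remainder also sees derivatives of order above $d+1$, so $\psi$ is split
at $\langle\xi\rangle\sim r^{-1}$. On low frequencies a derivative of order $i>d+1$ costs at most
$r^{-(i-d-1)}$, which the scaling $z\mapsto rz$ gives back (`HBound.taylorRem_comp`,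
`exists_wordRemainder_low_le`). On high frequencies no cancellation is needed. Interpolation between
$L^2$ and an integer order $M>m$ bounds the word by $r^{1/2}r^m\le r^{d+2}$ (`exists_interpolation`,
`exists_wordTransfer_high_le`), and the $k$-th rank one term is at most $r^{k+1}r^{d+1-k}$
(`exists_rankOne_high_le`). The normal form requires $\chi$ to be bounded below on the image of
$\phi_w$, which holds for $n>a$. For $n\le a$ the number $r$ is bounded below, and the high
frequency estimate applies to all of $\psi$ (`exists_wordRemainder_le`).

Each word thus contributes $|e^{\frac i\hbar\mathcal V_w}|\,r^{d+2}$, the exponential of the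
Birkhoff sum of $\mathrm{Re}\,V-(d+2)J$, and the sum over words is a partition function. Bounded
distortion makes it almost independent of the extensions and almost submultiplicative, so Fekete's
lemma gives both the pressure and the error $R(n)$ (`exists_pressure`). -/

noncomputable section

/-! ### Calculus of semiclassical bounds on derivatives. -/

/-- `f` is `n` times differentiable on `I`, and `‖f‖, ‖ħ f'‖, …, ‖ħⁿ f⁽ⁿ⁾‖` are bounded by the
function `b` there. -/
def HBound (ħ : ℝ) (I : Set ℝ) : ℕ → (ℝ → ℝ) → (ℝ → ℂ) → Prop
  | 0, b, f => ∀ y ∈ I, ‖f y‖ ≤ b y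
  | n + 1, b, f => (∀ y ∈ I, ‖f y‖ ≤ b y) ∧
      ∃ g : ℝ → ℂ, (∀ y ∈ I, HasDerivWithinAt f (g y) I y) ∧
        HBound ħ I n b (fun y => (ħ : ℂ) * g y)

namespace HBound

variable {ħ : ℝ} {I J : Set ℝ} {n : ℕ} {b b' : ℝ → ℝ} {f g : ℝ → ℂ}

theorem norm_le (h : HBound ħ I n b f) : ∀ y ∈ I, ‖f y‖ ≤ b y := by
  cases n with
  | zero => exact h
  | succ n => exact h.1

theorem of_succ : ∀ {n : ℕ} {f : ℝ → ℂ}, HBound ħ I (n + 1) b f → HBound ħ I n b f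
  | 0, _, h => h.1
  | _ + 1, _, h => ⟨h.1, h.2.choose, h.2.choose_spec.1, of_succ h.2.choose_spec.2⟩

theorem mono_order {m : ℕ} (h : HBound ħ I n b f) (hmn : m ≤ n) : HBound ħ I m b f := by
  induction hmn with
  | refl => exact h
  | step _ ih => exact ih h.of_succ

theorem mono : ∀ {n : ℕ} {f : ℝ → ℂ}, HBound ħ I n b f → (∀ y ∈ I, b y ≤ b' y) →
    HBound ħ I n b' f
  | 0, _, h, hb => fun y hy => (h y hy).trans (hb y hy)
  | _ + 1, _, h, hb => ⟨fun y hy => (h.1 y hy).trans (hb y hy), h.2.choose,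
      h.2.choose_spec.1, mono h.2.choose_spec.2 hb⟩

theorem congr : ∀ {n : ℕ} {f g : ℝ → ℂ}, HBound ħ I n b f → (∀ y ∈ I, g y = f y) →
    HBound ħ I n b g
  | 0, _, _, h, e => fun y hy => (e y hy).symm ▸ h y hy
  | _ + 1, _, _, h, e => ⟨fun y hy => (e y hy).symm ▸ h.1 y hy, h.2.choose, fun y hy =>
      (h.2.choose_spec.1 y hy).congr e (e y hy), h.2.choose_spec.2⟩

theorem mono_set : ∀ {n : ℕ} {f : ℝ → ℂ}, HBound ħ I n b f → J ⊆ I → HBound ħ J n b f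
  | 0, _, h, hJ => fun y hy => h y (hJ hy)
  | _ + 1, _, h, hJ => ⟨fun y hy => h.1 y (hJ hy), h.2.choose, fun y hy =>
      (h.2.choose_spec.1 y (hJ hy)).mono hJ, mono_set h.2.choose_spec.2 hJ⟩

theorem add : ∀ {n : ℕ} {f g : ℝ → ℂ}, HBound ħ I n b f → HBound ħ I n b' g →
    HBound ħ I n (fun y => b y + b' y) fun y => f y + g y
  | 0, _, _, hf, hg => fun y hy => (norm_add_le _ _).trans (add_le_add (hf y hy) (hg y hy))
  | n + 1, _, _, hf, hg => by
    obtain ⟨hf0, f', hf', hf1⟩ := hf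
    obtain ⟨hg0, g', hg', hg1⟩ := hg
    refine ⟨fun y hy => (norm_add_le _ _).trans (add_le_add (hf0 y hy) (hg0 y hy)),
      fun y => f' y + g' y, fun y hy => (hf' y hy).add (hg' y hy), ?_⟩
    exact (add hf1 hg1).congr fun y _ => by ring

theorem const_mul (c : ℂ) : ∀ {n : ℕ} {f : ℝ → ℂ}, HBound ħ I n b f →
    HBound ħ I n (fun y => ‖c‖ * b y) fun y => c * f y
  | 0, _, hf => fun y hy => by
    rw [norm_mul]; exact mul_le_mul_of_nonneg_left (hf y hy) (norm_nonneg c)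
  | n + 1, _, hf => by
    obtain ⟨hf0, f', hf', hf1⟩ := hf
    refine ⟨fun y hy => ?_, fun y => c * f' y, fun y hy => (hf' y hy).const_mul c, ?_⟩
    · rw [norm_mul]; exact mul_le_mul_of_nonneg_left (hf0 y hy) (norm_nonneg c)
    · exact (const_mul c hf1).congr fun y _ => by ring

theorem neg (hf : HBound ħ I n b f) : HBound ħ I n b fun y => -f y :=
  ((hf.const_mul (-1)).congr fun y _ => by ring).mono fun y _ => by simp

theorem const {n : ℕ} (c : ℂ) : HBound ħ I n (fun _ => ‖c‖) fun _ => c := by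
  have zero : ∀ n, HBound ħ I n (fun _ => ‖c‖) fun _ => 0 := by
    intro n
    induction n with
    | zero => exact fun y _ => by simp
    | succ n ih =>
      exact ⟨fun y _ => by simp, fun _ => 0, fun y _ => hasDerivWithinAt_const _ _ _,
        ih.congr fun y _ => by simp⟩
  cases n with
  | zero => exact fun y _ => le_rfl
  | succ n => exact ⟨fun y _ => le_rfl, fun _ => 0, fun y _ => hasDerivWithinAt_const _ _ _,
        (zero n).congr fun y _ => by simp⟩

theorem sum {ι : Type*} (s : Finset ι) {f : ι → ℝ → ℂ} {b : ι → ℝ → ℝ}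
    (h : ∀ i ∈ s, HBound ħ I n (b i) (f i)) :
    HBound ħ I n (fun y => ∑ i ∈ s, b i y) fun y => ∑ i ∈ s, f i y := by
  classical
  induction s using Finset.induction_on with
  | empty => simpa using const (ħ := ħ) (I := I) (n := n) 0
  | insert a s ha ih =>
    simp only [Finset.sum_insert ha]
    exact (h a (Finset.mem_insert_self a s)).add
      (ih fun i hi => h i (Finset.mem_insert_of_mem hi))

/-- Leibniz rule: every differentiation doubles the number of terms, hence $2^n$. Only the second
factor has a constant bound. The first keeps a bound depending on the point, so that an expression
in the derivatives of a test function can be carried along and put into $L^2$ at the end. -/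
theorem mul {B : ℝ} (hB : 0 ≤ B) : ∀ {n : ℕ} {f g : ℝ → ℂ}, HBound ħ I n b f →
    HBound ħ I n (fun _ => B) g →
    HBound ħ I n (fun y => 2 ^ n * B * b y) fun y => f y * g y
  | 0, f, g, hf, hg => fun y hy => by
    rw [norm_mul]
    simp only [pow_zero, one_mul]
    rw [mul_comm B]
    exact mul_le_mul (hf y hy) (hg y hy) (norm_nonneg _) ((norm_nonneg _).trans (hf y hy))
  | n + 1, f, g, hf, hg => by
    have hf2 := hf.of_succ
    have hg2 := hg.of_succ
    obtain ⟨hf0, f', hf', hf1⟩ := hf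
    obtain ⟨hg0, g', hg', hg1⟩ := hg
    refine ⟨fun y hy => ?_, fun y => f' y * g y + f y * g' y,
      fun y hy => (hf' y hy).mul (hg' y hy), ?_⟩
    · have h0 := (norm_nonneg _).trans (hf0 y hy)
      have h1 : (1 : ℝ) ≤ 2 ^ (n + 1) := one_le_pow₀ (by norm_num)
      rw [norm_mul]
      calc ‖f y‖ * ‖g y‖ ≤ b y * B := mul_le_mul (hf0 y hy) (hg0 y hy) (norm_nonneg _) h0
        _ ≤ 2 ^ (n + 1) * (b y * B) := le_mul_of_one_le_left (by positivity) h1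
        _ = _ := by ring
    · refine (((mul hB hf1 hg2).add (mul hB hf2 hg1)).congr fun y _ => ?_).mono fun y _ => ?_
      · ring
      · exact le_of_eq (by ring)

/-- Rescaling of the semiclassical parameter. -/
theorem rescale {K B : ℝ} (hħ : 0 ≤ ħ) (hK : ħ ≤ K) (hK1 : 1 ≤ K) (hB : 0 ≤ B) :
    ∀ {n : ℕ} {f : ℝ → ℂ}, HBound 1 I n (fun _ => B) f →
    HBound ħ I n (fun _ => K ^ n * B) f
  | 0, _, h => fun y hy => by simpa using h y hy
  | n + 1, f, h => by
    obtain ⟨h0, f', hf', h1⟩ := h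
    refine ⟨fun y hy => (h0 y hy).trans (le_mul_of_one_le_left hB (one_le_pow₀ hK1)), f', hf', ?_⟩
    refine (((rescale hħ hK hK1 hB h1).const_mul ħ).congr fun y _ => by simp).mono fun y _ => ?_
    rw [Complex.norm_real, Real.norm_eq_abs, abs_of_nonneg hħ, pow_succ', mul_assoc]
    exact mul_le_mul_of_nonneg_right hK (by positivity)

/-- Chain rule: composition of a finite tower of derivatives with a map whose derivative is
`r * q`. -/
theorem comp (hħ : 0 ≤ ħ) {r B : ℝ} (hr : 0 ≤ r) (hB : 0 ≤ B) {φ q : ℝ → ℝ}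
    (hφ : MapsTo φ I J) (hd : ∀ y ∈ I, HasDerivWithinAt φ (r * q y) I y) :
    ∀ {n : ℕ} {F : ℕ → ℝ → ℂ}, (∀ i < n, ∀ z ∈ J, HasDerivWithinAt (F i) (F (i + 1) z) J z) →
    HBound ħ I (n - 1) (fun _ => B) (fun y => (q y : ℂ)) →
    HBound ħ I n (fun y => (1 + 2 ^ n * B) ^ n *
      ∑ i ∈ Finset.range (n + 1), (r * ħ) ^ i * ‖F i (φ y)‖) fun y => F 0 (φ y) := by
  intro n
  induction n with
  | zero => intro F _ _ y _; simp
  | succ n ih =>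
    intro F hF hq
    simp only [Nat.add_sub_cancel] at hq
    have hone : 1 ≤ (1 + 2 ^ (n + 1) * B) ^ (n + 1) :=
      one_le_pow₀ (le_add_of_nonneg_right (by positivity))
    refine ⟨fun y hy => ?_, fun y => r * (F 1 (φ y) * q y), fun y hy => ?_, ?_⟩
    · calc ‖F 0 (φ y)‖ = (r * ħ) ^ 0 * ‖F 0 (φ y)‖ := by simp
        _ ≤ ∑ i ∈ Finset.range (n + 1 + 1), (r * ħ) ^ i * ‖F i (φ y)‖ :=
          Finset.single_le_sum (f := fun i => (r * ħ) ^ i * ‖F i (φ y)‖)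
            (fun i _ => by positivity) (by simp)
        _ ≤ _ := le_mul_of_one_le_left (Finset.sum_nonneg fun i _ => by positivity) hone
    · have := HasDerivWithinAt.scomp y (hF 0 (by omega) (φ y) (hφ hy)) (hd y hy) hφ
      refine this.congr_deriv ?_
      simp only [Complex.real_smul, Complex.ofReal_mul]
      ring
    · have h1 := ih (F := fun i => F (i + 1)) (fun i hi => hF (i + 1) (by omega))
        (hq.mono_order (by omega))
      have h2 := ((h1.mul hB hq).const_mul ((r * ħ : ℝ) : ℂ))
      refine (h2.congr fun y _ => ?_).mono fun y _ => ?_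
      · push_cast; ring
      · rw [Complex.norm_real, Real.norm_eq_abs, abs_of_nonneg (by positivity),
          Finset.sum_range_succ' _ (n + 1)]
        have hS : 0 ≤ ∑ i ∈ Finset.range (n + 1), (r * ħ) ^ (i + 1) * ‖F (i + 1) (φ y)‖ :=
          Finset.sum_nonneg fun i _ => by positivity
        have e : r * ħ * (2 ^ n * B * ((1 + 2 ^ n * B) ^ n *
            ∑ i ∈ Finset.range (n + 1), (r * ħ) ^ i * ‖F (i + 1) (φ y)‖)) =
            (2 ^ n * B) * (1 + 2 ^ n * B) ^ n *
            ∑ i ∈ Finset.range (n + 1), (r * ħ) ^ (i + 1) * ‖F (i + 1) (φ y)‖ := by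
          rw [Finset.mul_sum, Finset.mul_sum, Finset.mul_sum, Finset.mul_sum]
          refine Finset.sum_congr rfl fun i _ => by ring
        rw [e]
        have hp : (2:ℝ) ^ n * B ≤ 2 ^ (n + 1) * B := by
          rw [pow_succ]; nlinarith [pow_pos (two_pos (α := ℝ)) n]
        calc _ ≤ (1 + 2 ^ (n + 1) * B) * (1 + 2 ^ (n + 1) * B) ^ n *
            ∑ i ∈ Finset.range (n + 1), (r * ħ) ^ (i + 1) * ‖F (i + 1) (φ y)‖ := by
              gcongr; linarith
          _ ≤ _ := by
            rw [← pow_succ']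
            refine mul_le_mul_of_nonneg_left ?_ (by positivity)
            have : 0 ≤ (r * ħ) ^ 0 * ‖F 0 (φ y)‖ := by positivity
            linarith

/-- Solutions of linear differential equations. -/
theorem of_ode (n : ℕ) (B C : ℝ) (hB : 0 ≤ B) (hC : 0 ≤ C) : ∃ K, 0 ≤ K ∧ ∀ (ħ : ℝ) (I : Set ℝ)
    (u u' q : ℝ → ℂ), (∀ y ∈ I, HasDerivWithinAt u (u' y) I y) → (∀ y ∈ I, ħ * u' y = q y * u y) →
    HBound ħ I n (fun _ => B) q → (∀ y ∈ I, ‖u y‖ ≤ C) → HBound ħ I (n + 1) (fun _ => K) u := by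
  induction n with
  | zero =>
    refine ⟨max C (B * C), le_max_of_le_left hC, fun ħ I u u' q hu hq hqB huC => ?_⟩
    refine ⟨fun y hy => (huC y hy).trans (le_max_left _ _), u', hu, fun y hy => ?_⟩
    simp only
    rw [hq y hy, norm_mul]
    exact (mul_le_mul (hqB y hy) (huC y hy) (norm_nonneg _) hB).trans (le_max_right _ _)
  | succ n ih =>
    obtain ⟨K, hK, h⟩ := ih
    refine ⟨max C (2 ^ (n + 1) * B * K), le_max_of_le_left hC,
      fun ħ I u u' q hu hq hqB huC => ?_⟩
    refine ⟨fun y hy => (huC y hy).trans (le_max_left _ _), u', hu, ?_⟩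
    -- Bootstrap: the bound of order `n + 1` on `u`, inserted into the equation, bounds $\hbar
    -- u'=qu$ to order `n + 1`, which is order `n + 2` for `u`.
    have h1 := h ħ I u u' q hu hq hqB.of_succ huC
    exact ((h1.mul hB hqB).congr fun y hy => by rw [hq y hy]; ring).mono
      fun y _ => le_max_right _ _

/-- Since $(1/u)'=-u'/u^2$, derivatives of the inverse need only derivatives of $u$ and the sup
bound on $1/u$, by induction on the order. -/
theorem of_inv (n : ℕ) (B C : ℝ) (hC : 0 ≤ C) : ∃ K, 0 ≤ K ∧ ∀ (ħ : ℝ) (I : Set ℝ)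
    (u : ℝ → ℂ), HBound ħ I n (fun _ => B) u → (∀ y ∈ I, u y ≠ 0) →
    (∀ y ∈ I, ‖(u y)⁻¹‖ ≤ C) → HBound ħ I n (fun _ => K) fun y => (u y)⁻¹ := by
  induction n with
  | zero => exact ⟨C, hC, fun ħ I u _ _ h => h⟩
  | succ n ih =>
    obtain ⟨K, hK, h⟩ := ih
    refine ⟨max C (2 ^ n * K * (2 ^ n * K * B)), le_max_of_le_left hC, fun ħ I u hu h0 hi => ?_⟩
    have h1 := h ħ I u hu.of_succ h0 hi
    obtain ⟨-, u', hu', hu1⟩ := hu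
    refine ⟨fun y hy => (hi y hy).trans (le_max_left _ _), fun y => -u' y / u y ^ 2,
      fun y hy => (hu' y hy).inv (h0 y hy), ?_⟩
    refine ((((hu1.mul hK h1).mul hK h1).neg).congr fun y hy => ?_).mono fun y _ => le_max_right _ _
    have := h0 y hy
    field_simp

/-- Extraction of the bounds on the iterated derivatives. -/
theorem iteratedDerivWithin_le (hI : UniqueDiffOn ℝ I) :
    ∀ {n i : ℕ} {f : ℝ → ℂ}, HBound ħ I n b f → i ≤ n → ∀ y ∈ I,
      |ħ| ^ i * ‖iteratedDerivWithin i f I y‖ ≤ b y := by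
  intro n
  induction n with
  | zero =>
    intro i f h hi y hy
    obtain rfl : i = 0 := by omega
    simpa using h y hy
  | succ n ih =>
    intro i f h hi y hy
    cases i with
    | zero => simpa using h.1 y hy
    | succ i =>
      obtain ⟨-, g, hg, h1⟩ := h
      have e : iteratedDerivWithin (i + 1) f I y = iteratedDerivWithin i g I y := by
        rw [iteratedDerivWithin_succ']
        exact iteratedDerivWithin_congr (fun z hz => (hg z hz).derivWithin (hI z hz)) hy
      have := ih h1 (i := i) (by omega) y hy
      rw [iteratedDerivWithin_const_mul_field, norm_mul, Complex.norm_real,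
        Real.norm_eq_abs] at this
      rw [e, pow_succ, mul_assoc]
      exact this

theorem hasDerivWithinAt_iteratedDerivWithin (hI : UniqueDiffOn ℝ I) (hħ : ħ ≠ 0) :
    ∀ {n i : ℕ} {f : ℝ → ℂ}, HBound ħ I n b f → i < n → ∀ y ∈ I,
      HasDerivWithinAt (iteratedDerivWithin i f I) (iteratedDerivWithin (i + 1) f I y) I y := by
  intro n
  induction n with
  | zero => intro i f h hi; omega
  | succ n ih =>
    intro i f h hi y hy
    obtain ⟨-, g, hg, h1⟩ := h
    have e : ∀ j, ∀ z ∈ I, iteratedDerivWithin (j + 1) f I z = iteratedDerivWithin j g I z := by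
      intro j z hz
      rw [iteratedDerivWithin_succ']
      exact iteratedDerivWithin_congr (fun z hz => (hg z hz).derivWithin (hI z hz)) hz
    cases i with
    | zero =>
      rw [e 0 y hy]
      simpa using hg y hy
    | succ i =>
      have := ih h1 (i := i) (by omega) y hy
      have e2 : ∀ j, iteratedDerivWithin j (fun y => (ħ : ℂ) * g y) I =
          fun z => (ħ : ℂ) * iteratedDerivWithin j g I z := fun j =>
        funext fun z => iteratedDerivWithin_const_mul_field _ _
      rw [e2, e2] at this
      have h3 := this.const_mul (ħ : ℂ)⁻¹
      have hc : (ħ : ℂ) ≠ 0 := by exact_mod_cast hħ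
      rw [e (i + 1) y hy]
      refine (h3.congr_deriv ?_).congr (fun z hz => ?_) ?_
      · field_simp
      · rw [e i z hz]; field_simp
      · rw [e i y hy]; field_simp

theorem continuousOn (h : HBound ħ I (n + 1) b f) : ContinuousOn f I := fun y hy =>
  (h.2.choose_spec.1 y hy).continuousWithinAt

/-- Sums of series. -/
theorem tsum (hI : Convex ℝ I) {a : ℕ → ℝ} (ha : Summable a) : ∀ {n : ℕ} {f : ℕ → ℝ → ℂ},
    (∀ k, HBound 1 I n (fun _ => a k) (f k)) →
    HBound 1 I n (fun _ => ∑' k, a k) fun y => ∑' k, f k y := by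
  have base : ∀ {f : ℕ → ℝ → ℂ}, (∀ k, ∀ y ∈ I, ‖f k y‖ ≤ a k) → ∀ y ∈ I,
      ‖∑' k, f k y‖ ≤ ∑' k, a k := fun h y hy =>
    tsum_of_norm_bounded ha.hasSum fun k => h k y hy
  intro n
  induction n with
  | zero => exact fun h => base h
  | succ n ih =>
    intro f h
    refine ⟨base fun k => (h k).norm_le, ?_⟩
    choose h0 g hg h1 using h
    refine ⟨fun y => ∑' k, g k y, fun y hy => ?_, ?_⟩
    · have hgb : ∀ k, ∀ z ∈ I, ‖g k z‖ ≤ a k := fun k z hz => by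
        simpa using (h1 k).norm_le z hz
      rw [hasDerivWithinAt_iff_tendsto_slope]
      -- Termwise differentiation by dominated convergence of the difference quotients. The mean
      -- value inequality on the convex set bounds the $k$-th quotient by $a_k$.
      have key : Tendsto (fun z => ∑' k, slope (f k) y z) (𝓝[I \ {y}] y) (𝓝 (∑' k, g k y)) := by
        refine tendsto_tsum_of_dominated_convergence ha
          (fun k => hasDerivWithinAt_iff_tendsto_slope.mp (hg k y hy)) ?_
        filter_upwards [self_mem_nhdsWithin] with z hz k
        have := hI.norm_image_sub_le_of_norm_hasDerivWithin_le (hg k) (hgb k) hy hz.1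
        rw [slope_def_module, norm_smul, norm_inv]
        have hz' : 0 < ‖z - y‖ := norm_pos_iff.mpr (sub_ne_zero.mpr hz.2)
        rw [inv_mul_le_iff₀ hz', mul_comm]
        exact this
      refine key.congr' ?_
      filter_upwards [self_mem_nhdsWithin] with z hz
      have s1 : ∀ x ∈ I, Summable fun k => f k x := fun x hx =>
        Summable.of_norm_bounded ha fun k => h0 k x hx
      simp only [slope_def_module]
      rw [← (s1 z hz.1).tsum_sub (s1 y hy), tsum_const_smul'']
    · exact (ih h1).congr fun y _ => by simp

theorem of_contDiffOn (hI : UniqueDiffOn ℝ I) (hc : IsCompact I) (n : ℕ) : ∀ {f : ℝ → ℂ},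
    ContDiffOn ℝ ∞ f I → ∃ B, 0 ≤ B ∧ HBound 1 I n (fun _ => B) f := by
  induction n with
  | zero =>
    intro f hf
    obtain ⟨B, hB⟩ := hc.exists_bound_of_continuousOn hf.continuousOn
    exact ⟨max B 0, le_max_right _ _, fun y hy => (hB y hy).trans (le_max_left _ _)⟩
  | succ n ih =>
    intro f hf
    obtain ⟨B, hB⟩ := hc.exists_bound_of_continuousOn hf.continuousOn
    obtain ⟨B', hB', h⟩ := ih (hf.derivWithin hI (m := ∞) (by simp))
    refine ⟨max B B', le_max_of_le_right hB', fun y hy => (hB y hy).trans (le_max_left _ _),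
      derivWithin f I, fun y hy => ?_, ?_⟩
    · exact ((hf y hy).differentiableWithinAt (by simp)).hasDerivWithinAt
    · exact (h.congr fun y _ => by simp).mono fun y _ => le_max_right _ _

end HBound

end

noncomputable section

open scoped FourierTransform ENNReal

/-! ### Semiclassical Sobolev norms of Schwartz functions -/

/-- The bracket `⟨ξ⟩` at `ξ = 2 π ħ η`. -/
def bracket (ħ η : ℝ) : ℝ := Real.sqrt (1 + (2 * Real.pi * ħ * η) ^ 2)

theorem one_le_bracket (ħ η : ℝ) : 1 ≤ bracket ħ η := by
  rw [bracket, Real.one_le_sqrt]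
  nlinarith [sq_nonneg (2 * Real.pi * ħ * η)]

theorem bracket_pos (ħ η : ℝ) : 0 < bracket ħ η := one_pos.trans_le (one_le_bracket ħ η)

theorem bracket_rpow (ħ η s : ℝ) :
    bracket ħ η ^ s = (1 + (2 * Real.pi * ħ * η) ^ 2) ^ (s / 2) := by
  rw [bracket, Real.sqrt_eq_rpow, ← Real.rpow_mul (by positivity)]
  congr 1
  ring

theorem continuous_bracket (ħ : ℝ) : Continuous (bracket ħ) := by
  unfold bracket
  fun_prop

theorem abs_le_bracket (ħ η : ℝ) : |2 * Real.pi * ħ * η| ≤ bracket ħ η :=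
  Real.abs_le_sqrt (by linarith)

theorem hasTemperateGrowth_bracket_rpow (ħ s : ℝ) :
    (fun η : ℝ => ((bracket ħ η ^ s : ℝ) : ℂ)).HasTemperateGrowth := by
  have h1 : (fun η : ℝ => ((1 + ‖(2 * Real.pi * ħ) * η‖ ^ 2) ^ (s / 2) : ℝ)).HasTemperateGrowth :=
    (Function.hasTemperateGrowth_one_add_norm_sq_rpow ℝ (s / 2)).comp
      (f := fun η : ℝ => (2 * Real.pi * ħ) * η) (by fun_prop)
  have h2 : (fun η : ℝ => (((1 + ‖(2 * Real.pi * ħ) * η‖ ^ 2) ^ (s / 2) : ℝ) : ℂ)).HasTemperateGrowth := by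
    fun_prop
  convert h2 using 2 with η
  simp [bracket_rpow, mul_pow]

/-- The transpose of `semiclassicalBessel`. -/
def besselTest (ħ s : ℝ) (ψ : 𝓢(ℝ, ℂ)) : 𝓢(ℝ, ℂ) :=
  𝓕 (SchwartzMap.smulLeftCLM ℂ (fun η : ℝ => ((bracket ħ η ^ s : ℝ) : ℂ)) (𝓕⁻ ψ))

theorem semiclassicalBessel_eq (ħ s : ℝ) : semiclassicalBessel ħ s =
    TemperedDistribution.fourierMultiplierCLM ℂ
      (fun η : ℝ => ((bracket ħ η ^ s : ℝ) : ℂ)) := by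
  simp only [semiclassicalBessel, bracket_rpow]

theorem semiclassicalBessel_apply (ħ s : ℝ) (u : 𝓢'(ℝ, ℂ)) (ψ : 𝓢(ℝ, ℂ)) :
    semiclassicalBessel ħ s u ψ = u (besselTest ħ s ψ) := by
  rw [semiclassicalBessel_eq]; rfl

theorem fourierInv_besselTest (ħ s : ℝ) (ψ : 𝓢(ℝ, ℂ)) (η : ℝ) :
    𝓕⁻ (besselTest ħ s ψ) η = ((bracket ħ η ^ s : ℝ) : ℂ) * 𝓕⁻ ψ η := by
  rw [besselTest, FourierTransform.fourierInv_fourier_eq (F := 𝓢(ℝ, ℂ)),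
    SchwartzMap.smulLeftCLM_apply_apply (hasTemperateGrowth_bracket_rpow ħ s), smul_eq_mul]

theorem ext_fourierInv {ψ φ : 𝓢(ℝ, ℂ)} (h : ∀ η, 𝓕⁻ ψ η = 𝓕⁻ φ η) : ψ = φ := by
  have : (𝓕⁻ ψ : 𝓢(ℝ, ℂ)) = 𝓕⁻ φ := SchwartzMap.ext h
  have h2 : ∀ ψ : 𝓢(ℝ, ℂ), 𝓕 (𝓕⁻ ψ : 𝓢(ℝ, ℂ)) = ψ := FourierTransform.fourier_fourierInv_eq
  rw [← h2 ψ, this, h2]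

theorem besselTest_besselTest (ħ s t : ℝ) (ψ : 𝓢(ℝ, ℂ)) :
    besselTest ħ s (besselTest ħ t ψ) = besselTest ħ (s + t) ψ := by
  refine ext_fourierInv fun η => ?_
  rw [fourierInv_besselTest, fourierInv_besselTest, fourierInv_besselTest,
    Real.rpow_add (bracket_pos ħ η)]
  push_cast
  ring

theorem besselTest_zero (ħ : ℝ) (ψ : 𝓢(ℝ, ℂ)) : besselTest ħ 0 ψ = ψ :=
  ext_fourierInv fun η => by rw [fourierInv_besselTest]; simp

/-- The norm of a Schwartz function in `H_ħ^s(ℝ)`. -/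
def sobolevENorm (ħ s : ℝ) (ψ : 𝓢(ℝ, ℂ)) : ℝ≥0∞ :=
  eLpNorm (fun η => ((bracket ħ η ^ s : ℝ) : ℂ) * 𝓕⁻ ψ η) 2 volume

theorem eLpNorm_fourierInv (ψ : 𝓢(ℝ, ℂ)) :
    eLpNorm (fun η => 𝓕⁻ ψ η) 2 volume = eLpNorm (fun x => ψ x) 2 volume := by
  have h := SchwartzMap.norm_fourier_toL2_eq (𝓕⁻ ψ)
  rw [FourierTransform.fourier_fourierInv_eq, SchwartzMap.norm_toLp, SchwartzMap.norm_toLp,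
    ENNReal.toReal_eq_toReal_iff' (SchwartzMap.eLpNorm_lt_top _ _ _).ne
      (SchwartzMap.eLpNorm_lt_top _ _ _).ne] at h
  exact h.symm

theorem sobolevENorm_eq (ħ s : ℝ) (ψ : 𝓢(ℝ, ℂ)) :
    sobolevENorm ħ s ψ = eLpNorm (fun x => besselTest ħ s ψ x) 2 volume := by
  rw [← eLpNorm_fourierInv, sobolevENorm]
  simp only [fourierInv_besselTest]

theorem sobolevENorm_lt_top (ħ s : ℝ) (ψ : 𝓢(ℝ, ℂ)) : sobolevENorm ħ s ψ < ⊤ := by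
  rw [sobolevENorm_eq]
  exact SchwartzMap.eLpNorm_lt_top _ _ _

theorem sobolevENorm_add_le (ħ s : ℝ) (ψ φ : 𝓢(ℝ, ℂ)) :
    sobolevENorm ħ s (ψ + φ) ≤ sobolevENorm ħ s ψ + sobolevENorm ħ s φ := by
  have hm : ∀ ψ : 𝓢(ℝ, ℂ), AEStronglyMeasurable
      (fun η => ((bracket ħ η ^ s : ℝ) : ℂ) * 𝓕⁻ ψ η) volume := fun ψ => by
    have : (fun η => ((bracket ħ η ^ s : ℝ) : ℂ) * 𝓕⁻ ψ η) =
      fun η => 𝓕⁻ (besselTest ħ s ψ) η := funext fun η => (fourierInv_besselTest _ _ _ _).symm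
    rw [this]
    exact (SchwartzMap.continuous _).aestronglyMeasurable
  refine le_trans (le_of_eq ?_) (eLpNorm_add_le (hm ψ) (hm φ) (by norm_num))
  rw [sobolevENorm]
  congr 1
  ext η
  rw [FourierTransform.fourierInv_add]
  simp [mul_add]

theorem sobolevENorm_smul (ħ s : ℝ) (c : ℂ) (ψ : 𝓢(ℝ, ℂ)) :
    sobolevENorm ħ s (c • ψ) = ‖c‖ₑ * sobolevENorm ħ s ψ := by
  rw [sobolevENorm, sobolevENorm, ← eLpNorm_const_smul]
  congr 1
  ext η
  rw [FourierTransform.fourierInv_smul]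
  simp
  ring

theorem sobolevENorm_sum_le {ι : Type*} (ħ s : ℝ) (t : Finset ι) (ψ : ι → 𝓢(ℝ, ℂ)) :
    sobolevENorm ħ s (∑ i ∈ t, ψ i) ≤ ∑ i ∈ t, sobolevENorm ħ s (ψ i) := by
  classical
  induction t using Finset.induction_on with
  | empty =>
    have := sobolevENorm_smul ħ s 0 (0 : 𝓢(ℝ, ℂ))
    simpa using this
  | insert a t ha ih =>
    rw [Finset.sum_insert ha, Finset.sum_insert ha]
    exact (sobolevENorm_add_le _ _ _ _).trans (by gcongr)

theorem sobolevENorm_neg (ħ s : ℝ) (ψ : 𝓢(ℝ, ℂ)) :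
    sobolevENorm ħ s (-ψ) = sobolevENorm ħ s ψ := by
  have := sobolevENorm_smul ħ s (-1) ψ
  simpa using this

theorem sobolevENorm_mono_order (ħ : ℝ) {s t : ℝ} (h : s ≤ t) (ψ : 𝓢(ℝ, ℂ)) :
    sobolevENorm ħ s ψ ≤ sobolevENorm ħ t ψ := by
  refine eLpNorm_mono fun η => ?_
  rw [norm_mul, norm_mul]
  refine mul_le_mul_of_nonneg_right ?_ (norm_nonneg _)
  rw [Complex.norm_real, Complex.norm_real, Real.norm_eq_abs, Real.norm_eq_abs,
    abs_of_pos (Real.rpow_pos_of_pos (bracket_pos _ _) _),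
    abs_of_pos (Real.rpow_pos_of_pos (bracket_pos _ _) _)]
  exact Real.rpow_le_rpow_of_exponent_le (one_le_bracket _ _) h

/-! ### Duality -/

theorem enorm_toTemperedDistribution_le (f : Lp ℂ 2 (volume : Measure ℝ)) (ψ : 𝓢(ℝ, ℂ)) :
    ‖MeasureTheory.Lp.toTemperedDistribution f ψ‖ₑ ≤
      ‖f‖ₑ * eLpNorm (fun x => ψ x) 2 volume := by
  rw [MeasureTheory.Lp.toTemperedDistribution_apply]
  refine (enorm_integral_le_lintegral_enorm _).trans ?_
  have h := eLpNorm_smul_le_mul_eLpNorm (p := 2) (q := 2) (r := 1) (μ := (volume : Measure ℝ))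
    (Lp.aestronglyMeasurable f) (φ := fun x => ψ x) ψ.continuous.aestronglyMeasurable
  rw [eLpNorm_one_eq_lintegral_enorm] at h
  refine le_trans h (le_of_eq ?_)
  rw [Lp.enorm_def, mul_comm]

theorem semiclassicalBessel_neg_apply (ħ m : ℝ) (u : 𝓢'(ℝ, ℂ)) (ψ : 𝓢(ℝ, ℂ)) :
    u ψ = semiclassicalBessel ħ (-m) u (besselTest ħ m ψ) := by
  rw [semiclassicalBessel_apply, besselTest_besselTest, neg_add_cancel, besselTest_zero]

theorem enorm_apply_le {ħ m : ℝ} {u : 𝓢'(ℝ, ℂ)} {f : Lp ℂ 2 (volume : Measure ℝ)}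
    (h : semiclassicalBessel ħ (-m) u = MeasureTheory.Lp.toTemperedDistribution f)
    (ψ : 𝓢(ℝ, ℂ)) : ‖u ψ‖ₑ ≤ ‖f‖ₑ * sobolevENorm ħ m ψ := by
  rw [semiclassicalBessel_neg_apply ħ m u ψ, h, sobolevENorm_eq]
  exact enorm_toTemperedDistribution_le f _

/-- Schwartz functions are dense in $L^2$, so the functional extends with the same bound, and the
Riesz theorem represents it. -/
theorem exists_Lp_of_bound (v : 𝓢'(ℝ, ℂ)) (A : ℝ) (hA : 0 ≤ A)
    (h : ∀ ψ : 𝓢(ℝ, ℂ), ‖v ψ‖ ≤ A * ‖ψ.toLp 2 volume‖) :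
    ∃ f : Lp ℂ 2 (volume : Measure ℝ), v = MeasureTheory.Lp.toTemperedDistribution f ∧
      ‖f‖ ≤ A := by
  let e : 𝓢(ℝ, ℂ) →ₗ[ℂ] Lp ℂ 2 (volume : Measure ℝ) :=
    (SchwartzMap.toLpCLM ℂ ℂ 2 (volume : Measure ℝ) (E := ℝ)).toLinearMap
  let V : 𝓢(ℝ, ℂ) →ₗ[ℂ] ℂ := ⟨⟨v, map_add v⟩, map_smul v⟩
  have hd : DenseRange e := SchwartzMap.denseRange_toLpCLM (by norm_num)
  have hV : ∀ ψ, ‖V ψ‖ ≤ A * ‖e ψ‖ := h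
  obtain ⟨L, hLe, hLn⟩ : ∃ L : Lp ℂ 2 (volume : Measure ℝ) →L[ℂ] ℂ,
      (∀ ψ, L (e ψ) = V ψ) ∧ ‖L‖ ≤ A :=
    ⟨LinearMap.extendOfNorm V e, fun ψ => LinearMap.extendOfNorm_eq hd ⟨A, hV⟩ ψ,
      LinearMap.opNorm_extendOfNorm_le hd hA hV⟩
  obtain ⟨g, hg⟩ := (InnerProductSpace.toDual ℂ (Lp ℂ 2 (volume : Measure ℝ))).surjective L
  -- The conjugate appears because distributions pair bilinearly while the inner product is
  -- conjugate linear in its first argument.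
  refine ⟨star g, ?_, ?_⟩
  · ext ψ
    have h0 : v ψ = L (e ψ) := (hLe ψ).symm
    rw [h0, MeasureTheory.Lp.toTemperedDistribution_apply, ← hg,
      InnerProductSpace.toDual_apply_apply, MeasureTheory.L2.inner_def]
    refine integral_congr_ae ?_
    filter_upwards [Lp.coeFn_star g, SchwartzMap.coeFn_toLp ψ 2 (volume : Measure ℝ)] with x h1 h2
    have h3 : (e ψ : ℝ → ℂ) x = ψ x := h2
    rw [h1, h3]
    simp [mul_comm]
  · have h4 : ‖star g‖ ≤ ‖g‖ := Lp.norm_le_norm_of_ae_le (by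
      filter_upwards [Lp.coeFn_star g] with x hx
      rw [hx]; simp)
    refine h4.trans ?_
    rw [← LinearIsometryEquiv.norm_map (InnerProductSpace.toDual ℂ _), hg]
    exact hLn

/-- Testing against `besselTest ħ (-m) ψ` replaces the $H_\hbar^m$ norm by the $L^2$ norm of $\psi$.
Hence $\mathrm{Op}_\hbar(\langle\xi\rangle^{-m})v$ is an $L^2$-bounded functional, to which the
Riesz representation applies. -/
theorem memHSobolev_of_bound {ħ m : ℝ} {v : 𝓢'(ℝ, ℂ)} {A : ℝ} (hA : 0 ≤ A)
    (h : ∀ ψ : 𝓢(ℝ, ℂ), ‖v ψ‖ₑ ≤ ENNReal.ofReal A * sobolevENorm ħ m ψ) :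
    MemHSobolev ħ (-m) v ∧ hSobolevNorm ħ (-m) v ≤ A := by
  have key : ∃ f : Lp ℂ 2 (volume : Measure ℝ),
      semiclassicalBessel ħ (-m) v = MeasureTheory.Lp.toTemperedDistribution f ∧ ‖f‖ ≤ A := by
    refine exists_Lp_of_bound _ A hA fun ψ => ?_
    have h1 := h (besselTest ħ (-m) ψ)
    rw [sobolevENorm_eq, besselTest_besselTest, add_neg_cancel, besselTest_zero,
      ← semiclassicalBessel_apply] at h1
    have h2 := ENNReal.toReal_mono (ENNReal.mul_ne_top ENNReal.ofReal_ne_top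
      (SchwartzMap.eLpNorm_lt_top ψ 2 volume).ne) h1
    rw [ENNReal.toReal_mul, ENNReal.toReal_ofReal hA, toReal_enorm] at h2
    rw [SchwartzMap.norm_toLp]
    exact h2
  obtain ⟨f, hf, hfA⟩ := key
  have hmem : MemHSobolev ħ (-m) v := ⟨f, hf⟩
  refine ⟨hmem, ?_⟩
  rw [hSobolevNorm, dif_pos hmem]
  -- The norm is read off from a chosen representative, and this is the only one because $L^2$
  -- embeds injectively into distributions.
  have : hmem.choose = f := by
    have h1 := hf.symm.trans hmem.choose_spec
    have hinj : Function.Injective (MeasureTheory.Lp.toTemperedDistributionCLM ℂ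
        (volume : Measure ℝ) 2) := LinearMap.ker_eq_bot.mp
      (MeasureTheory.Lp.ker_toTemperedDistributionCLM_eq_bot (p := 2) (F := ℂ)
        (μ := (volume : Measure ℝ)))
    exact (hinj h1).symm
  rw [this]
  exact hfA

theorem enorm_apply_le_hSobolevNorm {ħ m : ℝ} {u : 𝓢'(ℝ, ℂ)} (hu : MemHSobolev ħ (-m) u)
    (ψ : 𝓢(ℝ, ℂ)) :
    ‖u ψ‖ₑ ≤ ENNReal.ofReal (hSobolevNorm ħ (-m) u) * sobolevENorm ħ m ψ := by
  rw [hSobolevNorm, dif_pos hu]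
  have := enorm_apply_le hu.choose_spec ψ
  rwa [← ofReal_norm hu.choose] at this

theorem hSobolevNorm_nonneg (ħ s : ℝ) (u : 𝓢'(ℝ, ℂ)) : 0 ≤ hSobolevNorm ħ s u := by
  rw [hSobolevNorm]
  split_ifs
  · exact norm_nonneg _
  · exact le_rfl

/-- A bound on the transpose gives a bound on the operator. -/
theorem hSobolevOpNormLE_of_transpose {ħ m B : ℝ} (hB : 0 ≤ B)
    (T : 𝓢'(ℝ, ℂ) →ₗ[ℂ] 𝓢'(ℝ, ℂ)) (R : 𝓢(ℝ, ℂ) → 𝓢(ℝ, ℂ)) (hT : ∀ u ψ, T u ψ = u (R ψ))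
    (hR : ∀ ψ, sobolevENorm ħ m (R ψ) ≤ ENNReal.ofReal B * sobolevENorm ħ m ψ) :
    HSobolevOpNormLE ħ (-m) T B := by
  intro u hu
  refine memHSobolev_of_bound (mul_nonneg hB (hSobolevNorm_nonneg _ _ _)) fun ψ => ?_
  rw [hT]
  refine (enorm_apply_le_hSobolevNorm hu _).trans ?_
  rw [ENNReal.ofReal_mul hB, mul_comm (ENNReal.ofReal B), mul_assoc]
  gcongr
  exact hR ψ

theorem memHSobolev_schwartz (ħ s : ℝ) (ψ : 𝓢(ℝ, ℂ)) :
    MemHSobolev ħ s (SchwartzMap.toTemperedDistributionCLM ℝ ℂ volume ψ) := by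
  refine ⟨(SchwartzMap.fourierMultiplierCLM ℂ
    (fun η : ℝ => ((bracket ħ η ^ s : ℝ) : ℂ)) ψ).toLp 2, ?_⟩
  rw [semiclassicalBessel_eq, Lp.toTemperedDistribution_toLp_eq,
    TemperedDistribution.fourierMultiplierCLM_toTemperedDistributionCLM_eq
      (hasTemperateGrowth_bracket_rpow ħ s)]

end

/-! ### Semiclassical derivatives on the Fourier side. -/

noncomputable section

open scoped FourierTransform ENNReal

/-- The semiclassical derivative `ħ d/dx`. -/
def semideriv (ħ : ℝ) (ψ : 𝓢(ℝ, ℂ)) : 𝓢(ℝ, ℂ) := (ħ : ℂ) • SchwartzMap.derivCLM ℂ ℂ ψ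

theorem semideriv_apply (ħ : ℝ) (ψ : 𝓢(ℝ, ℂ)) (x : ℝ) : semideriv ħ ψ x = ħ * deriv ψ x := by
  simp [semideriv]

theorem semideriv_iterate_apply (ħ : ℝ) (ψ : 𝓢(ℝ, ℂ)) (i : ℕ) (x : ℝ) :
    (semideriv ħ)^[i] ψ x = (ħ : ℂ) ^ i * iteratedDeriv i ψ x := by
  induction i generalizing ψ with
  | zero => simp
  | succ i ih =>
    rw [Function.iterate_succ_apply, ih, iteratedDeriv_succ']
    have : ⇑(semideriv ħ ψ) = fun x => (ħ : ℂ) * deriv ψ x := funext (semideriv_apply ħ ψ)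
    rw [this, iteratedDeriv_const_mul_field]
    ring

theorem fourierInv_semideriv (ħ : ℝ) (ψ : 𝓢(ℝ, ℂ)) (η : ℝ) :
    𝓕⁻ (semideriv ħ ψ) η = -(Complex.I * (2 * Real.pi * ħ * η : ℝ)) * 𝓕⁻ ψ η := by
  have h1 : SchwartzMap.derivCLM ℂ ℂ ψ = LineDeriv.lineDerivOp (1 : ℝ) ψ := by
    ext x
    simp [SchwartzMap.lineDerivOp_apply_eq_fderiv]
  rw [semideriv, h1, FourierTransform.fourierInv_smul, SchwartzMap.fourierInv_lineDerivOp_eq]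
  simp only [smul_apply, smul_eq_mul]
  rw [SchwartzMap.smulLeftCLM_apply_apply (by fun_prop)]
  simp
  ring

theorem norm_fourierInv_semideriv_iterate (ħ : ℝ) (ψ : 𝓢(ℝ, ℂ)) (i : ℕ) (η : ℝ) :
    ‖𝓕⁻ ((semideriv ħ)^[i] ψ) η‖ = |2 * Real.pi * ħ * η| ^ i * ‖𝓕⁻ ψ η‖ := by
  induction i generalizing ψ with
  | zero => simp
  | succ i ih =>
    rw [Function.iterate_succ_apply, ih, fourierInv_semideriv, norm_mul, norm_neg, norm_mul,
      Complex.norm_I, Complex.norm_real, Real.norm_eq_abs]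
    ring

theorem norm_apply_le_lintegral (ψ : 𝓢(ℝ, ℂ)) (x : ℝ) : ‖ψ x‖ₑ ≤ ∫⁻ η, ‖𝓕⁻ ψ η‖ₑ := by
  have h2 : ψ = 𝓕 (𝓕⁻ ψ : 𝓢(ℝ, ℂ)) := (FourierTransform.fourier_fourierInv_eq ψ).symm
  have h3 := SchwartzMap.norm_fourier_apply_le_toLp_one (𝓕⁻ ψ : 𝓢(ℝ, ℂ)) x
  rw [← h2, SchwartzMap.norm_toLp, eLpNorm_one_eq_lintegral_enorm] at h3
  rw [← ofReal_norm]
  exact ENNReal.ofReal_le_of_le_toReal h3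

theorem enorm_bracket_rpow (ħ s η : ℝ) :
    ‖((bracket ħ η ^ s : ℝ) : ℂ)‖ₑ = ENNReal.ofReal (bracket ħ η ^ s) := by
  rw [← ofReal_norm, Complex.norm_real, Real.norm_eq_abs,
    abs_of_pos (Real.rpow_pos_of_pos (bracket_pos _ _) _)]

theorem enorm_semideriv_iterate_le (ħ : ℝ) (ψ : 𝓢(ℝ, ℂ)) (i : ℕ) (x : ℝ) :
    ‖(semideriv ħ)^[i] ψ x‖ₑ ≤
      ∫⁻ η, ENNReal.ofReal (bracket ħ η ^ (i : ℝ)) * ‖𝓕⁻ ψ η‖ₑ := by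
  refine (norm_apply_le_lintegral _ x).trans (lintegral_mono fun η => ?_)
  rw [← ofReal_norm, ← ofReal_norm, ← ENNReal.ofReal_mul (by positivity [bracket_pos ħ η]),
    norm_fourierInv_semideriv_iterate, Real.rpow_natCast]
  refine ENNReal.ofReal_le_ofReal ?_
  gcongr
  exact abs_le_bracket ħ η

theorem eLpNorm_semideriv_iterate_le (ħ : ℝ) (ψ : 𝓢(ℝ, ℂ)) (i : ℕ) :
    eLpNorm (fun x => (semideriv ħ)^[i] ψ x) 2 volume ≤ sobolevENorm ħ i ψ := by
  rw [← eLpNorm_fourierInv, sobolevENorm]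
  refine eLpNorm_mono fun η => ?_
  rw [norm_fourierInv_semideriv_iterate, norm_mul, Complex.norm_real, Real.norm_eq_abs,
    Real.rpow_natCast, abs_of_pos (pow_pos (bracket_pos _ _) _)]
  gcongr
  exact abs_le_bracket ħ η

theorem bracket_pow_le (ħ η : ℝ) (M : ℕ) :
    bracket ħ η ^ M ≤ 2 ^ M * (1 + |2 * Real.pi * ħ * η| ^ M) := by
  set x := |2 * Real.pi * ħ * η| with hx
  have hx0 : 0 ≤ x := abs_nonneg _
  have h1 : bracket ħ η ≤ 1 + x := by
    rw [bracket, Real.sqrt_le_left (by positivity), ← sq_abs]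
    nlinarith
  have h2 : bracket ħ η ≤ 2 * max 1 x := by
    have := le_max_left 1 x
    have := le_max_right 1 x
    linarith
  calc bracket ħ η ^ M ≤ (2 * max 1 x) ^ M := pow_le_pow_left₀ (bracket_pos _ _).le h2 M
    _ = 2 ^ M * (max 1 x) ^ M := mul_pow _ _ _
    _ ≤ _ := by
      gcongr
      rcases max_cases 1 x with ⟨h, -⟩ | ⟨h, -⟩ <;> rw [h]
      · simp; positivity
      · have : 0 ≤ x ^ M := by positivity
        linarith

/-- Plancherel, together with the domination of $\langle\xi\rangle^M$ by $1+|\xi|^M$: intermediate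
derivatives are not needed. -/
theorem sobolevENorm_natCast_le (ħ : ℝ) (M : ℕ) (ψ : 𝓢(ℝ, ℂ)) :
    sobolevENorm ħ M ψ ≤ 2 ^ M * (eLpNorm (fun x => ψ x) 2 volume +
      eLpNorm (fun x => (semideriv ħ)^[M] ψ x) 2 volume) := by
  have hm : ∀ ψ : 𝓢(ℝ, ℂ), AEStronglyMeasurable (fun η => ‖𝓕⁻ ψ η‖) volume := fun ψ =>
    (SchwartzMap.continuous (𝓕⁻ ψ : 𝓢(ℝ, ℂ))).norm.aestronglyMeasurable
  rw [← eLpNorm_fourierInv ψ, ← eLpNorm_fourierInv ((semideriv ħ)^[M] ψ), sobolevENorm,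
    ← eLpNorm_norm (fun η => 𝓕⁻ ψ η), ← eLpNorm_norm (fun η => 𝓕⁻ ((semideriv ħ)^[M] ψ) η)]
  have e : (2 : ℝ≥0∞) ^ M = ‖(2 : ℝ) ^ M‖ₑ := by
    rw [Real.enorm_eq_ofReal (by positivity), ENNReal.ofReal_pow (by positivity)]
    simp
  refine le_trans ?_ (mul_le_mul_right (eLpNorm_add_le (hm _) (hm _) (by norm_num)) _)
  rw [e, ← eLpNorm_const_smul]
  refine eLpNorm_mono fun η => ?_
  rw [norm_mul, Complex.norm_real, Real.norm_eq_abs,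
    Real.rpow_natCast, abs_of_pos (pow_pos (bracket_pos _ _) _)]
  simp only [Pi.smul_apply, Pi.add_apply, smul_eq_mul, norm_fourierInv_semideriv_iterate]
  refine le_trans ?_ (le_abs_self _)
  calc _ ≤ 2 ^ M * (1 + |2 * Real.pi * ħ * η| ^ M) * ‖𝓕⁻ ψ η‖ := by
        gcongr; exact bracket_pow_le _ _ _
    _ = _ := by ring

end

noncomputable section

open scoped FourierTransform ENNReal

theorem measurable_fourierInv_enorm (ψ : 𝓢(ℝ, ℂ)) : Measurable fun η => ‖𝓕⁻ ψ η‖ₑ :=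
  (SchwartzMap.continuous (𝓕⁻ ψ : 𝓢(ℝ, ℂ))).enorm.measurable

theorem measurable_bracket_rpow (ħ s : ℝ) :
    Measurable fun η => ENNReal.ofReal (bracket ħ η ^ s) :=
  ((continuous_bracket ħ).measurable.pow_const s).ennreal_ofReal

theorem sobolevENorm_sq (ħ s : ℝ) (ψ : 𝓢(ℝ, ℂ)) :
    sobolevENorm ħ s ψ ^ 2 =
      ∫⁻ η, ENNReal.ofReal (bracket ħ η ^ (2 * s)) * ‖𝓕⁻ ψ η‖ₑ ^ 2 := by
  have h := eLpNorm_nnreal_pow_eq_lintegral (μ := (volume : Measure ℝ)) (p := 2)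
    (f := fun η => ((bracket ħ η ^ s : ℝ) : ℂ) * 𝓕⁻ ψ η) (by norm_num)
  simp only [NNReal.coe_ofNat, ENNReal.rpow_ofNat, ENNReal.coe_ofNat] at h
  rw [sobolevENorm, h]
  refine lintegral_congr fun η => ?_
  rw [enorm_mul, mul_pow, enorm_bracket_rpow, ← ENNReal.ofReal_pow
    (Real.rpow_nonneg (bracket_pos _ _).le _), ← Real.rpow_natCast,
    ← Real.rpow_mul (bracket_pos _ _).le, mul_comm s]
  norm_num

/-! ### The Wiener norm and the Sobolev embedding -/

/-- The weighted `L¹` norm of the Fourier transform. -/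
def wienerENorm (ħ s : ℝ) (ψ : 𝓢(ℝ, ℂ)) : ℝ≥0∞ :=
  ∫⁻ η, ENNReal.ofReal (bracket ħ η ^ s) * ‖𝓕⁻ ψ η‖ₑ

/-- The substitution $x=2\pi\hbar\eta$ produces the factor $\hbar^{-1}$, and $r>1$ is integrability
at infinity. The square root of this factor is the whole loss in the embedding that follows. -/
theorem exists_lintegral_bracket (r : ℝ) (hr : 1 < r) : ∃ C : ℝ, 0 ≤ C ∧ ∀ ħ : ℝ, 0 < ħ →
    ∫⁻ η, ENNReal.ofReal (bracket ħ η ^ (-r)) = ENNReal.ofReal (C * ħ⁻¹) := by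
  have hi : Integrable fun x : ℝ => ((1 : ℝ) + ‖x‖ ^ 2) ^ (-r / 2) :=
    integrable_rpow_neg_one_add_norm_sq (by simpa using hr)
  refine ⟨(2 * Real.pi)⁻¹ * ∫ x : ℝ, ((1 : ℝ) + ‖x‖ ^ 2) ^ (-r / 2),
    mul_nonneg (by positivity) (integral_nonneg fun x => by positivity), fun ħ hħ => ?_⟩
  have hc : 2 * Real.pi * ħ ≠ 0 := by positivity
  have e : (fun η => bracket ħ η ^ (-r)) =
      fun η => (fun x : ℝ => ((1 : ℝ) + ‖x‖ ^ 2) ^ (-r / 2)) ((2 * Real.pi * ħ) * η) := by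
    funext η
    simp only [bracket_rpow, Real.norm_eq_abs, sq_abs]
  rw [← ofReal_integral_eq_lintegral_ofReal, e,
    Measure.integral_comp_mul_left (fun x : ℝ => ((1 : ℝ) + ‖x‖ ^ 2) ^ (-r / 2))]
  · congr 1
    rw [abs_of_pos (by positivity), smul_eq_mul, mul_inv]
    ring
  · rw [e]
    exact hi.comp_mul_left' hc
  · exact Eventually.of_forall fun η => Real.rpow_nonneg (bracket_pos _ _).le _

/-- Cauchy–Schwarz against $\langle\xi\rangle^{s-m}$, which is square integrable because
$m-s>\frac12$. For $s=d+1$ this is where $d<m-\frac32$ enters. -/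
theorem exists_wienerENorm_le (s m : ℝ) (h : 1 / 2 < m - s) : ∃ C : ℝ, 0 ≤ C ∧
    ∀ ħ : ℝ, 0 < ħ → ∀ ψ : 𝓢(ℝ, ℂ), wienerENorm ħ s ψ ≤
      ENNReal.ofReal (C * ħ ^ (-(1 / 2 : ℝ))) * sobolevENorm ħ m ψ := by
  obtain ⟨C, hC, hI⟩ := exists_lintegral_bracket (2 * (m - s)) (by linarith)
  refine ⟨C ^ (1 / 2 : ℝ), by positivity, fun ħ hħ ψ => ?_⟩
  have e : wienerENorm ħ s ψ = ∫⁻ η, ((fun η => ENNReal.ofReal (bracket ħ η ^ (s - m))) *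
      fun η => ENNReal.ofReal (bracket ħ η ^ m) * ‖𝓕⁻ ψ η‖ₑ) η := by
    refine lintegral_congr fun η => ?_
    simp only [Pi.mul_apply]
    rw [← mul_assoc, ← ENNReal.ofReal_mul (Real.rpow_nonneg (bracket_pos _ _).le _),
      ← Real.rpow_add (bracket_pos _ _)]
    congr 3
    ring
  have hm : Measurable fun η => ENNReal.ofReal (bracket ħ η ^ m) * ‖𝓕⁻ ψ η‖ₑ :=
    (measurable_bracket_rpow _ _).mul (measurable_fourierInv_enorm ψ)
  rw [e]
  refine (ENNReal.lintegral_mul_le_Lp_mul_Lq volume (p := 2) (q := 2) ⟨by norm_num, by norm_num,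
    by norm_num⟩ (measurable_bracket_rpow _ _).aemeasurable
    hm.aemeasurable).trans
    (le_of_eq ?_)
  have e1 : ∀ η, ENNReal.ofReal (bracket ħ η ^ (s - m)) ^ (2 : ℝ) =
      ENNReal.ofReal (bracket ħ η ^ (-(2 * (m - s)))) := fun η => by
    rw [ENNReal.ofReal_rpow_of_nonneg (Real.rpow_nonneg (bracket_pos _ _).le _) (by norm_num),
      ← Real.rpow_mul (bracket_pos _ _).le]
    congr 2
    ring
  have e2 : ∀ η, (ENNReal.ofReal (bracket ħ η ^ m) * ‖𝓕⁻ ψ η‖ₑ) ^ (2 : ℝ) =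
      ENNReal.ofReal (bracket ħ η ^ (2 * m)) * ‖𝓕⁻ ψ η‖ₑ ^ 2 := fun η => by
    rw [ENNReal.mul_rpow_of_nonneg _ _ (by norm_num), ENNReal.ofReal_rpow_of_nonneg
      (Real.rpow_nonneg (bracket_pos _ _).le _) (by norm_num), ← Real.rpow_mul (bracket_pos _ _).le,
      ENNReal.rpow_ofNat, mul_comm m]
  simp only [e1, e2]
  rw [hI ħ hħ, ← sobolevENorm_sq, ENNReal.ofReal_rpow_of_nonneg (by positivity) (by norm_num),
    Real.mul_rpow hC (by positivity), Real.inv_rpow hħ.le, ← Real.rpow_neg hħ.le]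
  congr 1
  rw [← ENNReal.rpow_ofNat, ← ENNReal.rpow_mul]
  norm_num

theorem wienerENorm_mono_order (ħ : ℝ) {s t : ℝ} (h : s ≤ t) (ψ : 𝓢(ℝ, ℂ)) :
    wienerENorm ħ s ψ ≤ wienerENorm ħ t ψ := by
  refine lintegral_mono fun η => ?_
  gcongr
  exact one_le_bracket _ _

theorem sobolevENorm_mono {ħ s : ℝ} {ψ φ : 𝓢(ℝ, ℂ)} (h : ∀ η, ‖𝓕⁻ ψ η‖ ≤ ‖𝓕⁻ φ η‖) :
    sobolevENorm ħ s ψ ≤ sobolevENorm ħ s φ :=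
  eLpNorm_mono fun η => by
    rw [norm_mul, norm_mul]
    exact mul_le_mul_of_nonneg_left (h η) (norm_nonneg _)

/-- A Bernstein inequality: on the frequencies that occur, the surplus weight
$\langle\xi\rangle^{s-t}$ is at most $L^{s-t}$. The two high frequency versions below reverse the
roles of the exponents. -/
theorem wienerENorm_le_of_low {ħ s t L : ℝ} (hst : t ≤ s) {ψ : 𝓢(ℝ, ℂ)}
    (h : ∀ η, L < bracket ħ η → 𝓕⁻ ψ η = 0) :
    wienerENorm ħ s ψ ≤ ENNReal.ofReal (L ^ (s - t)) * wienerENorm ħ t ψ := by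
  have hm : Measurable fun η => ENNReal.ofReal (bracket ħ η ^ t) * ‖𝓕⁻ ψ η‖ₑ :=
    (measurable_bracket_rpow _ _).mul (measurable_fourierInv_enorm ψ)
  rw [wienerENorm, wienerENorm, ← lintegral_const_mul _ hm]
  refine lintegral_mono fun η => ?_
  by_cases hη : L < bracket ħ η
  · simp [h η hη]
  · push Not at hη
    have hL : 0 < L := (bracket_pos ħ η).trans_le hη
    rw [← mul_assoc, ← ENNReal.ofReal_mul (by positivity)]
    gcongr
    have : bracket ħ η ^ s = bracket ħ η ^ (s - t) * bracket ħ η ^ t := by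
      rw [← Real.rpow_add (bracket_pos _ _)]; congr 1; ring
    rw [this]
    have h0 := (bracket_pos ħ η).le
    gcongr

theorem wienerENorm_le_of_high {ħ s t L : ℝ} (hL : 0 < L) (hst : s ≤ t) {ψ : 𝓢(ℝ, ℂ)}
    (h : ∀ η, bracket ħ η < L → 𝓕⁻ ψ η = 0) :
    wienerENorm ħ s ψ ≤ ENNReal.ofReal (L ^ (s - t)) * wienerENorm ħ t ψ := by
  have hm : Measurable fun η => ENNReal.ofReal (bracket ħ η ^ t) * ‖𝓕⁻ ψ η‖ₑ :=
    (measurable_bracket_rpow _ _).mul (measurable_fourierInv_enorm ψ)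
  rw [wienerENorm, wienerENorm, ← lintegral_const_mul _ hm]
  refine lintegral_mono fun η => ?_
  by_cases hη : bracket ħ η < L
  · simp [h η hη]
  · push Not at hη
    rw [← mul_assoc, ← ENNReal.ofReal_mul (by positivity)]
    gcongr
    have : bracket ħ η ^ s = bracket ħ η ^ (s - t) * bracket ħ η ^ t := by
      rw [← Real.rpow_add (bracket_pos _ _)]; congr 1; ring
    rw [this]
    refine mul_le_mul_of_nonneg_right ?_ (Real.rpow_nonneg (bracket_pos _ _).le _)
    exact Real.rpow_le_rpow_of_nonpos hL hη (by linarith)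

theorem sobolevENorm_le_of_high {ħ s t L : ℝ} (hL : 0 < L) (hst : s ≤ t) {ψ : 𝓢(ℝ, ℂ)}
    (h : ∀ η, bracket ħ η < L → 𝓕⁻ ψ η = 0) :
    sobolevENorm ħ s ψ ≤ ENNReal.ofReal (L ^ (s - t)) * sobolevENorm ħ t ψ := by
  have e : ENNReal.ofReal (L ^ (s - t)) = ‖L ^ (s - t)‖ₑ :=
    (Real.enorm_eq_ofReal (by positivity)).symm
  rw [sobolevENorm, sobolevENorm, e, ← eLpNorm_const_smul]
  refine eLpNorm_mono fun η => ?_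
  by_cases hη : bracket ħ η < L
  · simp [h η hη]
  · push Not at hη
    simp only [Pi.smul_apply]
    rw [norm_smul, norm_mul, norm_mul, ← mul_assoc, Complex.norm_real, Complex.norm_real,
      Real.norm_of_nonneg (Real.rpow_nonneg (bracket_pos _ _).le _),
      Real.norm_of_nonneg (Real.rpow_nonneg (bracket_pos _ _).le _),
      Real.norm_of_nonneg (by positivity)]
    refine mul_le_mul_of_nonneg_right ?_ (norm_nonneg _)
    have : bracket ħ η ^ s = bracket ħ η ^ (s - t) * bracket ħ η ^ t := by
      rw [← Real.rpow_add (bracket_pos _ _)]; congr 1; ring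
    rw [this]
    refine mul_le_mul_of_nonneg_right ?_ (Real.rpow_nonneg (bracket_pos _ _).le _)
    exact Real.rpow_le_rpow_of_nonpos hL hη (by linarith)

/-! ### Decomposition in frequency -/

theorem exists_freq_split {ħ : ℝ} (hħ : 0 < ħ) (L : ℝ) (ψ : 𝓢(ℝ, ℂ)) :
    ∃ ψ₁ ψ₂ : 𝓢(ℝ, ℂ), ψ = ψ₁ + ψ₂ ∧ (∀ η, ‖𝓕⁻ ψ₁ η‖ ≤ ‖𝓕⁻ ψ η‖) ∧
      (∀ η, ‖𝓕⁻ ψ₂ η‖ ≤ ‖𝓕⁻ ψ η‖) ∧ (∀ η, 3 * L < bracket ħ η → 𝓕⁻ ψ₁ η = 0) ∧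
      (∀ η, bracket ħ η < L → 𝓕⁻ ψ₂ η = 0) := by
  have hz : ∀ η, 𝓕⁻ (0 : 𝓢(ℝ, ℂ)) η = 0 := fun η => by
    have := FourierTransform.fourierInv_smul (0 : ℂ) (0 : 𝓢(ℝ, ℂ))
    rw [zero_smul, zero_smul] at this
    rw [this]; rfl
  -- The bracket is at least $1$, so for $L\le1$ all of $\psi$ may be declared high frequency. For
  -- $L>1$ there is the inequality $\sqrt{1+4L^2}\le3L$, used for the low part.
  by_cases hL : L ≤ 1
  · refine ⟨0, ψ, by simp, fun η => by simp, fun η => le_rfl, fun η _ => hz η,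
      fun η hη => absurd hη (not_lt.mpr (hL.trans (one_le_bracket _ _)))⟩
  push Not at hL
  have hc : 0 < 2 * Real.pi * ħ := by positivity
  -- A bump function equal to $1$ for $|\xi|\le L$ and to $0$ for $|\xi|\ge2L$, where
  -- $\xi=2\pi\hbar\eta$.
  let κ : ContDiffBump (0 : ℝ) := ⟨L / (2 * Real.pi * ħ), 2 * L / (2 * Real.pi * ħ), by positivity,
    by gcongr; linarith⟩
  have hκ : (fun η => ((κ η : ℝ) : ℂ)).HasTemperateGrowth := by
    refine HasCompactSupport.hasTemperateGrowth ?_ ?_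
    · exact κ.hasCompactSupport.comp_left (g := fun x : ℝ => (x : ℂ)) (by simp)
    · exact Complex.ofRealCLM.contDiff.comp κ.contDiff
  set ψ₁ : 𝓢(ℝ, ℂ) := 𝓕 (SchwartzMap.smulLeftCLM ℂ (fun η => ((κ η : ℝ) : ℂ)) (𝓕⁻ ψ)) with hψ₁
  have h1 : ∀ η, 𝓕⁻ ψ₁ η = (κ η : ℂ) * 𝓕⁻ ψ η := fun η => by
    rw [hψ₁, FourierTransform.fourierInv_fourier_eq (F := 𝓢(ℝ, ℂ)),
      SchwartzMap.smulLeftCLM_apply_apply hκ, smul_eq_mul]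
  have h2 : ∀ η, 𝓕⁻ (ψ - ψ₁) η = ((1 - κ η : ℝ) : ℂ) * 𝓕⁻ ψ η := fun η => by
    have : (𝓕⁻ ψ : 𝓢(ℝ, ℂ)) = 𝓕⁻ (ψ - ψ₁) + 𝓕⁻ ψ₁ := by
      rw [← FourierTransform.fourierInv_add, sub_add_cancel]
    have := congrArg (fun f : 𝓢(ℝ, ℂ) => f η) this
    simp only [add_apply, h1] at this
    push_cast
    linear_combination -this
  have hb : ∀ c : ℝ, 0 ≤ c → c ≤ 1 → ∀ z : ℂ, ‖(c : ℂ) * z‖ ≤ ‖z‖ := fun c h0 h1 z => by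
    rw [norm_mul, Complex.norm_real, Real.norm_of_nonneg h0]
    exact mul_le_of_le_one_left (norm_nonneg z) h1
  refine ⟨ψ₁, ψ - ψ₁, by abel, fun η => ?_, fun η => ?_, fun η hη => ?_, fun η hη => ?_⟩
  · rw [h1]; exact hb _ κ.nonneg κ.le_one _
  · rw [h2]; exact hb _ (by linarith [κ.le_one (x := η)]) (by linarith [κ.nonneg (x := η)]) _
  · rw [h1, κ.zero_of_le_dist]
    · simp
    · change 2 * L / (2 * Real.pi * ħ) ≤ _
      rw [div_le_iff₀ hc, Real.dist_eq, sub_zero]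
      by_contra hlt
      push Not at hlt
      have h3 : |2 * Real.pi * ħ * η| < 2 * L := by
        rw [abs_mul, abs_of_pos hc]; linarith
      have h4 : bracket ħ η ≤ 3 * L := by
        rw [bracket, Real.sqrt_le_left (by positivity), ← sq_abs]
        nlinarith [abs_nonneg (2 * Real.pi * ħ * η)]
      linarith
  · rw [h2, κ.one_of_mem_closedBall]
    · simp
    · rw [Metric.mem_closedBall, Real.dist_eq, sub_zero]
      change _ ≤ L / (2 * Real.pi * ħ)
      rw [le_div_iff₀ hc]
      have := (abs_le_bracket ħ η).trans hη.le
      rw [abs_mul, abs_of_pos hc] at this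
      linarith

end

noncomputable section

open scoped FourierTransform ENNReal

/-! ### Real interpolation between `L²` and `H_ħ^M` -/

theorem lintegral_rpow_Ioc {p x : ℝ} (hp : 0 < p) (hx : 0 < x) :
    ∫⁻ t in Ioc 0 x, ENNReal.ofReal (t ^ (p - 1)) = ENNReal.ofReal (x ^ p / p) := by
  have hi : IntervalIntegrable (fun t : ℝ => t ^ (p - 1)) volume 0 x :=
    intervalIntegral.intervalIntegrable_rpow' (by linarith)
  rw [← ofReal_integral_eq_lintegral_ofReal
    ((intervalIntegrable_iff_integrableOn_Ioc_of_le hx.le).mp hi)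
    ((ae_restrict_mem measurableSet_Ioc).mono fun t ht => Real.rpow_nonneg ht.1.le _),
    ← intervalIntegral.integral_of_le hx.le, integral_rpow (Or.inl (by linarith))]
  congr 1
  rw [sub_add_cancel, Real.zero_rpow hp.ne', sub_zero]

theorem lintegral_rpow_Ioi {p x : ℝ} (hp : 0 < p) (hx : 0 < x) :
    ∫⁻ t in Ioi x, ENNReal.ofReal (t ^ (-p - 1)) = ENNReal.ofReal (x ^ (-p) / p) := by
  rw [← ofReal_integral_eq_lintegral_ofReal
    (integrableOn_Ioi_rpow_of_lt (by linarith) hx)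
    ((ae_restrict_mem measurableSet_Ioi).mono fun t ht => Real.rpow_nonneg
      (hx.le.trans (le_of_lt ht)) _),
    integral_Ioi_rpow_of_lt (by linarith) hx]
  congr 1
  rw [sub_add_cancel, div_neg, neg_div, neg_neg]

/-- Tonelli: integrating the truncation in $t$ first turns a family of cut-off integrals into one
integral with the weight $a$. -/
theorem lintegral_swap_cut {F : ℝ → ℝ≥0∞} (hF : Measurable F) {g : ℝ → ℝ≥0∞}
    (hg : Measurable g) {P : ℝ → ℝ → Prop} [∀ x y, Decidable (P x y)]
    (hP : MeasurableSet {z : ℝ × ℝ | P z.1 z.2}) {a : ℝ → ℝ≥0∞}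
    (ha : ∀ η, ∫⁻ t in Ioi (0 : ℝ), (if P t η then g t else 0) = a η) :
    ∫⁻ t in Ioi (0 : ℝ), g t * ∫⁻ η, (if P t η then F η else 0) = ∫⁻ η, a η * F η := by
  have hm : ∀ t, Measurable fun η => if P t η then F η else 0 := fun t =>
    Measurable.ite (hP.preimage (measurable_prodMk_left (x := t))) hF measurable_const
  have hm' : ∀ η, Measurable fun t => if P t η then g t else 0 := fun η =>
    Measurable.ite (hP.preimage (measurable_prodMk_right (y := η))) hg measurable_const
  have h1 : ∀ t, g t * ∫⁻ η, (if P t η then F η else 0) =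
      ∫⁻ η, (if P t η then g t * F η else 0) := fun t => by
    rw [← lintegral_const_mul _ (hm t)]
    simp only [mul_ite, mul_zero]
  simp only [h1]
  rw [lintegral_lintegral_swap]
  · refine lintegral_congr fun η => ?_
    rw [← ha η, ← lintegral_mul_const _ (hm' η)]
    simp only [ite_mul, zero_mul]
  · refine Measurable.aemeasurable ?_
    exact Measurable.ite hP ((hg.comp measurable_fst).mul (hF.comp measurable_snd))
      measurable_const

-- The weight $\langle\xi\rangle^{2m}$ is recovered from sharp truncations because
-- $\int_0^{\langle\xi\rangle/L}t^{2m-1}\,dt=(\langle\xi\rangle/L)^{2m}/(2m)$.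
open Classical in
theorem lintegral_cut_high (ħ : ℝ) {m L : ℝ} (hm : 0 < m) (hL : 0 < L) {F : ℝ → ℝ≥0∞}
    (hF : Measurable F) :
    ∫⁻ t in Ioi (0 : ℝ), ENNReal.ofReal (t ^ (2 * m - 1)) *
      ∫⁻ η, (if L * t ≤ bracket ħ η then F η else 0) =
    ENNReal.ofReal (L ^ (-(2 * m)) / (2 * m)) *
      ∫⁻ η, ENNReal.ofReal (bracket ħ η ^ (2 * m)) * F η := by
  have hm1 : Measurable fun η => ENNReal.ofReal (bracket ħ η ^ (2 * m)) * F η :=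
    (measurable_bracket_rpow _ _).mul hF
  rw [← lintegral_const_mul _ hm1]
  simp only [← mul_assoc]
  refine lintegral_swap_cut (g := fun t => ENNReal.ofReal (t ^ (2 * m - 1)))
    (P := fun t η => L * t ≤ bracket ħ η) hF ?_ ?_ ?_
  · exact (measurable_id.pow_const _).ennreal_ofReal
  · refine (isClosed_le ?_ ?_).measurableSet
    · fun_prop
    · exact (continuous_bracket ħ).comp continuous_snd
  · intro η
    have hb := bracket_pos ħ η
    have e : ∀ t, (if L * t ≤ bracket ħ η then ENNReal.ofReal (t ^ (2 * m - 1)) else 0) =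
        (Iic (bracket ħ η / L)).indicator (fun t => ENNReal.ofReal (t ^ (2 * m - 1))) t := by
      intro t
      have : L * t ≤ bracket ħ η ↔ t ∈ Iic (bracket ħ η / L) := by
        rw [mem_Iic, le_div_iff₀ hL, mul_comm]
      simp only [indicator, this]
    simp only [e]
    rw [lintegral_indicator measurableSet_Iic, Measure.restrict_restrict measurableSet_Iic,
      inter_comm, Ioi_inter_Iic, lintegral_rpow_Ioc (by positivity) (by positivity),
      ← ENNReal.ofReal_mul (by positivity)]
    congr 1
    rw [Real.div_rpow hb.le hL.le, Real.rpow_neg hL.le]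
    field_simp

-- The companion for frequencies below $Lt$: here the integral of $t^{-p-1}$ runs over
-- $t>\langle\xi\rangle/L$ and converges because $p>0$.
open Classical in
theorem lintegral_cut_low (ħ : ℝ) {p L : ℝ} (hp : 0 < p) (hL : 0 < L) {F : ℝ → ℝ≥0∞}
    (hF : Measurable F) :
    ∫⁻ t in Ioi (0 : ℝ), ENNReal.ofReal (t ^ (-p - 1)) *
      ∫⁻ η, (if bracket ħ η < L * t then F η else 0) =
    ENNReal.ofReal (L ^ p / p) *
      ∫⁻ η, ENNReal.ofReal (bracket ħ η ^ (-p)) * F η := by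
  have hm1 : Measurable fun η => ENNReal.ofReal (bracket ħ η ^ (-p)) * F η :=
    (measurable_bracket_rpow _ _).mul hF
  rw [← lintegral_const_mul _ hm1]
  simp only [← mul_assoc]
  refine lintegral_swap_cut (g := fun t => ENNReal.ofReal (t ^ (-p - 1)))
    (P := fun t η => bracket ħ η < L * t) hF ?_ ?_ ?_
  · exact (measurable_id.pow_const _).ennreal_ofReal
  · refine (isOpen_lt ?_ ?_).measurableSet
    · exact (continuous_bracket ħ).comp continuous_snd
    · fun_prop
  · intro η
    have hb := bracket_pos ħ η
    have e : ∀ t, (if bracket ħ η < L * t then ENNReal.ofReal (t ^ (-p - 1)) else 0) =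
        (Ioi (bracket ħ η / L)).indicator (fun t => ENNReal.ofReal (t ^ (-p - 1))) t := by
      intro t
      have : bracket ħ η < L * t ↔ t ∈ Ioi (bracket ħ η / L) := by
        rw [mem_Ioi, div_lt_iff₀ hL, mul_comm]
      simp only [indicator, this]
    have hs : Ioi (bracket ħ η / L) ∩ Ioi 0 = Ioi (bracket ħ η / L) :=
      inter_eq_left.mpr (Ioi_subset_Ioi (by positivity))
    simp only [e]
    rw [lintegral_indicator measurableSet_Ioi, Measure.restrict_restrict measurableSet_Ioi,
      hs, lintegral_rpow_Ioi hp (by positivity), ← ENNReal.ofReal_mul (by positivity)]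
    congr 1
    rw [Real.div_rpow hb.le hL.le, Real.rpow_neg hL.le]
    field_simp

theorem enorm_add_sq_le (a b : ℂ) : ‖a + b‖ₑ ^ 2 ≤ 4 * (‖a‖ₑ ^ 2 + ‖b‖ₑ ^ 2) := by
  have h1 : ‖a + b‖ ^ 2 ≤ 4 * (‖a‖ ^ 2 + ‖b‖ ^ 2) := by
    have := norm_add_le a b
    nlinarith [norm_nonneg (a + b), sq_nonneg (‖a‖ - ‖b‖), norm_nonneg a, norm_nonneg b]
  have h2 := ENNReal.ofReal_le_ofReal h1
  rw [ENNReal.ofReal_mul (by norm_num), ENNReal.ofReal_add (by positivity) (by positivity),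
    ENNReal.ofReal_pow (norm_nonneg _), ENNReal.ofReal_pow (norm_nonneg _),
    ENNReal.ofReal_pow (norm_nonneg _), ofReal_norm, ofReal_norm, ofReal_norm] at h2
  simpa using h2

-- One scale $t$ of the real interpolation method. The input is split at frequency $Lt$; its low
-- part is measured in $H_\hbar^M$ and its high part in $L^2$. Only the output frequencies
-- $\langle\xi\rangle\ge t$ are looked at.
open Classical in
theorem lintegral_interp_aux {ħ : ℝ} (hħ : 0 < ħ) {M L t : ℝ} (hL : 0 < L) (ht : 0 < t)
    (hM : 0 < M) {A : ℝ≥0∞} (T : 𝓢(ℝ, ℂ) → 𝓢(ℝ, ℂ)) (hT : ∀ ψ φ, T (ψ + φ) = T ψ + T φ)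
    (h0 : ∀ ψ : 𝓢(ℝ, ℂ), (∀ η, bracket ħ η < L → 𝓕⁻ ψ η = 0) →
      sobolevENorm ħ 0 (T ψ) ≤ A * sobolevENorm ħ 0 ψ)
    (h1 : ∀ ψ : 𝓢(ℝ, ℂ), (∀ η, bracket ħ η < L → 𝓕⁻ ψ η = 0) →
      sobolevENorm ħ M (T ψ) ≤ A * ENNReal.ofReal (L ^ (-M)) * sobolevENorm ħ M ψ)
    (ψ : 𝓢(ℝ, ℂ)) (hψ : ∀ η, bracket ħ η < L → 𝓕⁻ ψ η = 0) :
    ∫⁻ η, (if 1 * t ≤ bracket ħ η then ‖𝓕⁻ (T ψ) η‖ₑ ^ 2 else 0) ≤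
      4 * A ^ 2 * (ENNReal.ofReal (t ^ (-(2 * M))) * ENNReal.ofReal (L ^ (-(2 * M))) *
        (∫⁻ η, (if bracket ħ η < (4 * L) * t then
          ENNReal.ofReal (bracket ħ η ^ (2 * M)) * ‖𝓕⁻ ψ η‖ₑ ^ 2 else 0)) +
        ∫⁻ η, (if L * t ≤ bracket ħ η then ‖𝓕⁻ ψ η‖ₑ ^ 2 else 0)) := by
  obtain ⟨ψ₁, ψ₂, hadd, hb1, hb2, hs1, hs2⟩ := exists_freq_split hħ (L * t) ψ
  have supp : ∀ φ : 𝓢(ℝ, ℂ), (∀ η, ‖𝓕⁻ φ η‖ ≤ ‖𝓕⁻ ψ η‖) →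
      ∀ η, bracket ħ η < L → 𝓕⁻ φ η = 0 := fun φ hφ η hη => by
    have := hφ η
    rw [hψ η hη, norm_zero] at this
    exact norm_le_zero_iff.mp this
  have hm : ∀ (s : ℝ) (φ : 𝓢(ℝ, ℂ)),
      Measurable fun η => ENNReal.ofReal (bracket ħ η ^ s) * ‖𝓕⁻ φ η‖ₑ ^ 2 := fun s φ =>
    (measurable_bracket_rpow _ _).mul ((measurable_fourierInv_enorm φ).pow_const 2)
  have k1 : sobolevENorm ħ M (T ψ₁) ^ 2 ≤ A ^ 2 * ENNReal.ofReal (L ^ (-(2 * M))) *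
      ∫⁻ η, (if bracket ħ η < (4 * L) * t then
          ENNReal.ofReal (bracket ħ η ^ (2 * M)) * ‖𝓕⁻ ψ η‖ₑ ^ 2 else 0) := by
    have e : ENNReal.ofReal (L ^ (-(2 * M))) = ENNReal.ofReal (L ^ (-M)) ^ 2 := by
      rw [← ENNReal.ofReal_pow (by positivity), ← Real.rpow_natCast, ← Real.rpow_mul hL.le]
      congr 2; push_cast; ring
    rw [e, ← mul_pow]
    refine (pow_le_pow_left' (h1 ψ₁ (supp ψ₁ hb1)) 2).trans ?_
    rw [mul_pow, sobolevENorm_sq]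
    gcongr with η
    split_ifs with hη
    · have := enorm_le_iff_norm_le.mpr (hb1 η)
      gcongr
    -- The splitting kills $\psi_1$ strictly above $3Lt$, so the constant $4$ leaves room for the
    -- non-strict truncation.
    · have h3 : 0 < L * t := by positivity
      rw [hs1 η (by linarith)]
      simp
  have k2 : sobolevENorm ħ 0 (T ψ₂) ^ 2 ≤ A ^ 2 *
      ∫⁻ η, (if L * t ≤ bracket ħ η then ‖𝓕⁻ ψ η‖ₑ ^ 2 else 0) := by
    refine (pow_le_pow_left' (h0 ψ₂ (supp ψ₂ hb2)) 2).trans ?_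
    rw [mul_pow, sobolevENorm_sq]
    gcongr with η
    split_ifs with hη
    · have := enorm_le_iff_norm_le.mpr (hb2 η)
      simp only [mul_zero, Real.rpow_zero, ENNReal.ofReal_one, one_mul]
      gcongr
    · rw [hs2 η (not_le.mp hη)]
      simp
  calc _ ≤ ∫⁻ η, 4 * (ENNReal.ofReal (t ^ (-(2 * M))) *
        (ENNReal.ofReal (bracket ħ η ^ (2 * M)) * ‖𝓕⁻ (T ψ₁) η‖ₑ ^ 2) +
        ENNReal.ofReal (bracket ħ η ^ (2 * 0 : ℝ)) * ‖𝓕⁻ (T ψ₂) η‖ₑ ^ 2) := by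
        refine lintegral_mono fun η => ?_
        split_ifs with hη
        · have e1 : 𝓕⁻ (T ψ) η = 𝓕⁻ (T ψ₁) η + 𝓕⁻ (T ψ₂) η := by
            have : (𝓕⁻ (T ψ) : 𝓢(ℝ, ℂ)) = 𝓕⁻ (T ψ₁) + 𝓕⁻ (T ψ₂) := by
              rw [← FourierTransform.fourierInv_add, ← hT, ← hadd]
            rw [this]; rfl
          rw [e1]
          refine (enorm_add_sq_le _ _).trans ?_
          gcongr
          -- On these output frequencies $(\langle\xi\rangle/t)^{2M}\ge1$, so the $H_\hbar^M$ weight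
          -- may be inserted at the price $t^{-2M}$.
          · rw [← mul_assoc, ← ENNReal.ofReal_mul (by positivity)]
            refine le_mul_of_one_le_left (by positivity) ?_
            rw [ENNReal.one_le_ofReal, Real.rpow_neg ht.le, inv_mul_eq_div,
              one_le_div (by positivity)]
            exact Real.rpow_le_rpow ht.le (by linarith) (by positivity)
          · simp
        · positivity
    _ = 4 * (ENNReal.ofReal (t ^ (-(2 * M))) * sobolevENorm ħ M (T ψ₁) ^ 2 +
        sobolevENorm ħ 0 (T ψ₂) ^ 2) := by
        rw [lintegral_const_mul' _ _ (by simp), lintegral_add_left ((hm _ _).const_mul _),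
          lintegral_const_mul' _ _ ENNReal.ofReal_ne_top, ← sobolevENorm_sq, ← sobolevENorm_sq]
    _ ≤ 4 * (ENNReal.ofReal (t ^ (-(2 * M))) * (A ^ 2 * ENNReal.ofReal (L ^ (-(2 * M))) *
      ∫⁻ η, (if bracket ħ η < (4 * L) * t then
          ENNReal.ofReal (bracket ħ η ^ (2 * M)) * ‖𝓕⁻ ψ η‖ₑ ^ 2 else 0)) + (A ^ 2 *
      ∫⁻ η, (if L * t ≤ bracket ħ η then ‖𝓕⁻ ψ η‖ₑ ^ 2 else 0))) := by
        gcongr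
    _ = _ := by ring

open Classical in
/-- Interpolation for an operator on functions with frequencies `⟨ξ⟩ ≥ L`. -/
theorem exists_interpolation (m M : ℝ) (hm : 0 < m) (hmM : m < M) : ∃ K : ℝ, 0 ≤ K ∧
    ∀ (ħ : ℝ), 0 < ħ → ∀ (L : ℝ), 0 < L → ∀ (A : ℝ≥0∞) (T : 𝓢(ℝ, ℂ) → 𝓢(ℝ, ℂ)),
    (∀ ψ φ, T (ψ + φ) = T ψ + T φ) →
    (∀ ψ : 𝓢(ℝ, ℂ), (∀ η, bracket ħ η < L → 𝓕⁻ ψ η = 0) →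
      sobolevENorm ħ 0 (T ψ) ≤ A * sobolevENorm ħ 0 ψ) →
    (∀ ψ : 𝓢(ℝ, ℂ), (∀ η, bracket ħ η < L → 𝓕⁻ ψ η = 0) →
      sobolevENorm ħ M (T ψ) ≤ A * ENNReal.ofReal (L ^ (-M)) * sobolevENorm ħ M ψ) →
    ∀ ψ : 𝓢(ℝ, ℂ), (∀ η, bracket ħ η < L → 𝓕⁻ ψ η = 0) →
      sobolevENorm ħ m (T ψ) ≤ A * ENNReal.ofReal (K * L ^ (-m)) * sobolevENorm ħ m ψ := by
  have hM : 0 < M := hm.trans hmM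
  have hd : 0 < 2 * M - 2 * m := by linarith
  -- The factor $2m$ undoes the truncation of the output and $4$ comes from the estimate at one
  -- scale. The two summands are the $t$-integrals for the low part, with cut-off $4L$ and
  -- $p=2M-2m$, and for the high part.
  set Q : ℝ := 2 * m * 4 * (4 ^ (2 * M - 2 * m) / (2 * M - 2 * m) + 1 / (2 * m)) with hQ
  have hQ0 : 0 ≤ Q := by positivity
  refine ⟨Real.sqrt Q, Real.sqrt_nonneg _, fun ħ hħ L hL A T hT h0 h1 ψ hψ => ?_⟩
  rw [← ENNReal.pow_le_pow_left_iff two_ne_zero]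
  have hmeas : ∀ φ : 𝓢(ℝ, ℂ), Measurable fun η => ‖𝓕⁻ φ η‖ₑ ^ 2 := fun φ =>
    (measurable_fourierInv_enorm φ).pow_const 2
  have hl := lintegral_cut_high ħ hm one_pos (hmeas (T ψ))
  have hr := lintegral_cut_high ħ hm hL (hmeas ψ)
  have hlow := lintegral_cut_low ħ hd (L := 4 * L) (by positivity)
    ((measurable_bracket_rpow ħ (2 * M)).mul (hmeas ψ))
  simp only [Pi.mul_apply] at hlow
  have e1 : ∀ η, ENNReal.ofReal (bracket ħ η ^ (-(2 * M - 2 * m))) *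
      (ENNReal.ofReal (bracket ħ η ^ (2 * M)) * ‖𝓕⁻ ψ η‖ₑ ^ 2) =
      ENNReal.ofReal (bracket ħ η ^ (2 * m)) * ‖𝓕⁻ ψ η‖ₑ ^ 2 := fun η => by
    rw [← mul_assoc, ← ENNReal.ofReal_mul (Real.rpow_nonneg (bracket_pos _ _).le _),
      ← Real.rpow_add (bracket_pos _ _)]
    congr 3
    ring
  simp only [e1] at hlow
  rw [← sobolevENorm_sq] at hl hr hlow
  have hmono : ENNReal.ofReal (1 ^ (-(2 * m)) / (2 * m)) * sobolevENorm ħ m (T ψ) ^ 2 ≤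
      ∫⁻ t in Ioi (0 : ℝ), (4 * A ^ 2 * ENNReal.ofReal (L ^ (-(2 * M))) *
        (ENNReal.ofReal (t ^ (-(2 * M - 2 * m) - 1)) *
        (∫⁻ η, (if bracket ħ η < (4 * L) * t then
          ENNReal.ofReal (bracket ħ η ^ (2 * M)) * ‖𝓕⁻ ψ η‖ₑ ^ 2 else 0))) +
        4 * A ^ 2 * (ENNReal.ofReal (t ^ (2 * m - 1)) *
          ∫⁻ η, (if L * t ≤ bracket ħ η then ‖𝓕⁻ ψ η‖ₑ ^ 2 else 0))) := by
    rw [← hl]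
    refine setLIntegral_mono' measurableSet_Ioi fun t ht => ?_
    have ht : 0 < t := ht
    refine (mul_le_mul_right (lintegral_interp_aux hħ hL ht hM T hT h0 h1 ψ hψ) _).trans
      (le_of_eq ?_)
    -- The weight $t^{2m-1}$ times the loss $t^{-2M}$ is the weight $t^{-p-1}$ with $p=2M-2m$,
    -- positive because $m<M$.
    have e2 : ENNReal.ofReal (t ^ (-(2 * M - 2 * m) - 1)) =
        ENNReal.ofReal (t ^ (2 * m - 1)) * ENNReal.ofReal (t ^ (-(2 * M))) := by
      rw [← ENNReal.ofReal_mul (by positivity), ← Real.rpow_add ht]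
      congr 2; ring
    rw [e2]
    ring
  have hm2 : Measurable fun t : ℝ => ENNReal.ofReal (t ^ (-(2 * M - 2 * m) - 1)) *
      (∫⁻ η, (if bracket ħ η < (4 * L) * t then
          ENNReal.ofReal (bracket ħ η ^ (2 * M)) * ‖𝓕⁻ ψ η‖ₑ ^ 2 else 0)) := by
    refine (measurable_id.pow_const _).ennreal_ofReal.mul (Measurable.lintegral_prod_right'
      (f := fun z : ℝ × ℝ => if bracket ħ z.2 < (4 * L) * z.1 then
        ENNReal.ofReal (bracket ħ z.2 ^ (2 * M)) * ‖𝓕⁻ ψ z.2‖ₑ ^ 2 else 0) ?_)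
    refine Measurable.ite (isOpen_lt ((continuous_bracket ħ).comp continuous_snd)
      (by fun_prop)).measurableSet ?_ measurable_const
    exact ((measurable_bracket_rpow ħ (2 * M)).mul (hmeas ψ)).comp measurable_snd
  have hm3 : Measurable fun t : ℝ => ENNReal.ofReal (t ^ (2 * m - 1)) *
      (∫⁻ η, (if L * t ≤ bracket ħ η then ‖𝓕⁻ ψ η‖ₑ ^ 2 else 0)) := by
    refine (measurable_id.pow_const _).ennreal_ofReal.mul (Measurable.lintegral_prod_right'
      (f := fun z : ℝ × ℝ => if L * z.1 ≤ bracket ħ z.2 then ‖𝓕⁻ ψ z.2‖ₑ ^ 2 else 0) ?_)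
    refine Measurable.ite (isClosed_le (by fun_prop)
      ((continuous_bracket ħ).comp continuous_snd)).measurableSet ?_ measurable_const
    exact (hmeas ψ).comp measurable_snd
  rw [lintegral_add_right _ (hm3.const_mul _), lintegral_const_mul _ hm2,
    lintegral_const_mul _ hm3, hlow, hr] at hmono
  have e3 : sobolevENorm ħ m (T ψ) ^ 2 = ENNReal.ofReal (2 * m) *
      (ENNReal.ofReal (1 ^ (-(2 * m)) / (2 * m)) * sobolevENorm ħ m (T ψ) ^ 2) := by
    rw [← mul_assoc, ← ENNReal.ofReal_mul (by positivity), Real.one_rpow]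
    rw [mul_one_div_cancel (by positivity)]
    simp
  rw [e3]
  refine (mul_le_mul_right hmono _).trans (le_of_eq ?_)
  have e4 : ENNReal.ofReal (Real.sqrt Q * L ^ (-m)) ^ 2 =
      ENNReal.ofReal (2 * m) * 4 * (ENNReal.ofReal (L ^ (-(2 * M))) *
        ENNReal.ofReal ((4 * L) ^ (2 * M - 2 * m) / (2 * M - 2 * m)) +
        ENNReal.ofReal (L ^ (-(2 * m)) / (2 * m))) := by
    have f4 : (4 : ℝ≥0∞) = ENNReal.ofReal 4 := by simp
    rw [f4, ← ENNReal.ofReal_mul (by positivity), ← ENNReal.ofReal_mul (by positivity),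
      ← ENNReal.ofReal_add (by positivity) (by positivity), ← ENNReal.ofReal_mul (by positivity),
      ← ENNReal.ofReal_pow (by positivity)]
    congr 1
    have f1 : (L ^ (-m)) ^ 2 = L ^ (-(2 * m)) := by
      rw [← Real.rpow_natCast, ← Real.rpow_mul hL.le]; congr 1; push_cast; ring
    have f2 : L ^ (-(2 * M)) * L ^ (2 * M - 2 * m) = L ^ (-(2 * m)) := by
      rw [← Real.rpow_add hL]; congr 1; ring
    rw [mul_pow, Real.sq_sqrt hQ0, f1, Real.mul_rpow (by norm_num) hL.le, hQ]
    calc _ = 2 * m * 4 * (4 ^ (2 * M - 2 * m) / (2 * M - 2 * m) *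
          L ^ (-(2 * m)) + L ^ (-(2 * m)) / (2 * m)) := by ring
      _ = _ := by rw [← f2]; ring
  rw [mul_pow, mul_pow, e4]
  ring

end

noncomputable section

/-! ### Uniform estimates for the branches of an iterated function scheme -/

namespace IFS

variable {S : IFS}

/-- A contraction rate. -/
def rate (S : IFS) : ℝ := S.contraction.choose

theorem rate_pos (S : IFS) : 0 < S.rate := S.contraction.choose_spec.1

theorem rate_lt_one (S : IFS) : S.rate < 1 := S.contraction.choose_spec.2.1

/-- The derivative of `φ i j` on `I_i`. -/
def dφ (S : IFS) (i j : Fin S.N) (x : ℝ) : ℝ := derivWithin (S.φ i j) (S.interval i) x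

theorem uniqueDiffOn_interval (S : IFS) (i : Fin S.N) : UniqueDiffOn ℝ (S.interval i) :=
  uniqueDiffOn_Icc (S.lo_lt_hi i)

theorem isCompact_interval (S : IFS) (i : Fin S.N) : IsCompact (S.interval i) := isCompact_Icc

theorem convex_interval (S : IFS) (i : Fin S.N) : Convex ℝ (S.interval i) := convex_Icc _ _

theorem dφ_pos {i j : Fin S.N} (h : S.adj i j = 1) {x : ℝ} (hx : x ∈ S.interval i) :
    0 < S.dφ i j x := (S.contraction.choose_spec.2.2 i j h x hx).1

theorem dφ_le {i j : Fin S.N} (h : S.adj i j = 1) {x : ℝ} (hx : x ∈ S.interval i) :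
    S.dφ i j x ≤ S.rate := (S.contraction.choose_spec.2.2 i j h x hx).2

theorem hasDerivWithinAt_φ {i j : Fin S.N} (h : S.adj i j = 1) {x : ℝ} (hx : x ∈ S.interval i) :
    HasDerivWithinAt (S.φ i j) (S.dφ i j x) (S.interval i) x :=
  (((S.smooth i j h) x hx).differentiableWithinAt (by simp)).hasDerivWithinAt

theorem contDiffOn_dφ {i j : Fin S.N} (h : S.adj i j = 1) :
    ContDiffOn ℝ ∞ (S.dφ i j) (S.interval i) :=
  (S.smooth i j h).derivWithin (S.uniqueDiffOn_interval i) (by simp)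

theorem mapsTo_φ {i j : Fin S.N} (h : S.adj i j = 1) :
    MapsTo (S.φ i j) (S.interval i) (S.interval j) := fun x hx =>
  interior_subset (S.maps i j h ⟨x, hx, rfl⟩)

theorem mapsTo_φ_trap {i j : Fin S.N} (h : S.adj i j = 1) :
    MapsTo (S.φ i j) (S.interval i) (S.trap 1) := fun y hy =>
  S.mem_trap_succ.mpr ⟨i, j, h, y, ⟨hy, mem_iUnion.mpr ⟨i, hy⟩⟩, rfl⟩

@[simp] theorem shift_apply (w : ℤ → Fin S.N) (k l : ℤ) : shift w k l = w (l + k) := rfl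

theorem shift_shift (w : ℤ → Fin S.N) (k l : ℤ) : shift (shift w k) l = shift w (k + l) := by
  funext i; simp only [shift_apply]; congr 1; ring

@[simp] theorem shift_zero (w : ℤ → Fin S.N) : shift w 0 = w := by
  funext i; simp

theorem Admissible.shift {w : ℤ → Fin S.N} (hw : S.Admissible w) (k : ℤ) :
    S.Admissible (IFS.shift w k) := fun l => by
  have := hw (l + k)
  simp only [shift_apply]
  convert this using 3
  ring

theorem branch_zero (w : ℤ → Fin S.N) (y : ℝ) : S.branch w 0 y = y := rfl

theorem branch_succ (w : ℤ → Fin S.N) (n : ℕ) (y : ℝ) :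
    S.branch w (n + 1) y = S.φ (w n) (w (n + 1)) (S.branch w n y) := rfl

theorem branch_add (w : ℤ → Fin S.N) (k n : ℕ) (y : ℝ) :
    S.branch w (k + n) y = S.branch (shift w k) n (S.branch w k y) := by
  induction n with
  | zero => rfl
  | succ n ih =>
    rw [← add_assoc, branch_succ, branch_succ, ih]
    simp only [shift_apply]
    push_cast
    congr 2 <;> ring_nf

theorem branch_congr {w w' : ℤ → Fin S.N} {n : ℕ} (h : ∀ k : ℕ, k ≤ n → w k = w' k) :
    S.branch w n = S.branch w' n := by
  induction n with
  | zero => rfl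
  | succ n ih =>
    have h1 := h n (by omega)
    have h2 := h (n + 1) le_rfl
    push_cast at h2
    simp only [branch, ih fun k hk => h k (by omega), h1, h2]

section admissible

variable {w : ℤ → Fin S.N} (hw : S.Admissible w)

include hw

theorem mapsTo_branch (n : ℕ) : MapsTo (S.branch w n) (S.interval (w 0)) (S.interval (w n)) := by
  induction n with
  | zero => exact fun y hy => hy
  | succ n ih =>
    intro y hy
    have := mapsTo_φ (hw n) (ih hy)
    simpa [branch_succ] using this

theorem branch_mem_trap (n : ℕ) {y : ℝ} (hy : y ∈ S.interval (w 0)) :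
    S.branch w n y ∈ S.trap n := by
  induction n with
  | zero => exact mem_iUnion.mpr ⟨_, hy⟩
  | succ n ih => exact S.mem_trap_succ.mpr ⟨_, _, hw n, _, ⟨mapsTo_branch hw n hy, ih⟩, rfl⟩

end admissible

/-- The derivative of `φ_{w_{0,n}}`. -/
def dbranch (S : IFS) (w : ℤ → Fin S.N) (n : ℕ) (y : ℝ) : ℝ :=
  ∏ l ∈ Finset.range n, S.dφ (w l) (w (l + 1)) (S.branch w l y)

section admissible

variable {w : ℤ → Fin S.N} (hw : S.Admissible w)

include hw

theorem hasDerivWithinAt_branch (n : ℕ) {y : ℝ} (hy : y ∈ S.interval (w 0)) :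
    HasDerivWithinAt (S.branch w n) (S.dbranch w n y) (S.interval (w 0)) y := by
  induction n with
  | zero => simpa [dbranch, branch] using hasDerivWithinAt_id y _
  | succ n ih =>
    rw [dbranch, Finset.prod_range_succ, mul_comm]
    exact (hasDerivWithinAt_φ (hw n) (mapsTo_branch hw n hy)).comp y ih (mapsTo_branch hw n)

theorem contDiffOn_branch (n : ℕ) : ContDiffOn ℝ ∞ (S.branch w n) (S.interval (w 0)) := by
  induction n with
  | zero => exact contDiffOn_id
  | succ n ih => exact (S.smooth _ _ (hw n)).comp ih (mapsTo_branch hw n)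

theorem dbranch_pos (n : ℕ) {y : ℝ} (hy : y ∈ S.interval (w 0)) : 0 < S.dbranch w n y :=
  Finset.prod_pos fun l _ => dφ_pos (hw l) (mapsTo_branch hw l hy)

theorem dbranch_le (n : ℕ) {y : ℝ} (hy : y ∈ S.interval (w 0)) :
    S.dbranch w n y ≤ S.rate ^ n := by
  rw [← Finset.card_range n, ← Finset.prod_const, Finset.card_range]
  exact Finset.prod_le_prod (fun l _ => (dφ_pos (hw l) (mapsTo_branch hw l hy)).le)
    fun l _ => dφ_le (hw l) (mapsTo_branch hw l hy)

theorem dist_branch_le (n : ℕ) {y z : ℝ} (hy : y ∈ S.interval (w 0)) (hz : z ∈ S.interval (w 0)) :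
    |S.branch w n y - S.branch w n z| ≤ S.rate ^ n * |y - z| := by
  have := (S.convex_interval (w 0)).norm_image_sub_le_of_norm_hasDerivWithin_le
    (fun x hx => hasDerivWithinAt_branch hw n hx) (C := S.rate ^ n)
    (fun x hx => by
      rw [Real.norm_eq_abs, abs_of_pos (dbranch_pos hw n hx)]
      exact dbranch_le hw n hx) hz hy
  simpa [Real.norm_eq_abs] using this

theorem strictMonoOn_branch (n : ℕ) : StrictMonoOn (S.branch w n) (S.interval (w 0)) := by
  refine strictMonoOn_of_deriv_pos (convex_Icc _ _)
    (fun y hy => (hasDerivWithinAt_branch hw n hy).continuousWithinAt) fun y hy => ?_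
  have hn : S.interval (w 0) ∈ 𝓝 y := mem_interior_iff_mem_nhds.mp hy
  rw [((hasDerivWithinAt_branch hw n (interior_subset hy)).hasDerivAt hn).deriv]
  exact dbranch_pos hw n (interior_subset hy)

end admissible

/-- An upper bound for the lengths of the intervals. -/
theorem exists_length_le (S : IFS) : ∃ ℓ : ℝ, 0 ≤ ℓ ∧ ∀ i, ∀ x ∈ S.interval i, ∀ y ∈ S.interval i,
    |x - y| ≤ ℓ := by
  refine ⟨∑ i, (S.hi i - S.lo i), Finset.sum_nonneg fun i _ => by linarith [S.lo_lt_hi i],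
    fun i x hx y hy => ?_⟩
  have : S.hi i - S.lo i ≤ ∑ i, (S.hi i - S.lo i) :=
    Finset.single_le_sum (f := fun i => S.hi i - S.lo i)
      (fun i _ => by linarith [S.lo_lt_hi i]) (Finset.mem_univ i)
  refine le_trans ?_ this
  rw [abs_le]
  constructor <;> linarith [hx.1, hx.2, hy.1, hy.2]

section point

variable {w : ℤ → Fin S.N} (hw : S.Admissible w)

include hw

/-- The images are nested non-empty compact sets whose diameters are at most `S.rate ^ n` times a
common length. They are nested because a past of length $n+1$ is one map followed by a past of
length $n$. -/
theorem exists_iInter_eq_singleton : ∃ x,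
    ⋂ n : ℕ, S.branch (shift w (-n)) n '' S.interval (w (-n)) = {x} := by
  have h0 : ∀ n : ℕ, shift w (-n) 0 = w (-n) := fun n => by simp
  have hadm : ∀ n : ℕ, S.Admissible (shift w (-(n : ℤ))) := fun n => hw.shift _
  have hcont : ∀ n : ℕ, ContinuousOn (S.branch (shift w (-n)) n) (S.interval (w (-n))) :=
    fun n => by rw [← h0]; exact (contDiffOn_branch (hadm n) n).continuousOn
  have hc : ∀ n : ℕ, IsCompact (S.branch (shift w (-n)) n '' S.interval (w (-n))) :=
    fun n => (S.isCompact_interval _).image_of_continuousOn (hcont n)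
  obtain ⟨x, hx⟩ := IsCompact.nonempty_iInter_of_sequence_nonempty_isCompact_isClosed
    (fun n : ℕ => S.branch (shift w (-n)) n '' S.interval (w (-n))) (fun n => by
      rintro _ ⟨y, hy, rfl⟩
      have hy' : y ∈ S.interval (shift w (-((n : ℤ) + 1)) 0) := by simpa using hy
      have h1 := mapsTo_branch (hw.shift (-((n : ℤ) + 1))) 1 hy'
      refine ⟨S.branch (shift w (-((n : ℤ) + 1))) 1 y, ?_, ?_⟩
      · convert h1 using 2
        simp
      · have := branch_add (shift w (-((n : ℤ) + 1))) 1 n y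
        rw [shift_shift] at this
        push_cast
        rw [add_comm 1 n] at this
        rw [this]
        congr 2
        push_cast
        ring)
    (fun n => ⟨_, mem_image_of_mem _ (left_mem_Icc.mpr (S.lo_lt_hi _).le)⟩) (hc 0)
    fun n => (hc n).isClosed
  refine ⟨x, subset_antisymm (fun y hy => ?_) (by simpa using hx)⟩
  obtain ⟨ℓ, hℓ, hlen⟩ := S.exists_length_le
  have key : ∀ n : ℕ, |y - x| ≤ S.rate ^ n * ℓ := fun n => by
    obtain ⟨y', hy', ey⟩ := mem_iInter.mp hy n
    obtain ⟨x', hx', ex⟩ := mem_iInter.mp hx n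
    rw [← ey, ← ex]
    refine (dist_branch_le (hadm n) n (by rwa [h0]) (by rwa [h0])).trans ?_
    exact mul_le_mul_of_nonneg_left (hlen _ _ hy' _ hx') (pow_nonneg S.rate_pos.le _)
  have lim : Tendsto (fun n : ℕ => S.rate ^ n * ℓ) atTop (𝓝 (0 * ℓ)) :=
    (tendsto_pow_atTop_nhds_zero_of_lt_one S.rate_pos.le S.rate_lt_one).mul_const ℓ
  have : |y - x| ≤ 0 * ℓ := ge_of_tendsto' lim key
  rw [zero_mul] at this
  exact sub_eq_zero.mp (abs_eq_zero.mp (le_antisymm this (abs_nonneg _)))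

theorem iInter_eq_point :
    ⋂ n : ℕ, S.branch (shift w (-n)) n '' S.interval (w (-n)) = {S.point w} :=
  Classical.epsilon_spec (exists_iInter_eq_singleton hw)

theorem point_mem_image (n : ℕ) :
    S.point w ∈ S.branch (shift w (-n)) n '' S.interval (w (-n)) := by
  have := (iInter_eq_point hw).symm ▸ mem_singleton (S.point w)
  exact mem_iInter.mp this n

theorem eq_point {x : ℝ} (hx : ∀ n : ℕ, x ∈ S.branch (shift w (-n)) n '' S.interval (w (-n))) :
    x = S.point w := by
  have : x ∈ ⋂ n : ℕ, S.branch (shift w (-n)) n '' S.interval (w (-n)) := mem_iInter.mpr hx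
  rwa [iInter_eq_point hw] at this

theorem point_mem : S.point w ∈ S.interval (w 0) := by
  have := point_mem_image hw 0
  simpa [branch] using this

theorem point_mem_trap (n : ℕ) : S.point w ∈ S.trap n := by
  obtain ⟨y, hy, e⟩ := point_mem_image hw n
  rw [← e]
  exact branch_mem_trap (hw.shift _) n (by simpa using hy)

theorem point_mem_interior : S.point w ∈ interior (S.interval (w 0)) :=
  S.mem_interior_interval _ (point_mem_trap hw 1) (point_mem hw)

/-- The image of $x_w$ lies in every set whose intersection defines $x_{Lw}$: a past of length $n+1$
for $Lw$ is a past of length $n$ for $w$ followed by $\phi_{w_0,w_1}$. -/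
theorem φ_point : S.φ (w 0) (w 1) (S.point w) = S.point (shift w 1) := by
  refine eq_point (hw.shift 1) fun n => ?_
  cases n with
  | zero =>
    have := mapsTo_φ (hw 0) (point_mem hw)
    simpa [branch] using this
  | succ n =>
    obtain ⟨z, hz, e⟩ := point_mem_image hw n
    have e1 : shift (shift w 1) (-((n + 1 : ℕ) : ℤ)) = shift w (-n) := by
      rw [shift_shift]; congr 1; push_cast; ring
    refine ⟨z, ?_, ?_⟩
    · convert hz using 2
      simp
    · rw [e1, branch_succ, e]
      simp

theorem branch_point (n : ℕ) : S.branch w n (S.point w) = S.point (shift w n) := by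
  induction n with
  | zero => simp [branch]
  | succ n ih =>
    rw [branch_succ, ih]
    have := φ_point (hw.shift n)
    rw [shift_shift] at this
    simp only [shift_apply, zero_add] at this
    push_cast
    rw [← this, add_comm 1 (n : ℤ)]

end point

end IFS

end

/-! ### Derivatives along orbits, uniformly in the word and its length. -/

noncomputable section

namespace IFS

variable {S : IFS}

/-- Families of smooth functions, indexed by the edges, along the orbits of the system. -/
theorem exists_hbound_comp_branch {n : ℕ}
    (hp : ∃ B : ℝ, 0 ≤ B ∧ ∀ w, S.Admissible w → ∀ k,
      HBound 1 (S.interval (w 0)) (n - 1) (fun _ => B) (fun y => (S.dbranch w k y : ℂ)))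
    {F : Fin S.N → Fin S.N → ℝ → ℂ}
    (hF : ∀ i j, S.adj i j = 1 → ContDiffOn ℝ ∞ (F i j) (S.interval i)) :
    ∃ K : ℝ, 0 ≤ K ∧ ∀ w, S.Admissible w → ∀ k : ℕ, HBound 1 (S.interval (w 0)) n (fun _ => K)
      (fun y => F (w k) (w (k + 1)) (S.branch w k y)) := by
  obtain ⟨B, hB, hp⟩ := hp
  have h1 : ∀ i j, ∃ A : ℝ, 0 ≤ A ∧ (S.adj i j = 1 →
      HBound 1 (S.interval i) n (fun _ => A) (F i j)) := fun i j => by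
    by_cases h : S.adj i j = 1
    · obtain ⟨A, hA, h'⟩ := HBound.of_contDiffOn (S.uniqueDiffOn_interval i)
        (S.isCompact_interval i) n (hF i j h)
      exact ⟨A, hA, fun _ => h'⟩
    · exact ⟨0, le_rfl, fun h' => absurd h' h⟩
  choose A hA hA1 using h1
  have hAle : ∀ i j, A i j ≤ ∑ i, ∑ j, A i j := fun i j =>
    (Finset.single_le_sum (f := fun j => A i j) (fun j _ => hA i j) (Finset.mem_univ j)).trans
      (Finset.single_le_sum (f := fun i => ∑ j, A i j)
        (fun i _ => Finset.sum_nonneg fun j _ => hA i j) (Finset.mem_univ i))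
  have hA0 : 0 ≤ ∑ i, ∑ j, A i j := Finset.sum_nonneg fun i _ => Finset.sum_nonneg fun j _ => hA i j
  refine ⟨(1 + 2 ^ n * B) ^ n * ∑ _i ∈ Finset.range (n + 1), ∑ i, ∑ j, A i j, by positivity,
    fun w hw k => ?_⟩
  have hb := hA1 _ _ (hw k)
  have hu := S.uniqueDiffOn_interval (w k)
  refine (HBound.comp (ħ := 1) zero_le_one (r := 1) zero_le_one hB (mapsTo_branch hw k)
    (q := S.dbranch w k) (fun y hy => by simpa using hasDerivWithinAt_branch hw k hy)
    (F := fun i => iteratedDerivWithin i (F (w k) (w (k + 1))) (S.interval (w k)))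
    (fun i hi z hz => hb.hasDerivWithinAt_iteratedDerivWithin hu one_ne_zero hi z hz)
    (hp w hw k)).congr (fun y _ => by simp [iteratedDerivWithin_zero]) |>.mono fun y hy => ?_
  refine mul_le_mul_of_nonneg_left (Finset.sum_le_sum fun i hi => ?_) (by positivity)
  have := hb.iteratedDerivWithin_le hu (i := i) (by simpa [Nat.lt_succ_iff] using hi) _
    (mapsTo_branch hw k hy)
  simp only [abs_one, one_pow, one_mul] at this
  simpa using this.trans (hAle _ _)

theorem sum_rate_pow_le (S : IFS) (k : ℕ) : ∑ l ∈ Finset.range k, S.rate ^ l ≤ (1 - S.rate)⁻¹ :=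
  (Summable.sum_le_tsum _ (fun l _ => pow_nonneg S.rate_pos.le l)
    (summable_geometric_of_lt_one S.rate_pos.le S.rate_lt_one)).trans_eq
    (tsum_geometric_of_lt_one S.rate_pos.le S.rate_lt_one)

/-- The logarithmic derivative of the derivatives of the maps `φ i j`. -/
def ddφ (S : IFS) (i j : Fin S.N) (x : ℝ) : ℝ :=
  derivWithin (S.dφ i j) (S.interval i) x / S.dφ i j x

/-- Logarithmic differentiation of the product. Each term of the sum carries the factor `S.dbranch w
l y`, at most `S.rate ^ l`, which is what bounds the sum independently of `k`. -/
theorem hasDerivWithinAt_dbranch {w : ℤ → Fin S.N} (hw : S.Admissible w) (k : ℕ) {y : ℝ}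
    (hy : y ∈ S.interval (w 0)) : HasDerivWithinAt (S.dbranch w k)
      (S.dbranch w k y * ∑ l ∈ Finset.range k,
        S.ddφ (w l) (w (l + 1)) (S.branch w l y) * S.dbranch w l y) (S.interval (w 0)) y := by
  induction k with
  | zero =>
    have e : S.dbranch w 0 = fun _ => 1 := by funext z; simp [dbranch]
    simpa [e] using hasDerivWithinAt_const y (S.interval (w 0)) (1 : ℝ)
  | succ k ih =>
    have h1 : HasDerivWithinAt (fun y => S.dφ (w k) (w (k + 1)) (S.branch w k y)) _
        (S.interval (w 0)) y :=
      (((contDiffOn_dφ (hw k)) _ (mapsTo_branch hw k hy)).differentiableWithinAt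
        (by simp)).hasDerivWithinAt.comp y (hasDerivWithinAt_branch hw k hy) (mapsTo_branch hw k)
    have e : S.dbranch w (k + 1) =
        fun y => S.dbranch w k y * S.dφ (w k) (w (k + 1)) (S.branch w k y) := by
      funext y; rw [dbranch, Finset.prod_range_succ]; rfl
    rw [e]
    refine (ih.mul h1).congr_deriv ?_
    have hne := (dφ_pos (hw k) (mapsTo_branch hw k hy)).ne'
    rw [Finset.sum_range_succ, ddφ]
    field_simp

/-- After division by `S.rate ^ k` the derivative solves $u'=qu$ with $|u|\le1$ and with $q$ a
geometric sum, bounded uniformly in `k`. `HBound.of_ode` then gains one order, and the coefficient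
$q$ involves only the orders already treated. -/
theorem exists_hbound_dbranch (S : IFS) (n : ℕ) : ∃ C : ℝ, 0 ≤ C ∧ ∀ w, S.Admissible w → ∀ k,
    HBound 1 (S.interval (w 0)) n (fun _ => C * S.rate ^ k) fun y => (S.dbranch w k y : ℂ) := by
  induction n with
  | zero =>
    refine ⟨1, zero_le_one, fun w hw k y hy => ?_⟩
    rw [Complex.norm_real, Real.norm_eq_abs, abs_of_pos (dbranch_pos hw k hy), one_mul]
    exact dbranch_le hw k hy
  | succ n ih =>
    obtain ⟨C, hC, h⟩ := ih
    have hr := S.rate_pos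
    have hr1 := S.rate_lt_one
    have hsm : ∀ i j, S.adj i j = 1 →
        ContDiffOn ℝ ∞ (fun x => (S.ddφ i j x : ℂ)) (S.interval i) := fun i j hij => by
      have h2 : ContDiffOn ℝ ∞ (S.ddφ i j) (S.interval i) :=
        ((contDiffOn_dφ hij).derivWithin (S.uniqueDiffOn_interval i) (by simp)).div
          (contDiffOn_dφ hij) fun x hx => (dφ_pos hij hx).ne'
      exact Complex.ofRealCLM.contDiff.comp_contDiffOn h2
    -- Composition with a branch to order `n` needs its derivative only to order `n - 1`, so the
    -- induction hypothesis suffices.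
    obtain ⟨K, hK, hKb⟩ := exists_hbound_comp_branch (n := n) ⟨C, hC, fun w hw k =>
      ((h w hw k).mono_order (by omega)).mono fun y _ =>
        mul_le_of_le_one_right hC (pow_le_one₀ hr.le hr1.le)⟩ hsm
    have h1r : 0 < 1 - S.rate := by linarith
    obtain ⟨A, hA, hode⟩ := HBound.of_ode n (2 ^ n * C * K * (1 - S.rate)⁻¹) 1 (by positivity)
      zero_le_one
    refine ⟨A, hA, fun w hw k => ?_⟩
    have hq : HBound 1 (S.interval (w 0)) n (fun _ => 2 ^ n * C * K * (1 - S.rate)⁻¹)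
        (fun y => ∑ l ∈ Finset.range k,
          (S.dbranch w l y : ℂ) * (S.ddφ (w l) (w (l + 1)) (S.branch w l y) : ℂ)) := by
      refine (HBound.sum (Finset.range k) fun l _ =>
        HBound.mul hK (h w hw l) (hKb w hw l)).mono fun y _ => ?_
      rw [← Finset.mul_sum, ← Finset.mul_sum]
      calc _ = 2 ^ n * C * K * ∑ l ∈ Finset.range k, S.rate ^ l := by ring
        _ ≤ _ := mul_le_mul_of_nonneg_left (S.sum_rate_pow_le k) (by positivity)
    have hrk : (0 : ℝ) < S.rate ^ k := by positivity
    have hd : ∀ y ∈ S.interval (w 0), HasDerivWithinAt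
        (fun y => ((S.rate ^ k : ℝ) : ℂ)⁻¹ * (S.dbranch w k y : ℂ))
        (((S.rate ^ k : ℝ) : ℂ)⁻¹ * ((S.dbranch w k y * ∑ l ∈ Finset.range k,
        S.ddφ (w l) (w (l + 1)) (S.branch w l y) * S.dbranch w l y : ℝ) : ℂ))
        (S.interval (w 0)) y := fun y hy =>
      (hasDerivWithinAt_dbranch hw k hy).ofReal_comp.const_mul _
    have := (hode 1 _ _ _ _ hd (fun y hy => by
      push_cast
      simp only [mul_comm (S.ddφ _ _ _ : ℂ)]
      ring) hq (fun y hy => by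
      rw [norm_mul, norm_inv, Complex.norm_real, Complex.norm_real, Real.norm_eq_abs,
        Real.norm_eq_abs, abs_of_pos hrk, abs_of_pos (dbranch_pos hw k hy),
        inv_mul_le_one₀ hrk]
      exact dbranch_le hw k hy)).const_mul ((S.rate ^ k : ℝ) : ℂ)
    refine (this.congr fun y hy => ?_).mono fun y hy => ?_
    · rw [← mul_assoc, mul_inv_cancel₀ (by exact_mod_cast hrk.ne'), one_mul]
    · rw [Complex.norm_real, Real.norm_eq_abs, abs_of_pos hrk, mul_comm]

theorem exists_hbound_dbranch_const (S : IFS) (n : ℕ) : ∃ C : ℝ, 0 ≤ C ∧ ∀ w, S.Admissible w →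
    ∀ k, HBound 1 (S.interval (w 0)) n (fun _ => C) fun y => (S.dbranch w k y : ℂ) := by
  obtain ⟨C, hC, h⟩ := S.exists_hbound_dbranch n
  exact ⟨C, hC, fun w hw k => (h w hw k).mono fun y _ =>
    mul_le_of_le_one_right hC (pow_le_one₀ S.rate_pos.le S.rate_lt_one.le)⟩

/-- `g` is smooth on `φ(I)`, in the coordinates given by the inverse branches. -/
def EdgeSmooth (S : IFS) (g : ℝ → ℂ) : Prop :=
  ∀ i j, S.adj i j = 1 → ContDiffOn ℝ ∞ (fun y => g (S.φ i j y)) (S.interval i)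

theorem EdgeSmooth.of_contDiffOn {g : ℝ → ℂ} (hg : ContDiffOn ℝ ∞ g (S.trap 1)) :
    S.EdgeSmooth g := fun i j h => hg.comp (S.smooth i j h) (mapsTo_φ_trap h)

/-- The difference between `g` along the orbit of `y` and `g` along the orbit of `x_w`. -/
def orbitDiff (S : IFS) (g : ℝ → ℂ) (w : ℤ → Fin S.N) (k : ℕ) (y : ℝ) : ℂ :=
  g (S.branch w (k + 1) y) - g (S.branch w (k + 1) (S.point w))

/-- The derivative of the difference is `S.dbranch w k` times a bounded function, of size `S.rate ^
k`. The difference vanishes at $x_w$, so the mean value inequality gives the same decay for its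
values. -/
theorem exists_hbound_orbitDiff {g : ℝ → ℂ} (hg : S.EdgeSmooth g) (n : ℕ) :
    ∃ C : ℝ, 0 ≤ C ∧ ∀ w, S.Admissible w → ∀ k,
      HBound 1 (S.interval (w 0)) n (fun _ => C * S.rate ^ k) (S.orbitDiff g w k) := by
  obtain ⟨ℓ, hℓ, hlen⟩ := S.exists_length_le
  set G : Fin S.N → Fin S.N → ℝ → ℂ := fun i j =>
    derivWithin (fun y => g (S.φ i j y)) (S.interval i) with hG
  obtain ⟨K, hK, hKb⟩ := exists_hbound_comp_branch (n := n) (S.exists_hbound_dbranch_const _)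
    (F := G) fun i j h => (hg i j h).derivWithin (S.uniqueDiffOn_interval i) (by simp)
  obtain ⟨B, hB, hBb⟩ := S.exists_hbound_dbranch n
  have hd : ∀ w, S.Admissible w → ∀ k, ∀ y ∈ S.interval (w 0), HasDerivWithinAt
      (S.orbitDiff g w k) ((S.dbranch w k y : ℂ) * G (w k) (w (k + 1)) (S.branch w k y))
      (S.interval (w 0)) y := fun w hw k y hy => by
    have h1 := ((hg _ _ (hw k) _ (mapsTo_branch hw k hy)).differentiableWithinAt
      (by simp)).hasDerivWithinAt
    have h2 := h1.scomp y (hasDerivWithinAt_branch hw k hy) (mapsTo_branch hw k)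
    rw [Complex.real_smul] at h2
    exact h2.sub_const _
  have hb : ∀ w, S.Admissible w → ∀ k, HBound 1 (S.interval (w 0)) n
      (fun _ => 2 ^ n * K * B * S.rate ^ k)
      fun y => (S.dbranch w k y : ℂ) * G (w k) (w (k + 1)) (S.branch w k y) := fun w hw k =>
    (HBound.mul hK (hBb w hw k) (hKb w hw k)).mono fun y _ => by rw [← mul_assoc]
  -- The factor $1+\ell$ serves both purposes: it bounds the distance to $x_w$ for the values, and
  -- it is at least $1$ for the derivatives.
  set C : ℝ := 2 ^ n * K * B * (1 + ℓ) with hC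
  have hr := S.rate_pos
  have h0 : ∀ w, S.Admissible w → ∀ k, ∀ y ∈ S.interval (w 0),
      ‖S.orbitDiff g w k y‖ ≤ C * S.rate ^ k := fun w hw k y hy => by
    have h3 := (S.convex_interval (w 0)).norm_image_sub_le_of_norm_hasDerivWithin_le
      (hd w hw k) (fun z hz => (hb w hw k).norm_le z hz) (point_mem hw) hy
    have h4 : S.orbitDiff g w k (S.point w) = 0 := sub_self _
    rw [h4, sub_zero] at h3
    refine h3.trans ?_
    have h5 : ‖y - S.point w‖ ≤ 1 + ℓ := by
      rw [Real.norm_eq_abs]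
      linarith [hlen _ _ hy _ (point_mem hw)]
    calc _ ≤ 2 ^ n * K * B * S.rate ^ k * (1 + ℓ) :=
          mul_le_mul_of_nonneg_left h5 (by positivity)
      _ = _ := by rw [hC]; ring
  refine ⟨C, by positivity, fun w hw k => ?_⟩
  cases n with
  | zero => exact h0 w hw k
  | succ n =>
    refine ⟨h0 w hw k, _, hd w hw k, ?_⟩
    refine (((hb w hw k).of_succ).congr fun y _ => by simp).mono fun y _ => ?_
    refine mul_le_mul_of_nonneg_right ?_ (by positivity)
    rw [hC]
    exact le_mul_of_one_le_right (by positivity) (by linarith)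

end IFS

end

/-! ### The Jacobian function and the quotients of cut-offs. -/

noncomputable section

/-- A left inverse on a compact set is differentiable on the image. -/
theorem IsCompact.hasDerivWithinAt_leftInverse {I : Set ℝ} (hI : IsCompact I) {f g : ℝ → ℝ}
    (hf : ContinuousOn f I) (hgf : ∀ x ∈ I, g (f x) = x) {y f' : ℝ} (hy : y ∈ I)
    (hd : HasDerivWithinAt f f' I y) (hf' : f' ≠ 0) :
    HasDerivWithinAt g f'⁻¹ (f '' I) (f y) := by
  -- A continuous map on a compact set is closed, so its left inverse is continuous on the image.
  have hcont : ContinuousOn g (f '' I) := by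
    rw [continuousOn_iff_isClosed]
    intro t ht
    refine ⟨f '' (t ∩ I), ((hI.inter_left ht).image_of_continuousOn
      (hf.mono inter_subset_right)).isClosed, ?_⟩
    ext z
    constructor
    · rintro ⟨hz, x, hx, rfl⟩
      rw [mem_preimage, hgf x hx] at hz
      exact ⟨⟨x, ⟨hz, hx⟩, rfl⟩, x, hx, rfl⟩
    · rintro ⟨⟨x, ⟨hz, hx⟩, rfl⟩, -⟩
      exact ⟨by rwa [mem_preimage, hgf x hx], x, hx, rfl⟩
  have ht : Tendsto g (𝓝[f '' I] (f y)) (𝓝[I] (g (f y))) :=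
    tendsto_nhdsWithin_iff.mpr ⟨hcont _ ⟨y, hy, rfl⟩, by
      filter_upwards [self_mem_nhdsWithin] with z hz
      obtain ⟨x, hx, rfl⟩ := hz
      rwa [hgf x hx]⟩
  have hd' : HasFDerivWithinAt f (ContinuousLinearEquiv.unitsEquivAut ℝ (Units.mk0 f' hf') :
      ℝ →L[ℝ] ℝ) I (g (f y)) := by
    rw [hgf y hy]
    have e : (ContinuousLinearEquiv.unitsEquivAut ℝ (Units.mk0 f' hf') : ℝ →L[ℝ] ℝ) =
        ContinuousLinearMap.toSpanSingleton ℝ f' := by ext; simp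
    rw [e]
    exact hd
  have := HasFDerivWithinAt.of_local_left_inverse ht hd' ⟨y, hy, rfl⟩ (by
    filter_upwards [self_mem_nhdsWithin] with z hz
    obtain ⟨x, hx, rfl⟩ := hz
    rw [hgf x hx])
  refine this.hasDerivWithinAt.congr_deriv ?_
  have e : (ContinuousLinearEquiv.unitsEquivAut ℝ (Units.mk0 f' hf')) f'⁻¹ = 1 := by simp [hf']
  exact (ContinuousLinearEquiv.symm_apply_eq _).mpr e.symm

namespace IFS

variable {S : IFS}

theorem injOn_φ {i j : Fin S.N} (h : S.adj i j = 1) : InjOn (S.φ i j) (S.interval i) := by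
  refine (strictMonoOn_of_deriv_pos (convex_Icc _ _) (S.smooth i j h).continuousOn
    fun y hy => ?_).injOn
  have hn : S.interval i ∈ 𝓝 y := mem_interior_iff_mem_nhds.mp hy
  rw [((hasDerivWithinAt_φ h (interior_subset hy)).hasDerivAt hn).deriv]
  exact dφ_pos h (interior_subset hy)

theorem phiInv_φ {i j : Fin S.N} (h : S.adj i j = 1) {y : ℝ} (hy : y ∈ S.interval i) :
    S.phiInv (S.φ i j y) = y := by
  obtain ⟨i', j', h', hy', e⟩ := Classical.epsilon_spec
    (p := fun z => ∃ i' j', S.adj i' j' = 1 ∧ z ∈ S.interval i' ∧ S.φ i' j' z = S.φ i j y)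
    ⟨y, i, j, h, hy, rfl⟩
  change S.phiInv (S.φ i j y) ∈ S.interval i' at hy'
  change S.φ i' j' (S.phiInv (S.φ i j y)) = _ at e
  by_cases hij : (i', j') = (i, j)
  · obtain ⟨rfl, rfl⟩ := Prod.mk.inj hij
    exact injOn_φ h hy' hy e
  · exact absurd ⟨y, hy, e.symm⟩ (fun hh => Set.disjoint_left.mp
      (S.separated i' j' i j h' h hij) ⟨_, hy', rfl⟩ hh)

/-- The images of the other edges form a finite union of compact sets, disjoint from this one. Near
$\phi_{i,j}(y)$ the set $K_1$ is therefore just the image of a single edge. -/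
theorem image_mem_nhdsWithin_trap {i j : Fin S.N} (h : S.adj i j = 1) {y : ℝ}
    (hy : y ∈ S.interval i) : S.φ i j '' S.interval i ∈ 𝓝[S.trap 1] (S.φ i j y) := by
  have hcl : IsClosed (⋃ p ∈ {p : Fin S.N × Fin S.N | S.adj p.1 p.2 = 1 ∧ p ≠ (i, j)},
      S.φ p.1 p.2 '' S.interval p.1) := (Set.toFinite _).isClosed_biUnion fun p hp =>
    ((S.isCompact_interval _).image_of_continuousOn (S.smooth _ _ hp.1).continuousOn).isClosed
  have hx : S.φ i j y ∈ (⋃ p ∈ {p : Fin S.N × Fin S.N | S.adj p.1 p.2 = 1 ∧ p ≠ (i, j)},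
      S.φ p.1 p.2 '' S.interval p.1)ᶜ := by
    simp only [mem_compl_iff, mem_iUnion, not_exists]
    exact fun p hp hmem => Set.disjoint_left.mp (S.separated p.1 p.2 i j hp.1 h hp.2) hmem
      ⟨y, hy, rfl⟩
  rw [mem_nhdsWithin]
  refine ⟨_, hcl.isOpen_compl, hx, ?_⟩
  rintro z ⟨hz, hzt⟩
  obtain ⟨k, l, hkl, x, ⟨hxk, -⟩, rfl⟩ := S.mem_trap_succ.mp hzt
  by_cases e : (k, l) = (i, j)
  · obtain ⟨rfl, rfl⟩ := Prod.mk.inj e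
    exact ⟨x, hxk, rfl⟩
  · exact absurd (mem_biUnion (t := fun p : Fin S.N × Fin S.N => S.φ p.1 p.2 '' S.interval p.1)
      (show (k, l) ∈ {p : Fin S.N × Fin S.N | S.adj p.1 p.2 = 1 ∧ p ≠ (i, j)} from ⟨hkl, e⟩)
      ⟨x, hxk, rfl⟩) hz

/-- On $K_1$ near $\phi_{i,j}(y)$ the map `S.phiInv` inverts one branch only, so the derivative
relative to $K_1$ can be computed on the image of that branch. -/
theorem J_φ {i j : Fin S.N} (h : S.adj i j = 1) {y : ℝ} (hy : y ∈ S.interval i) :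
    S.J (S.φ i j y) = -Real.log (S.dφ i j y) := by
  have hd := hasDerivWithinAt_φ h hy
  have hne := (dφ_pos h hy).ne'
  have h1 := (S.isCompact_interval i).hasDerivWithinAt_leftInverse
    (S.smooth i j h).continuousOn (fun x hx => phiInv_φ h hx) hy hd hne
  have h2 := h1.mono_of_mem_nhdsWithin (image_mem_nhdsWithin_trap h hy)
  have hu : UniqueDiffWithinAt ℝ (S.φ i j '' S.interval i) (S.φ i j y) := by
    refine hd.hasFDerivWithinAt.uniqueDiffWithinAt (S.uniqueDiffOn_interval i y hy) ?_
    refine Function.Surjective.denseRange fun z => ⟨z / S.dφ i j y, ?_⟩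
    simp [hne]
  have hsub : S.φ i j '' S.interval i ⊆ S.trap 1 := (mapsTo_φ_trap h).image_subset
  rw [J, h2.derivWithin (hu.mono hsub), Real.log_inv]

theorem edgeSmooth_J : S.EdgeSmooth fun x => (S.J x : ℂ) := fun i j h => by
  have : ContDiffOn ℝ ∞ (fun y => -Real.log (S.dφ i j y)) (S.interval i) :=
    ((contDiffOn_dφ h).log fun x hx => (dφ_pos h hx).ne').neg
  exact Complex.ofRealCLM.contDiff.comp_contDiffOn (this.congr fun y hy => J_φ h hy)

theorem birkhoff_eq {E : Type*} [AddCommMonoid E] (g : ℝ → E) (n : ℕ) (w : ℤ → Fin S.N) :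
    S.birkhoff g n w = ∑ k ∈ Finset.range n, g (S.branch w (k + 1) (S.point w)) := by
  rw [birkhoff, Finset.range_eq_Ico,
    Finset.sum_Ico_add' (fun k => g (S.branch w k (S.point w))) 0 n 1, zero_add]
  rfl

theorem sum_J_eq {w : ℤ → Fin S.N} (hw : S.Admissible w) (n : ℕ) {y : ℝ}
    (hy : y ∈ S.interval (w 0)) :
    ∑ k ∈ Finset.range n, S.J (S.branch w (k + 1) y) = -Real.log (S.dbranch w n y) := by
  rw [dbranch, Real.log_prod fun (l : ℕ) _ => (dφ_pos (hw l) (mapsTo_branch hw l hy)).ne',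
    ← Finset.sum_neg_distrib]
  exact Finset.sum_congr rfl fun k _ => J_φ (hw k) (mapsTo_branch hw k hy)

theorem exp_neg_birkhoff_J {w : ℤ → Fin S.N} (hw : S.Admissible w) (n : ℕ) :
    Real.exp (-S.birkhoff S.J n w) = S.dbranch w n (S.point w) := by
  rw [birkhoff_eq, sum_J_eq hw n (point_mem hw), neg_neg,
    Real.exp_log (dbranch_pos hw n (point_mem hw))]

theorem isCompact_trap (S : IFS) (n : ℕ) : IsCompact (S.trap n) := by
  induction n with
  | zero => exact isCompact_iUnion fun i => S.isCompact_interval i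
  | succ n ih =>
    refine isCompact_iUnion fun i => isCompact_iUnion fun j => ?_
    by_cases h : S.adj i j = 1
    · simp only [h, iUnion_true]
      exact ((S.isCompact_interval i).inter ih).image_of_continuousOn
        ((S.smooth i j h).continuousOn.mono inter_subset_left)
    · simp [h]

theorem trap_antitone (S : IFS) : Antitone S.trap :=
  antitone_nat_of_succ_le fun n => (S.trap_succ_subset_interior n).trans interior_subset

theorem branch_mem_trap_add {w : ℤ → Fin S.N} (hw : S.Admissible w) (n k : ℕ) {y : ℝ}
    (hy : y ∈ S.interval (w 0)) (hk : y ∈ S.trap k) : S.branch w n y ∈ S.trap (k + n) := by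
  induction n with
  | zero => exact hk
  | succ n ih => exact S.mem_trap_succ.mpr ⟨_, _, hw n, _, ⟨mapsTo_branch hw n hy, ih⟩, rfl⟩

end IFS

namespace TransferData

variable {S : IFS} (D : TransferData S)

open IFS

theorem χ_pos_of_mem {n : ℕ} (hn : D.a < n) {x : ℝ} (hx : x ∈ S.trap n) : 0 < D.χ x :=
  D.χ_pos x (S.trap_succ_subset_interior _ (S.trap_antitone hn hx))

theorem mem_trap_of_χ_ne {x : ℝ} (hx : D.χ x ≠ 0) : x ∈ S.trap D.a :=
  D.χ_supp (subset_tsupport _ hx)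

theorem χ_branch_pos {w : ℤ → Fin S.N} (hw : S.Admissible w) {n : ℕ} (hn : 1 ≤ n) {y : ℝ}
    (hy : y ∈ S.interval (w 0)) (hχ : D.χ y ≠ 0) : 0 < D.χ (S.branch w n y) :=
  D.χ_pos_of_mem (by omega) (branch_mem_trap_add hw n D.a hy (D.mem_trap_of_χ_ne hχ))

/-- The ratio `χ / (χ ∘ φ)`. -/
def ratio (w : ℤ → Fin S.N) (n : ℕ) (y : ℝ) : ℂ := (D.χ y : ℂ) * (D.χ (S.branch w n y) : ℂ)⁻¹

/-- The inserted factor $\chi(\phi_{w_{0,n}}(y))$ is non-zero as soon as $\chi(y)\ne0$. Where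
$\chi(y)=0$ both sides vanish. -/
theorem ratio_succ {w : ℤ → Fin S.N} (hw : S.Admissible w) {n : ℕ} (hn : 1 ≤ n) {y : ℝ}
    (hy : y ∈ S.interval (w 0)) : D.ratio w (n + 1) y = D.ratio w n y *
      ((D.χ (S.branch w n y) : ℂ) * (D.χ (S.branch w (n + 1) y) : ℂ)⁻¹) := by
  simp only [ratio]
  by_cases hχ : D.χ y = 0
  · simp [hχ]
  · have := (D.χ_branch_pos hw hn hy hχ).ne'
    have : (D.χ (S.branch w n y) : ℂ) ≠ 0 := by exact_mod_cast this
    field_simp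

/-- There is no singularity where $\chi\circ\phi_{i,j}$ vanishes: a point of the support of $\chi$
lies in $K_a$ and is mapped into $K_{a+1}\subset\mathrm{Int}(K_a)$, where $\chi>0$. Off the support
the quotient is locally zero. -/
theorem contDiffOn_edge_ratio {i j : Fin S.N} (h : S.adj i j = 1) :
    ContDiffOn ℝ ∞ (fun y => (D.χ y : ℂ) * (D.χ (S.φ i j y) : ℂ)⁻¹) (S.interval i) := by
  have hχ : ContDiff ℝ ∞ fun y => (D.χ y : ℂ) := Complex.ofRealCLM.contDiff.comp D.χ_smooth
  intro y hy
  by_cases ht : y ∈ tsupport D.χ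
  · refine hχ.contDiffAt.contDiffWithinAt.mul
      ((hχ.contDiffAt.comp_contDiffWithinAt y (S.smooth i j h y hy)).inv ?_)
    have := D.χ_pos_of_mem (Nat.lt_succ_self _)
      (S.mem_trap_succ.mpr ⟨i, j, h, y, ⟨hy, D.χ_supp ht⟩, rfl⟩)
    simpa using this.ne'
  · have h0 := notMem_tsupport_iff_eventuallyEq.mp ht
    refine (contDiffWithinAt_const (c := (0 : ℂ))).congr_of_eventuallyEq
      (nhdsWithin_le_nhds ?_) ?_
    · filter_upwards [h0] with z hz
      simp [hz]
    · simp [h0.eq_of_nhds]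

theorem exists_hbound_χ_comp (n : ℕ) : ∃ C : ℝ, 0 ≤ C ∧ ∀ w, S.Admissible w → ∀ k : ℕ,
    HBound 1 (S.interval (w 0)) n (fun _ => C) fun y => (D.χ (S.branch w k y) : ℂ) :=
  exists_hbound_comp_branch (S.exists_hbound_dbranch_const _) (F := fun _ _ y => (D.χ y : ℂ))
    fun _ _ _ => (Complex.ofRealCLM.contDiff.comp D.χ_smooth).contDiffOn

theorem exists_inv_χ_le : ∃ c : ℝ, 0 ≤ c ∧ ∀ x ∈ S.trap (D.a + 1), ‖(D.χ x : ℂ)⁻¹‖ ≤ c := by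
  have hcont : ContinuousOn (fun x => (D.χ x : ℂ)⁻¹) (S.trap (D.a + 1)) :=
    ContinuousOn.inv₀ (Complex.continuous_ofReal.comp D.χ_smooth.continuous).continuousOn
      fun x hx => by simpa using (D.χ_pos_of_mem (Nat.lt_succ_self _) hx).ne'
  obtain ⟨c, hc⟩ := (S.isCompact_trap _).exists_bound_of_continuousOn hcont
  exact ⟨max c 0, le_max_right _ _, fun x hx => (hc x hx).trans (le_max_left _ _)⟩

/-- For $n\le a$ the quotient is a product of boundedly many edge quotients. For $n>a$ the image
lies in the compact set $K_{a+1}$, on which $\chi^{-1}$ is bounded. This makes the constant uniform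
in `n`. -/
theorem exists_hbound_ratio (M : ℕ) : ∃ C : ℝ, 0 ≤ C ∧ ∀ w, S.Admissible w → ∀ n, 1 ≤ n →
    HBound 1 (S.interval (w 0)) M (fun _ => C) (D.ratio w n) := by
  obtain ⟨K, hK, hKb⟩ := exists_hbound_comp_branch (n := M) (S.exists_hbound_dbranch_const _)
    (F := fun i j y => (D.χ y : ℂ) * (D.χ (S.φ i j y) : ℂ)⁻¹)
    fun i j h => D.contDiffOn_edge_ratio h
  have small : ∀ n, ∃ C : ℝ, 0 ≤ C ∧ ∀ w, S.Admissible w → 1 ≤ n →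
      HBound 1 (S.interval (w 0)) M (fun _ => C) (D.ratio w n) := by
    intro n
    induction n with
    | zero => exact ⟨0, le_rfl, fun _ _ h => absurd h (by norm_num)⟩
    | succ n ih =>
      rcases Nat.eq_zero_or_pos n with rfl | hn
      · refine ⟨K, hK, fun w hw _ => (hKb w hw 0).congr fun y _ => ?_⟩
        simp [ratio, branch]
      · obtain ⟨C, hC, h⟩ := ih
        exact ⟨2 ^ M * K * C, by positivity, fun w hw _ =>
          (HBound.mul hK (h w hw hn) (hKb w hw n)).congr fun y hy => D.ratio_succ hw hn hy⟩
  choose C hC hCb using small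
  obtain ⟨B, hB, hBb⟩ := D.exists_hbound_χ_comp M
  obtain ⟨c, hc, hcb⟩ := D.exists_inv_χ_le
  obtain ⟨A, hA, hAb⟩ := HBound.of_inv M B c hc
  refine ⟨∑ n ∈ Finset.range (D.a + 1), C n + 2 ^ M * A * B,
    add_nonneg (Finset.sum_nonneg fun n _ => hC n) (by positivity), fun w hw n hn => ?_⟩
  by_cases hna : n < D.a + 1
  · refine (hCb n w hw hn).mono fun y _ => ?_
    have : C n ≤ ∑ n ∈ Finset.range (D.a + 1), C n :=
      Finset.single_le_sum (f := C) (fun n _ => hC n) (Finset.mem_range.mpr hna)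
    have : 0 ≤ 2 ^ M * A * B := by positivity
    linarith
  · have hmem : ∀ y ∈ S.interval (w 0), S.branch w n y ∈ S.trap (D.a + 1) := fun y hy =>
      S.trap_antitone (not_lt.mp hna) (branch_mem_trap hw n hy)
    have h1 := hAb 1 _ _ (hBb w hw n) (fun y hy => by
      simpa using (D.χ_pos_of_mem (Nat.lt_succ_self _) (hmem y hy)).ne')
      fun y hy => hcb _ (hmem y hy)
    refine (HBound.mul hA (hBb w hw 0) h1).mono fun y _ => ?_
    have : 0 ≤ ∑ n ∈ Finset.range (D.a + 1), C n := Finset.sum_nonneg fun n _ => hC n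
    linarith

end TransferData

end

noncomputable section

/-! ### Topological pressure -/

namespace IFS

variable {S : IFS}

/-- Bounded distortion. -/
theorem exists_distortion {g : ℝ → ℂ} (hg : S.EdgeSmooth g) : ∃ C : ℝ, 0 ≤ C ∧
    ∀ w, S.Admissible w → ∀ n, ∀ y ∈ S.interval (w 0),
      ‖∑ k ∈ Finset.range n, g (S.branch w (k + 1) y) - S.birkhoff g n w‖ ≤ C := by
  obtain ⟨C, hC, h⟩ := exists_hbound_orbitDiff hg 0
  have h1r : 0 < 1 - S.rate := by linarith [S.rate_lt_one]
  refine ⟨C * (1 - S.rate)⁻¹, by positivity, fun w hw n y hy => ?_⟩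
  rw [birkhoff_eq, ← Finset.sum_sub_distrib]
  calc _ ≤ ∑ k ∈ Finset.range n, C * S.rate ^ k :=
        norm_sum_le_of_le _ fun k _ => h w hw k y hy
    _ ≤ _ := by
        rw [← Finset.mul_sum]
        exact mul_le_mul_of_nonneg_left (S.sum_rate_pow_le n) hC

theorem birkhoff_ofReal (g : ℝ → ℝ) (n : ℕ) (w : ℤ → Fin S.N) :
    S.birkhoff (fun x => (g x : ℂ)) n w = ((S.birkhoff g n w : ℝ) : ℂ) := by
  simp [birkhoff]

/-- Two extensions of the same word share the maps up to time `n`. Their Birkhoff sums are taken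
along the same branches at two starting points, and bounded distortion compares each with the other.
-/
theorem exists_birkhoff_sub_le {g : ℝ → ℝ} (hg : S.EdgeSmooth fun x => (g x : ℂ)) :
    ∃ C : ℝ, 0 ≤ C ∧ ∀ w w', S.Admissible w → S.Admissible w' → ∀ n : ℕ,
      (∀ k : ℕ, k ≤ n → w k = w' k) → |S.birkhoff g n w - S.birkhoff g n w'| ≤ C := by
  obtain ⟨C, hC, h⟩ := exists_distortion hg
  refine ⟨C, hC, fun w w' hw hw' n hww => ?_⟩
  have h0 : w 0 = w' 0 := hww 0 (Nat.zero_le n)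
  have h1 := h w hw n (S.point w') (h0 ▸ point_mem hw')
  have h2 : ∑ k ∈ Finset.range n, (g (S.branch w (k + 1) (S.point w')) : ℂ) =
      ((S.birkhoff g n w' : ℝ) : ℂ) := by
    rw [birkhoff_eq]
    push_cast
    refine Finset.sum_congr rfl fun k hk => ?_
    rw [branch_congr fun l hl => hww l (hl.trans (Finset.mem_range.mp hk))]
  rw [h2, birkhoff_ofReal, ← Complex.ofReal_sub, Complex.norm_real, Real.norm_eq_abs] at h1
  rwa [abs_sub_comm]

theorem birkhoff_add {E : Type*} [AddCommMonoid E] (g : ℝ → E) {w : ℤ → Fin S.N}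
    (hw : S.Admissible w) (n k : ℕ) :
    S.birkhoff g (n + k) w = S.birkhoff g n w + S.birkhoff g k (shift w n) := by
  simp only [birkhoff_eq, Finset.sum_range_add]
  congr 1
  refine Finset.sum_congr rfl fun l _ => ?_
  rw [add_assoc, branch_add, branch_point hw]

theorem adj_of_pos {i j : Fin S.N} (h : S.adj i j ≠ 0) : S.adj i j = 1 :=
  (S.adj_mem i j).resolve_left h

/-- If $T\ge1$, a positive entry of $A^T=A\,A^{T-1}$ forces a non-zero entry in the row. If $T=0$,
positivity of the identity matrix forces $N=1$, and the assumed edge is then a loop. -/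
theorem exists_successor (hne : ∃ i j, S.adj i j = 1) (i : Fin S.N) : ∃ j, S.adj i j = 1 := by
  obtain ⟨T, hT⟩ := S.transitive
  cases T with
  | zero =>
    obtain ⟨k, l, h⟩ := hne
    have e : ∀ a b : Fin S.N, a = b := fun a b => by
      by_contra hab
      simpa [Matrix.one_apply, hab] using hT a b
    exact ⟨l, e k i ▸ h⟩
  | succ T =>
    have := hT i i
    rw [pow_succ', Matrix.mul_apply] at this
    obtain ⟨j, -, hj⟩ := Finset.exists_ne_zero_of_sum_ne_zero this.ne'
    exact ⟨j, adj_of_pos (left_ne_zero_of_mul hj)⟩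

theorem exists_predecessor (hne : ∃ i j, S.adj i j = 1) (j : Fin S.N) : ∃ i, S.adj i j = 1 := by
  obtain ⟨T, hT⟩ := S.transitive
  cases T with
  | zero =>
    obtain ⟨k, l, h⟩ := hne
    have e : ∀ a b : Fin S.N, a = b := fun a b => by
      by_contra hab
      simpa [Matrix.one_apply, hab] using hT a b
    exact ⟨k, e l j ▸ h⟩
  | succ T =>
    have := hT j j
    rw [pow_succ, Matrix.mul_apply] at this
    obtain ⟨i, -, hi⟩ := Finset.exists_ne_zero_of_sum_ne_zero this.ne'
    exact ⟨i, adj_of_pos (right_ne_zero_of_mul hi)⟩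

theorem exists_extends (hne : ∃ i j, S.adj i j = 1) {n : ℕ} (v : S.Word n) :
    ∃ w, S.Extends w v := by
  choose σ hσ using exists_successor hne
  choose π hπ using exists_predecessor hne
  set f : ℕ → Fin S.N := fun k => if h : k < n + 1 then v.1 ⟨k, h⟩ else
    σ^[k - n] (v.1 (Fin.last n)) with hf
  have hfs : ∀ k, S.adj (f k) (f (k + 1)) = 1 := by
    intro k
    by_cases h1 : k + 1 < n + 1
    · have h2 : k < n + 1 := by omega
      simp only [hf, h1, h2, dif_pos]
      exact v.2 ⟨k, by omega⟩
    · by_cases h2 : k < n + 1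
      · obtain rfl : k = n := by omega
        simp only [hf, h1, h2, dif_pos, dif_neg, not_false_iff]
        rw [Nat.add_sub_cancel_left, Function.iterate_one]
        exact hσ _
      · simp only [hf, h1, h2, dif_neg, not_false_iff]
        rw [show k + 1 - n = (k - n) + 1 by omega, Function.iterate_succ_apply']
        exact hσ _
  refine ⟨fun l => match l with
    | Int.ofNat k => f k
    | Int.negSucc k => π^[k + 1] (v.1 0), ?_, ?_⟩
  · intro l
    match l with
    | Int.ofNat k => exact hfs k
    | Int.negSucc 0 =>
      have : f 0 = v.1 0 := by simp [hf]
      change S.adj (π (v.1 0)) (f 0) = 1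
      rw [this]
      exact hπ _
    | Int.negSucc (k + 1) =>
      change S.adj (π^[k + 1 + 1] (v.1 0)) (π^[k + 1] (v.1 0)) = 1
      rw [Function.iterate_succ_apply']
      exact hπ _
  · intro k
    change f k = _
    simp only [hf, k.2, dif_pos]

/-- The first letters of a word. -/
def firstLetters {w : ℤ → Fin S.N} (hw : S.Admissible w) (n : ℕ) : S.Word n :=
  ⟨fun k => w (k : ℕ), fun k => by simpa using hw k⟩

theorem extends_firstLetters {w : ℤ → Fin S.N} (hw : S.Admissible w) (n : ℕ) :
    S.Extends w (firstLetters hw n) := ⟨hw, fun _ => rfl⟩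

theorem Extends.eq {n : ℕ} {v : S.Word n} {w w' : ℤ → Fin S.N} (h : S.Extends w v)
    (h' : S.Extends w' v) (k : ℕ) (hk : k ≤ n) : w k = w' k :=
  (h.2 ⟨k, by omega⟩).trans (h'.2 ⟨k, by omega⟩).symm

/-- The partition function. -/
def partitionSum (g : ℝ → ℝ) (n : ℕ) (ext : S.Word n → ℤ → Fin S.N) : ℝ :=
  ∑ v : S.Word n, Real.exp (S.birkhoff g n (ext v))

/-- Bounded distortion gives comparability of the partition sums for different extensions up to
$e^C$, and submultiplicativity up to $e^{2C}$. Fekete's lemma applies to the corrected logarithms. A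
single orbit gives the lower bound that keeps the limit finite. -/
theorem exists_pressure {g : ℝ → ℝ} (hg : S.EdgeSmooth fun x => (g x : ℂ)) :
    ∃ P : ℝ, S.IsPressure g P ∧ ∃ R : ℕ → ℝ, Tendsto R atTop (𝓝 0) ∧ ∀ n : ℕ, 1 ≤ n →
      ∀ ext : S.Word n → ℤ → Fin S.N, (∀ v, S.Extends (ext v) v) →
      partitionSum g n ext ≤ Real.exp (n * (P + R n)) := by
  by_cases hne : ∃ i j, S.adj i j = 1
  swap
  · have no : ∀ w, ¬ S.Admissible w := fun w hw => hne ⟨_, _, hw 0⟩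
    refine ⟨0, fun ext hext => ?_, 0, tendsto_const_nhds, fun n hn ext hext => ?_⟩
    · exact absurd (hext 0 ⟨fun _ => ⟨0, S.N_pos⟩, fun k => k.elim0⟩).1 (no _)
    · have : IsEmpty (S.Word n) := ⟨fun v => hne ⟨_, _, v.2 ⟨0, hn⟩⟩⟩
      simp [partitionSum]
  obtain ⟨C, hC, hCd⟩ := exists_birkhoff_sub_le hg
  choose e he using fun (n : ℕ) (v : S.Word n) => exists_extends hne v
  set Z : ℕ → ℝ := fun n => partitionSum g n (e n) with hZ
  obtain ⟨w₀, hw₀⟩ := exists_extends hne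
    (⟨fun _ => ⟨0, S.N_pos⟩, fun k => k.elim0⟩ : S.Word 0)
  have hZpos : ∀ n (ext : S.Word n → ℤ → Fin S.N), 0 < partitionSum g n ext := fun n ext =>
    Finset.sum_pos (fun _ _ => Real.exp_pos _) ⟨firstLetters hw₀.1 n, Finset.mem_univ _⟩
  have compare : ∀ n (ext ext' : S.Word n → ℤ → Fin S.N), (∀ v, S.Extends (ext v) v) →
      (∀ v, S.Extends (ext' v) v) →
      partitionSum g n ext ≤ Real.exp C * partitionSum g n ext' := by
    intro n ext ext' h h'
    rw [partitionSum, partitionSum, Finset.mul_sum]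
    refine Finset.sum_le_sum fun v _ => ?_
    rw [← Real.exp_add, Real.exp_le_exp]
    have := (abs_le.mp (hCd _ _ (h v).1 (h' v).1 n ((h v).eq (h' v)))).2
    linarith
  have submul : ∀ n k, Z (n + k) ≤ Real.exp (2 * C) * (Z n * Z k) := by
    intro n k
    -- A word is cut at the letter $w_n$, which belongs to both pieces. The map is injective but in
    -- general not onto, which is enough for an upper bound.
    set ι : S.Word (n + k) → S.Word n × S.Word k := fun v =>
      (firstLetters (he _ v).1 n, firstLetters ((he _ v).1.shift n) k) with hι
    have inj : Function.Injective ι := by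
      intro v v' h
      obtain ⟨h1, h2⟩ := Prod.mk.inj h
      refine Subtype.ext (funext fun l => ?_)
      rw [← (he _ v).2 l, ← (he _ v').2 l]
      by_cases hl : (l : ℕ) < n + 1
      · exact congrFun (congrArg Subtype.val h1) ⟨l, hl⟩
      · have := congrFun (congrArg Subtype.val h2) ⟨l - n, by omega⟩
        simp only [firstLetters, shift_apply] at this
        have e1 : (((l : ℕ) - n : ℕ) : ℤ) + n = (l : ℕ) := by
          rw [Nat.cast_sub (by omega)]; ring
        rwa [e1] at this
    calc Z (n + k) ≤ ∑ v : S.Word (n + k), (fun p : S.Word n × S.Word k => Real.exp (2 * C) *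
          (Real.exp (S.birkhoff g n (e n p.1)) * Real.exp (S.birkhoff g k (e k p.2)))) (ι v) := by
          refine Finset.sum_le_sum fun v _ => ?_
          simp only
          rw [← Real.exp_add, ← Real.exp_add, Real.exp_le_exp, birkhoff_add g (he _ v).1]
          have h1 := (abs_le.mp (hCd _ _ (he _ v).1 (he n (ι v).1).1 n
            ((extends_firstLetters (he _ v).1 n).eq (he n (ι v).1)))).2
          have h2 := (abs_le.mp (hCd _ _ ((he _ v).1.shift n) (he k (ι v).2).1 k
            ((extends_firstLetters ((he _ v).1.shift n) k).eq (he k (ι v).2)))).2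
          linarith
      _ ≤ ∑ p : S.Word n × S.Word k, Real.exp (2 * C) *
          (Real.exp (S.birkhoff g n (e n p.1)) * Real.exp (S.birkhoff g k (e k p.2))) := by
          rw [← Finset.sum_image (s := Finset.univ) (g := ι)
            (f := fun p : S.Word n × S.Word k => Real.exp (2 * C) *
              (Real.exp (S.birkhoff g n (e n p.1)) * Real.exp (S.birkhoff g k (e k p.2))))
            fun _ _ _ _ h => inj h]
          exact Finset.sum_le_sum_of_subset_of_nonneg (Finset.subset_univ _)
            fun _ _ _ => by positivity
      _ = _ := by
          rw [← Finset.mul_sum, Fintype.sum_prod_type, hZ]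
          simp only [partitionSum, Finset.sum_mul_sum]
  -- Adding $2C$ absorbs the multiplicative constant and makes the sequence exactly subadditive.
  set u : ℕ → ℝ := fun n => Real.log (Z n) + 2 * C with hu
  have hsub : Subadditive u := fun n k => by
    have h1 := Real.log_le_log (hZpos _ _) (submul n k)
    rw [Real.log_mul (Real.exp_pos _).ne' (mul_pos (hZpos _ _) (hZpos _ _)).ne', Real.log_exp,
      Real.log_mul (hZpos _ _).ne' (hZpos _ _).ne'] at h1
    simp only [hu]
    linarith
  obtain ⟨B, hB, hBb⟩ := exists_hbound_comp_branch (n := 0) (S.exists_hbound_dbranch_const _)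
    (F := fun i j y => (g (S.φ i j y) : ℂ)) hg
  have hgB : ∀ n, -(n * B) ≤ S.birkhoff g n w₀ := fun n => by
    rw [birkhoff_eq, ← mul_neg, ← nsmul_eq_mul]
    refine le_trans (le_of_eq (by simp)) (Finset.card_nsmul_le_sum (Finset.range n) _ (-B)
      fun k _ => ?_)
    have := hBb w₀ hw₀.1 k _ (point_mem hw₀.1)
    rw [Complex.norm_real, Real.norm_eq_abs] at this
    exact (abs_le.mp this).1
  have hbdd : BddBelow (range fun n => u n / n) := by
    refine ⟨-B - C, ?_⟩
    rintro _ ⟨n, rfl⟩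
    simp only
    rcases Nat.eq_zero_or_pos n with rfl | hn
    · simp; linarith
    · have hn' : (0 : ℝ) < n := by exact_mod_cast hn
      rw [le_div_iff₀ hn']
      have hw₁ := he n (firstLetters hw₀.1 n)
      have h1 : Real.exp (S.birkhoff g n (e n (firstLetters hw₀.1 n))) ≤ Z n :=
        Finset.single_le_sum (f := fun v => Real.exp (S.birkhoff g n (e n v)))
          (fun v _ => (Real.exp_pos _).le) (Finset.mem_univ _)
      have h2 := (Real.le_log_iff_exp_le (hZpos n (e n))).mpr h1
      have h3 := (abs_le.mp (hCd _ _ hw₀.1 hw₁.1 n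
        ((extends_firstLetters hw₀.1 n).eq hw₁))).2
      have h4 := hgB n
      have h5 : 0 ≤ C * n := by positivity
      have h6 : u n = Real.log (partitionSum g n (e n)) + 2 * C := rfl
      linarith
  have hlim := hsub.tendsto_lim hbdd
  have hzero : ∀ c : ℝ, Tendsto (fun n : ℕ => c / n) atTop (𝓝 0) := fun c =>
    tendsto_const_div_atTop_nhds_zero_nat c
  -- The error is chosen so that $e^{n(P+R(n))}=e^CZ_n$ for $n\ge1$. It depends on one fixed choice
  -- of extensions, the factor $e^C$ paying for all others.
  refine ⟨hsub.lim, fun ext hext => ?_, fun n => (Real.log (Z n) + C) / n - hsub.lim, ?_, ?_⟩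
  · have h1 : ∀ n : ℕ, |Real.log (partitionSum g n (ext n)) - Real.log (Z n)| ≤ C := fun n => by
      have a1 := Real.log_le_log (hZpos _ _) (compare n _ _ (hext n) (he n))
      have a2 := Real.log_le_log (hZpos _ _) (compare n _ _ (he n) (hext n))
      rw [Real.log_mul (Real.exp_pos _).ne' (hZpos _ _).ne', Real.log_exp] at a1 a2
      rw [abs_le]
      constructor <;> simp only [hZ] <;> linarith
    have h2 : Tendsto (fun n : ℕ => (n : ℝ)⁻¹ * Real.log (partitionSum g n (ext n)) - u n / n)
        atTop (𝓝 0) := by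
      refine squeeze_zero_norm (fun n => ?_) (hzero (3 * C))
      have : (n : ℝ)⁻¹ * Real.log (partitionSum g n (ext n)) - u n / n =
          (Real.log (partitionSum g n (ext n)) - Real.log (Z n) - 2 * C) / n := by
        simp only [hu]; ring
      rw [this, norm_div, Real.norm_natCast]
      gcongr
      have := abs_le.mp (h1 n)
      rw [Real.norm_eq_abs, abs_le]
      constructor <;> linarith
    simpa [partitionSum] using h2.add hlim
  · have : Tendsto (fun n : ℕ => u n / n + (-C) / n - hsub.lim) atTop (𝓝 (hsub.lim + 0 - hsub.lim)) :=
      (hlim.add (hzero (-C))).sub_const _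
    rw [add_zero, sub_self] at this
    refine this.congr fun n => ?_
    simp only [hu]
    ring
  · intro n hn ext hext
    have hn' : (n : ℝ) ≠ 0 := by positivity
    have : (n : ℝ) * (hsub.lim + ((Real.log (Z n) + C) / n - hsub.lim)) = C + Real.log (Z n) := by
      field_simp
      ring
    rw [this, Real.exp_add, Real.exp_log (hZpos _ _)]
    exact compare n _ _ hext (he n)

end IFS

end

/-! ### Oscillating exponentials, cocycles and the linearizing coordinate. -/

noncomputable section

namespace HBound

variable {ħ : ℝ} {I J : Set ℝ} {n : ℕ}

/-- Composition with a change of variables. -/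
theorem comp_const (hħ : 0 < ħ) {A B r : ℝ} (hB : 0 ≤ B) (hr : 0 ≤ r) (hr1 : r ≤ 1)
    (hJ : UniqueDiffOn ℝ J)
    {φ q : ℝ → ℝ} (hφ : MapsTo φ I J) (hd : ∀ y ∈ I, HasDerivWithinAt φ (r * q y) I y)
    {F : ℝ → ℂ} (hF : HBound ħ J n (fun _ => A) F)
    (hq : HBound ħ I (n - 1) (fun _ => B) fun y => (q y : ℂ)) :
    HBound ħ I n (fun _ => (1 + 2 ^ n * B) ^ n * ((n + 1) * A)) fun y => F (φ y) := by
  refine (HBound.comp hħ.le hr hB hφ hd (F := fun i => iteratedDerivWithin i F J)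
    (fun i hi z hz => hF.hasDerivWithinAt_iteratedDerivWithin hJ hħ.ne' hi z hz)
    hq).congr (fun y _ => by simp [iteratedDerivWithin_zero]) |>.mono fun y hy => ?_
  refine mul_le_mul_of_nonneg_left ?_ (by positivity)
  have h1 : ∀ i ∈ Finset.range (n + 1),
      (r * ħ) ^ i * ‖iteratedDerivWithin i F J (φ y)‖ ≤ A := fun i hi => by
    have := hF.iteratedDerivWithin_le hJ (i := i) (by simpa [Nat.lt_succ_iff] using hi) _ (hφ hy)
    rw [abs_of_pos hħ] at this
    refine le_trans (mul_le_mul_of_nonneg_right ?_ (norm_nonneg _)) this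
    exact pow_le_pow_left₀ (by positivity) (mul_le_of_le_one_left hħ.le hr1) i
  refine (Finset.sum_le_card_nsmul _ _ _ h1).trans_eq ?_
  simp

/-- Oscillating exponentials. -/
theorem exists_exp (n : ℕ) (A B ħ₀ : ℝ) (hA : 0 ≤ A) (hB : 0 ≤ B) (hħ₀ : 0 < ħ₀) :
    ∃ K : ℝ, 0 ≤ K ∧ ∀ ħ : ℝ, 0 < ħ → ħ ≤ ħ₀ → ∀ (I : Set ℝ) (a b : ℝ → ℂ),
      HBound 1 I (n + 1) (fun _ => A) a → (∀ y ∈ I, (a y).im = 0) →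
      HBound 1 I (n + 1) (fun _ => B) b →
      HBound ħ I (n + 1) (fun _ => K)
        fun y => Complex.exp (Complex.I / ħ * a y + b y) := by
  -- The function $u=e^{ia/\hbar+b}$ solves $\hbar u'=(ia'+\hbar b')u$, whose coefficient is bounded
  -- uniformly in $\hbar\le\hbar_0$. The reality of $a$ gives $|u|\le e^B$.
  obtain ⟨K, hK, h⟩ := of_ode n (max ħ₀ 1 ^ n * A + ħ₀ * (max ħ₀ 1 ^ n * B)) (Real.exp B)
    (by positivity) (Real.exp_pos _).le
  refine ⟨K, hK, fun ħ hħ hħ0 I a b ha him hb => ?_⟩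
  obtain ⟨-, a', ha', ha1⟩ := ha
  obtain ⟨hb0, b', hb', hb1⟩ := hb
  have hne : (ħ : ℂ) ≠ 0 := by exact_mod_cast hħ.ne'
  refine h ħ I _ (fun y => Complex.exp (Complex.I / ħ * a y + b y) *
    (Complex.I / ħ * a' y + b' y)) (fun y => Complex.I * a' y + ħ * b' y) (fun y hy => ?_)
    (fun y hy => ?_) ?_ fun y hy => ?_
  · exact (((ha' y hy).const_mul _).add (hb' y hy)).cexp
  · field_simp
  · have h1 := (rescale hħ.le (hħ0.trans (le_max_left ħ₀ 1)) (le_max_right _ _) hA ha1).const_mul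
      Complex.I
    have h2 := (rescale hħ.le (hħ0.trans (le_max_left ħ₀ 1)) (le_max_right _ _) hB hb1).const_mul
      (ħ : ℂ)
    refine ((h1.add h2).congr fun y _ => by simp).mono fun y _ => ?_
    rw [Complex.norm_I, one_mul, Complex.norm_real, Real.norm_eq_abs, abs_of_pos hħ]
    gcongr
  · rw [Complex.norm_exp, Real.exp_le_exp]
    have h0 : (Complex.I / ħ * a y).re = 0 := by
      have : a y = ((a y).re : ℂ) := Complex.ext rfl (by simp [him y hy])
      rw [this]
      have : Complex.I / ħ * ((a y).re : ℂ) = (((a y).re / ħ : ℝ) : ℂ) * Complex.I := by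
        push_cast; field_simp
      rw [this]
      simp
    rw [Complex.add_re, h0, zero_add]
    exact (Complex.re_le_norm _).trans (hb0 y hy)

end HBound

namespace IFS

variable {S : IFS}

/-- The sum of the differences of `g` along two orbits asymptotic in the future. -/
def cocycle (S : IFS) (g : ℝ → ℂ) (w : ℤ → Fin S.N) (y : ℝ) : ℂ := -∑' k, S.orbitDiff g w k y

theorem exists_hbound_cocycle {g : ℝ → ℂ} (hg : S.EdgeSmooth g) (n : ℕ) :
    ∃ C : ℝ, 0 ≤ C ∧ ∀ w, S.Admissible w →
      HBound 1 (S.interval (w 0)) n (fun _ => C) (S.cocycle g w) := by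
  obtain ⟨C, hC, h⟩ := exists_hbound_orbitDiff hg n
  have hs : Summable fun k => C * S.rate ^ k :=
    (summable_geometric_of_lt_one S.rate_pos.le S.rate_lt_one).mul_left C
  exact ⟨∑' k, C * S.rate ^ k, tsum_nonneg fun k => mul_nonneg hC (pow_nonneg S.rate_pos.le k),
    fun w hw => (HBound.tsum (S.convex_interval _) hs (h w hw)).neg⟩

theorem exists_hbound_sum_orbitDiff {g : ℝ → ℂ} (hg : S.EdgeSmooth g) (n : ℕ) :
    ∃ C : ℝ, 0 ≤ C ∧ ∀ w, S.Admissible w → ∀ k,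
      HBound 1 (S.interval (w 0)) n (fun _ => C)
        fun y => ∑ l ∈ Finset.range k, S.orbitDiff g w l y := by
  obtain ⟨C, hC, h⟩ := exists_hbound_orbitDiff hg n
  have h1r : 0 < 1 - S.rate := by linarith [S.rate_lt_one]
  refine ⟨C * (1 - S.rate)⁻¹, by positivity, fun w hw k =>
    (HBound.sum _ fun l _ => h w hw l).mono fun y _ => ?_⟩
  rw [← Finset.mul_sum]
  exact mul_le_mul_of_nonneg_left (S.sum_rate_pow_le k) hC

section admissible

variable {w : ℤ → Fin S.N} (hw : S.Admissible w) {y : ℝ} (hy : y ∈ S.interval (w 0))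

@[simp] theorem cocycle_point (g : ℝ → ℂ) : S.cocycle g w (S.point w) = 0 := by
  simp [cocycle, orbitDiff]

include hw

theorem orbitDiff_shift (g : ℝ → ℂ) (n k : ℕ) (y : ℝ) :
    S.orbitDiff g (shift w n) k (S.branch w n y) = S.orbitDiff g w (n + k) y := by
  rw [orbitDiff, orbitDiff, ← branch_point hw, ← branch_add, ← branch_add, add_assoc]

include hy

theorem summable_orbitDiff {g : ℝ → ℂ} (hg : S.EdgeSmooth g) :
    Summable fun k => S.orbitDiff g w k y := by
  obtain ⟨C, hC, h⟩ := exists_hbound_orbitDiff hg 0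
  exact Summable.of_norm_bounded
    ((summable_geometric_of_lt_one S.rate_pos.le S.rate_lt_one).mul_left C)
    fun k => h w hw k y hy

/-- Removing the first `n` terms of the series is the same as moving the base point along the orbit.
Thus a Birkhoff sum along an orbit is its value at $x_w$ plus a coboundary, and conjugation removes
the latter. -/
theorem cocycle_branch {g : ℝ → ℂ} (hg : S.EdgeSmooth g) (n : ℕ) :
    S.cocycle g (shift w n) (S.branch w n y) =
      S.cocycle g w y + ∑ k ∈ Finset.range n, S.orbitDiff g w k y := by
  rw [cocycle, cocycle, ← (summable_orbitDiff hw hy hg).sum_add_tsum_nat_add n]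
  simp only [orbitDiff_shift hw, add_comm n]
  ring

end admissible

/-- The derivative of the linearizing coordinate. -/
def hderiv (S : IFS) (w : ℤ → Fin S.N) (y : ℝ) : ℝ :=
  Real.exp (S.cocycle (fun x => (S.J x : ℂ)) w y).re

theorem hderiv_pos (w : ℤ → Fin S.N) (y : ℝ) : 0 < S.hderiv w y := Real.exp_pos _

theorem cocycle_ofReal_im {g : ℝ → ℝ} (w : ℤ → Fin S.N) (y : ℝ) :
    (S.cocycle (fun x => (g x : ℂ)) w y).im = 0 := by
  have : S.cocycle (fun x => (g x : ℂ)) w y =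
      ((-∑' k, (g (S.branch w (k + 1) y) - g (S.branch w (k + 1) (S.point w))) : ℝ) : ℂ) := by
    rw [cocycle]
    push_cast
    simp only [orbitDiff]
  rw [this, Complex.ofReal_im]

theorem ofReal_hderiv (w : ℤ → Fin S.N) (y : ℝ) :
    (S.hderiv w y : ℂ) = Complex.exp (S.cocycle (fun x => (S.J x : ℂ)) w y) := by
  rw [hderiv, Complex.ofReal_exp]
  congr 1
  exact Complex.ext rfl (by simp [cocycle_ofReal_im])

theorem exists_hbound_hderiv (S : IFS) (n : ℕ) : ∃ C : ℝ, 0 ≤ C ∧ ∀ w, S.Admissible w →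
    HBound 1 (S.interval (w 0)) n (fun _ => C) (fun y => (S.hderiv w y : ℂ)) ∧
    HBound 1 (S.interval (w 0)) n (fun _ => C) (fun y => ((S.hderiv w y)⁻¹ : ℂ)) := by
  obtain ⟨B, hB, h⟩ := exists_hbound_cocycle (S := S) edgeSmooth_J (n + 1)
  obtain ⟨K, hK, hexp⟩ := HBound.exists_exp n 0 B 1 le_rfl hB one_pos
  have h0 : ∀ I, HBound 1 I (n + 1) (fun _ => 0) (fun _ => (0 : ℂ)) := fun I =>
    (HBound.const 0).mono fun y _ => by simp
  refine ⟨K, hK, fun w hw => ⟨?_, ?_⟩⟩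
  · exact ((hexp 1 one_pos le_rfl _ _ _ (h0 _) (fun _ _ => rfl) (h w hw)).of_succ).congr
      fun y _ => by simp [ofReal_hderiv]
  · exact ((hexp 1 one_pos le_rfl _ _ _ (h0 _) (fun _ _ => rfl) (h w hw).neg).of_succ).congr
      fun y _ => by simp [ofReal_hderiv, Complex.exp_neg]

theorem continuousOn_hderiv {w : ℤ → Fin S.N} (hw : S.Admissible w) :
    ContinuousOn (S.hderiv w) (S.interval (w 0)) := by
  obtain ⟨C, -, h⟩ := S.exists_hbound_hderiv 1
  exact (Complex.continuous_re.comp_continuousOn (h w hw).1.continuousOn).congr fun y _ => by simp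

/-- The linearizing coordinate, `H_w⁻¹(y - x_w)`. -/
def hcoord (S : IFS) (w : ℤ → Fin S.N) (y : ℝ) : ℝ :=
  ∫ t in (S.point w)..y, IccExtend (S.lo_lt_hi (w 0)).le
    (fun t : Icc (S.lo (w 0)) (S.hi (w 0)) => S.hderiv w t) t

@[simp] theorem hcoord_point (w : ℤ → Fin S.N) : S.hcoord w (S.point w) = 0 := by
  simp [hcoord]

theorem hasDerivWithinAt_hcoord {w : ℤ → Fin S.N} (hw : S.Admissible w) {y : ℝ}
    (hy : y ∈ S.interval (w 0)) :
    HasDerivWithinAt (S.hcoord w) (S.hderiv w y) (S.interval (w 0)) y := by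
  have hc : Continuous (IccExtend (S.lo_lt_hi (w 0)).le
      (fun t : Icc (S.lo (w 0)) (S.hi (w 0)) => S.hderiv w t)) :=
    (continuousOn_iff_continuous_domRestrict.mp (continuousOn_hderiv hw)).Icc_extend'
  have := (intervalIntegral.integral_hasDerivAt_right (hc.intervalIntegrable (S.point w) y)
    hc.stronglyMeasurable.stronglyMeasurableAtFilter hc.continuousAt).hasDerivWithinAt
      (s := S.interval (w 0))
  rwa [IccExtend_of_mem _ _ hy] at this

theorem exists_abs_hcoord_le (S : IFS) : ∃ C : ℝ, 0 ≤ C ∧ ∀ w, S.Admissible w →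
    ∀ y ∈ S.interval (w 0), |S.hcoord w y| ≤ C := by
  obtain ⟨C, hC, h⟩ := S.exists_hbound_hderiv 0
  obtain ⟨ℓ, hℓ, hlen⟩ := S.exists_length_le
  refine ⟨C * ℓ, by positivity, fun w hw y hy => ?_⟩
  have := (S.convex_interval (w 0)).norm_image_sub_le_of_norm_hasDerivWithin_le
    (fun x hx => hasDerivWithinAt_hcoord hw hx) (C := C)
    (fun x hx => by simpa using (h w hw).1.norm_le x hx) (point_mem hw) hy
  rw [hcoord_point, sub_zero] at this
  exact this.trans (mul_le_mul_of_nonneg_left (hlen _ _ hy _ (point_mem hw)) hC)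

/-- The cocycle identity for $J$: the finite sum of differences is minus the logarithm of `S.dbranch
w n y`, up to the Birkhoff sum at $x_w$. -/
theorem hderiv_branch {w : ℤ → Fin S.N} (hw : S.Admissible w) {y : ℝ}
    (hy : y ∈ S.interval (w 0)) (n : ℕ) :
    S.hderiv w y = Real.exp (S.birkhoff S.J n w) * S.dbranch w n y *
      S.hderiv (shift w n) (S.branch w n y) := by
  have h1 : ∑ k ∈ Finset.range n, S.orbitDiff (fun x => (S.J x : ℂ)) w k y =
      ((-Real.log (S.dbranch w n y) - S.birkhoff S.J n w : ℝ) : ℂ) := by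
    rw [← sum_J_eq hw n hy, birkhoff_eq, ← Finset.sum_sub_distrib]
    push_cast
    rfl
  rw [hderiv, hderiv, cocycle_branch hw hy edgeSmooth_J, h1, Complex.add_re, Complex.ofReal_re]
  have h2 := Real.exp_log (dbranch_pos hw n hy)
  nth_rewrite 1 [← h2]
  rw [← Real.exp_add, ← Real.exp_add]
  congr 1
  ring

/-- By `hderiv_branch` the derivatives of the rescaled branches differ from `S.hderiv w` by a factor
evaluated near $x_{L^nw}$, where it equals $1$. They converge uniformly at the rate `S.rate ^ n`,
and the mean value inequality from $x_w$ transfers this to the functions. This identifies the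
integral defining `S.hcoord` with the limit defining $H_w^{-1}$. -/
theorem tendsto_hcoord {w : ℤ → Fin S.N} (hw : S.Admissible w) {y : ℝ}
    (hy : y ∈ S.interval (w 0)) :
    Tendsto (fun n : ℕ => Real.exp (S.birkhoff S.J n w) *
      (S.branch w n y - S.branch w n (S.point w))) atTop (𝓝 (S.hcoord w y)) := by
  obtain ⟨C, hC, h⟩ := S.exists_hbound_hderiv 1
  obtain ⟨ℓ, hℓ, hlen⟩ := S.exists_length_le
  have hr := S.rate_pos
  have key : ∀ n : ℕ, ∀ x ∈ S.interval (w 0),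
      ‖Real.exp (S.birkhoff S.J n w) * S.dbranch w n x - S.hderiv w x‖ ≤
        C * (C * (C * (S.rate ^ n * ℓ))) := fun n x hx => by
    have hw' := hw.shift n
    have hmem : S.branch w n x ∈ S.interval (shift w n 0) := by
      simpa using mapsTo_branch hw n hx
    obtain ⟨h0, g, hg, hg1⟩ := (h _ hw').1
    have lip := (S.convex_interval _).norm_image_sub_le_of_norm_hasDerivWithin_le hg (C := C)
      (fun z hz => by simpa using hg1 z hz) (point_mem hw') hmem
    have h1 : (S.hderiv (shift w n) (S.point (shift w n)) : ℂ) = 1 := by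
      rw [ofReal_hderiv, cocycle_point, Complex.exp_zero]
    have lip' : |1 - S.hderiv (shift w n) (S.branch w n x)| ≤ C * (S.rate ^ n * ℓ) := by
      rw [h1, ← Complex.ofReal_one, ← Complex.ofReal_sub, Complex.norm_real, norm_sub_rev,
        Real.norm_eq_abs, Real.norm_eq_abs] at lip
      refine lip.trans (mul_le_mul_of_nonneg_left ?_ hC)
      rw [← branch_point hw]
      exact (dist_branch_le hw n hx (point_mem hw)).trans
        (mul_le_mul_of_nonneg_left (hlen _ _ hx _ (point_mem hw)) (by positivity))
    have hb := hderiv_branch hw hx n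
    set u := Real.exp (S.birkhoff S.J n w) * S.dbranch w n x with hu
    set v := S.hderiv (shift w n) (S.branch w n x) with hv
    have hv0 : 0 < v := hderiv_pos _ _
    have hu0 : 0 < u := mul_pos (Real.exp_pos _) (dbranch_pos hw n hx)
    have hv1 : v⁻¹ ≤ C := by
      have := (h _ hw').2.norm_le _ hmem
      rw [← Complex.ofReal_inv, Complex.norm_real, Real.norm_eq_abs] at this
      exact (le_abs_self _).trans this
    have hu1 : u ≤ C * C := by
      have h2 : S.hderiv w x ≤ C := by
        have := (h w hw).1.norm_le _ hx
        rw [Complex.norm_real, Real.norm_eq_abs] at this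
        exact (le_abs_self _).trans this
      have : u = S.hderiv w x * v⁻¹ := by rw [hb]; field_simp
      rw [this]
      exact mul_le_mul h2 hv1 (by positivity) hC
    rw [hb, show u - u * v = u * (1 - v) by ring, norm_mul, Real.norm_eq_abs, Real.norm_eq_abs,
      abs_of_pos hu0]
    calc u * |1 - v| ≤ C * C * (C * (S.rate ^ n * ℓ)) :=
          mul_le_mul hu1 lip' (abs_nonneg _) (by positivity)
      _ = _ := by ring
  rw [tendsto_iff_norm_sub_tendsto_zero]
  refine squeeze_zero (fun _ => norm_nonneg _) (g := fun n => C * (C * (C * (S.rate ^ n * ℓ))) * ℓ)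
    (fun n => ?_) ?_
  · have hd : ∀ x ∈ S.interval (w 0), HasDerivWithinAt
        (fun y => Real.exp (S.birkhoff S.J n w) * (S.branch w n y - S.branch w n (S.point w)) -
          S.hcoord w y) (Real.exp (S.birkhoff S.J n w) * S.dbranch w n x - S.hderiv w x)
        (S.interval (w 0)) x := fun x hx =>
      (((hasDerivWithinAt_branch hw n hx).sub_const _).const_mul _).sub
        (hasDerivWithinAt_hcoord hw hx)
    have := (S.convex_interval _).norm_image_sub_le_of_norm_hasDerivWithin_le hd (key n)
      (point_mem hw) hy
    simp only [sub_self, mul_zero, hcoord_point, sub_zero] at this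
    exact this.trans (mul_le_mul_of_nonneg_left (hlen _ _ hy _ (point_mem hw)) (by positivity))
  · have := (tendsto_pow_atTop_nhds_zero_of_lt_one S.rate_pos.le S.rate_lt_one)
    have := ((((this.mul_const ℓ).const_mul C).const_mul C).const_mul C).mul_const ℓ
    simpa using this

/-- Exact linearization: both sides are limits along the same orbit, one of them started `n` steps
later. The Birkhoff sum of $J$ over these steps is the scaling factor. -/
theorem hcoord_branch {w : ℤ → Fin S.N} (hw : S.Admissible w) {y : ℝ}
    (hy : y ∈ S.interval (w 0)) (n : ℕ) :
    S.hcoord (shift w n) (S.branch w n y) = Real.exp (-S.birkhoff S.J n w) * S.hcoord w y := by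
  have hmem : S.branch w n y ∈ S.interval (shift w n 0) := by
    simpa using mapsTo_branch hw n hy
  have h1 := tendsto_hcoord (hw.shift n) hmem
  have h2 := ((tendsto_hcoord hw hy).comp (tendsto_add_atTop_nat n)).const_mul
    (Real.exp (-S.birkhoff S.J n w))
  refine tendsto_nhds_unique h1 (h2.congr fun k => ?_)
  simp only [Function.comp]
  rw [add_comm k n, birkhoff_add _ hw, branch_add, branch_add, branch_point hw, ← mul_assoc,
    ← Real.exp_add]
  congr 2
  ring

theorem Hinv_eq {w : ℤ → Fin S.N} (hw : S.Admissible w) {z : ℝ} (hz : z ∈ S.localInterval w) :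
    S.Hinv w z = S.hcoord w (S.point w + z) := by
  have := tendsto_hcoord hw hz
  simp only [branch_point hw] at this
  exact this.limUnder_eq

theorem continuousOn_hcoord {w : ℤ → Fin S.N} (hw : S.Admissible w) :
    ContinuousOn (S.hcoord w) (S.interval (w 0)) := fun _ hy =>
  (hasDerivWithinAt_hcoord hw hy).continuousWithinAt

theorem strictMonoOn_hcoord {w : ℤ → Fin S.N} (hw : S.Admissible w) :
    StrictMonoOn (S.hcoord w) (S.interval (w 0)) := by
  refine strictMonoOn_of_deriv_pos (convex_Icc _ _) (continuousOn_hcoord hw) fun y hy => ?_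
  have hn : S.interval (w 0) ∈ 𝓝 y := mem_interior_iff_mem_nhds.mp hy
  rw [((hasDerivWithinAt_hcoord hw (interior_subset hy)).hasDerivAt hn).deriv]
  exact hderiv_pos _ _

/-- The image of the linearizing coordinate. -/
def hrange (S : IFS) (w : ℤ → Fin S.N) : Set ℝ := S.hcoord w '' S.interval (w 0)

theorem image_Hinv {w : ℤ → Fin S.N} (hw : S.Admissible w) :
    S.Hinv w '' S.localInterval w = S.hrange w := by
  ext x
  constructor
  · rintro ⟨z, hz, rfl⟩
    exact ⟨_, hz, (Hinv_eq hw hz).symm⟩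
  · rintro ⟨y, hy, rfl⟩
    have : y - S.point w ∈ S.localInterval w := by simpa [localInterval] using hy
    exact ⟨_, this, by rw [Hinv_eq hw this]; congr 1; ring⟩

/-- The inverse of the linearizing coordinate, `x_w + H_w`. -/
def hinverse (S : IFS) (w : ℤ → Fin S.N) (z : ℝ) : ℝ := S.point w + S.H w z

theorem hinverse_hcoord {w : ℤ → Fin S.N} (hw : S.Admissible w) {y : ℝ}
    (hy : y ∈ S.interval (w 0)) : S.hinverse w (S.hcoord w y) = y := by
  have hz : y - S.point w ∈ S.localInterval w := by simpa [localInterval] using hy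
  have e : S.hcoord w y = S.Hinv w (y - S.point w) := by
    rw [Hinv_eq hw hz]; congr 1; ring
  have hex : ∃ z ∈ S.localInterval w, S.Hinv w z = S.hcoord w y := ⟨_, hz, e.symm⟩
  have h1 : S.H w (S.hcoord w y) ∈ S.localInterval w := Function.invFunOn_mem hex
  have h2 : S.Hinv w (S.H w (S.hcoord w y)) = S.hcoord w y := Function.invFunOn_eq hex
  rw [Hinv_eq hw h1] at h2
  exact (strictMonoOn_hcoord hw).injOn h1 hy h2

theorem hasDerivWithinAt_hinverse {w : ℤ → Fin S.N} (hw : S.Admissible w) {y : ℝ}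
    (hy : y ∈ S.interval (w 0)) :
    HasDerivWithinAt (S.hinverse w) (S.hderiv w y)⁻¹ (S.hrange w) (S.hcoord w y) :=
  (S.isCompact_interval _).hasDerivWithinAt_leftInverse (continuousOn_hcoord hw)
    (fun _ hx => hinverse_hcoord hw hx) hy (hasDerivWithinAt_hcoord hw hy) (hderiv_pos _ _).ne'

theorem uniqueDiffOn_hrange {w : ℤ → Fin S.N} (hw : S.Admissible w) :
    UniqueDiffOn ℝ (S.hrange w) := by
  rintro _ ⟨y, hy, rfl⟩
  refine (hasDerivWithinAt_hcoord hw hy).hasFDerivWithinAt.uniqueDiffWithinAt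
    (S.uniqueDiffOn_interval _ y hy) ?_
  have hne := (hderiv_pos w y).ne'
  refine Function.Surjective.denseRange fun z => ⟨z / S.hderiv w y, ?_⟩
  simp [hne]

theorem mapsTo_hinverse {w : ℤ → Fin S.N} (hw : S.Admissible w) :
    MapsTo (S.hinverse w) (S.hrange w) (S.interval (w 0)) := by
  rintro _ ⟨y, hy, rfl⟩
  rwa [hinverse_hcoord hw hy]

theorem hasDerivWithinAt_hinverse' {w : ℤ → Fin S.N} (hw : S.Admissible w) {z : ℝ}
    (hz : z ∈ S.hrange w) :
    HasDerivWithinAt (S.hinverse w) (S.hderiv w (S.hinverse w z))⁻¹ (S.hrange w) z := by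
  obtain ⟨y, hy, rfl⟩ := hz
  rw [hinverse_hcoord hw hy]
  exact hasDerivWithinAt_hinverse hw hy

theorem derivWithin_H {w : ℤ → Fin S.N} (hw : S.Admissible w) {z : ℝ} (hz : z ∈ S.hrange w) :
    derivWithin (S.H w) (S.hrange w) z = (S.hderiv w (S.hinverse w z))⁻¹ := by
  have h := (hasDerivWithinAt_hinverse' hw hz).const_add (-S.point w)
  have e : (fun z => -S.point w + S.hinverse w z) = S.H w := by
    funext z; simp [hinverse]
  rw [e] at h
  exact h.derivWithin (uniqueDiffOn_hrange hw z hz)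

/-- Bootstrap: the derivative of the inverse coordinate is $1/H$-derivative composed with the
inverse coordinate itself, that is `(S.hderiv w)⁻¹ ∘ S.hinverse w`. Order `n` for this function
therefore yields order `n + 1` through the chain rule. -/
theorem exists_hbound_hinverse (S : IFS) (n : ℕ) : ∃ C : ℝ, 0 ≤ C ∧ ∀ w, S.Admissible w →
    HBound 1 (S.hrange w) n (fun _ => C)
      fun z => (((S.hderiv w (S.hinverse w z))⁻¹ : ℝ) : ℂ) := by
  induction n with
  | zero =>
    obtain ⟨C, hC, h⟩ := S.exists_hbound_hderiv 0
    exact ⟨C, hC, fun w hw z hz => by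
      simpa using (h w hw).2.norm_le _ (mapsTo_hinverse hw hz)⟩
  | succ n ih =>
    obtain ⟨B, hB, hBb⟩ := ih
    obtain ⟨C, hC, h⟩ := S.exists_hbound_hderiv (n + 1)
    exact ⟨_, by positivity, fun w hw => ((HBound.comp_const one_pos hB zero_le_one le_rfl
      (S.uniqueDiffOn_interval _) (mapsTo_hinverse hw)
      (fun z hz => by simpa using hasDerivWithinAt_hinverse' hw hz) (h w hw).2
      (hBb w hw))).congr fun z _ => by simp⟩

theorem derivWithin_Hinv {w : ℤ → Fin S.N} (hw : S.Admissible w) {y : ℝ}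
    (hy : y ∈ S.interval (w 0)) :
    derivWithin (S.Hinv w) (S.localInterval w) (y - S.point w) = S.hderiv w y := by
  have hz : y - S.point w ∈ S.localInterval w := by simpa [localInterval] using hy
  have hI : S.localInterval w = Icc (S.lo (w 0) - S.point w) (S.hi (w 0) - S.point w) := by
    ext z; simp only [localInterval, interval, mem_ofPred_eq, mem_Icc]
    constructor <;> rintro ⟨h1, h2⟩ <;> constructor <;> linarith
  have hu : UniqueDiffWithinAt ℝ (S.localInterval w) (y - S.point w) := by
    rw [hI] at hz ⊢
    exact uniqueDiffOn_Icc (by linarith [S.lo_lt_hi (w 0)]) _ hz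
  have e : S.point w + (y - S.point w) = y := by ring
  have h1 : HasDerivWithinAt (S.hcoord w) (S.hderiv w y) (S.interval (w 0))
      (S.point w + (y - S.point w)) := e.symm ▸ hasDerivWithinAt_hcoord hw hy
  have h2 : HasDerivWithinAt (fun z => S.hcoord w (S.point w + z)) (S.hderiv w y * 1)
      (S.localInterval w) (y - S.point w) :=
    h1.comp _ ((hasDerivWithinAt_id _ _).const_add _) fun z hz => hz
  rw [mul_one] at h2
  exact (h2.congr (fun z hz => Hinv_eq hw hz) (Hinv_eq hw hz)).derivWithin hu

end IFS

end

noncomputable section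

/-! ### Iterates of the transposed transfer operator -/

namespace TransferData

open IFS

variable {S : IFS} (D : TransferData S) (ħ : ℝ)

open Classical in
/-- The transpose of one component of the transfer operator. -/
def edgeTransfer (i j : Fin S.N) : 𝓢(ℝ, ℂ) →L[ℂ] 𝓢(ℝ, ℂ) :=
  if h : S.adj i j = 1 then (D.exists_branchTranspose ħ i j h).choose else 0

theorem edgeTransfer_apply (i j : Fin S.N) (ψ : 𝓢(ℝ, ℂ)) (y : ℝ) :
    D.edgeTransfer ħ i j ψ y = D.branchTranspose ħ i j ψ y := by
  by_cases h : S.adj i j = 1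
  · rw [edgeTransfer, dif_pos h]
    exact (D.exists_branchTranspose ħ i j h).choose_spec ψ y
  · simp [edgeTransfer, branchTranspose, h]

/-- The contribution of a word to the iterated transpose. -/
def wordTransfer : (ℤ → Fin S.N) → ℕ → 𝓢(ℝ, ℂ) →L[ℂ] 𝓢(ℝ, ℂ)
  | _, 0 => ContinuousLinearMap.id ℂ _
  | w, n + 1 => (D.edgeTransfer ħ (w 0) (w 1)).comp (wordTransfer (shift w 1) n)

open Classical in
/-- The contribution of a finite sequence of letters, on functions. -/
def lettersFun (f : ℝ → ℂ) : (n : ℕ) → (Fin (n + 1) → Fin S.N) → ℝ → ℂ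
  | 0, v, y => if y ∈ S.interval (v 0) then f y else 0
  | n + 1, v, y => D.branchTranspose ħ (v 0) (v 1) (lettersFun f n (Fin.tail v)) y

variable {ħ}

theorem branchTranspose_congr {i j : Fin S.N} {f g : ℝ → ℂ} {y : ℝ}
    (h : S.adj i j = 1 → y ∈ S.interval i → f (S.φ i j y) = g (S.φ i j y)) :
    D.branchTranspose ħ i j f y = D.branchTranspose ħ i j g y := by
  by_cases h1 : S.adj i j = 1 ∧ y ∈ S.interval i
  · simp only [branchTranspose, h1, and_self, if_true, h h1.1 h1.2]
  · simp only [branchTranspose, h1, if_false]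

theorem branchTranspose_zero (i j : Fin S.N) (y : ℝ) :
    D.branchTranspose ħ i j (fun _ => 0) y = 0 := by
  simp [branchTranspose]

theorem branchTranspose_sum {ι : Type*} (s : Finset ι) (i j : Fin S.N) (f : ι → ℝ → ℂ) (y : ℝ) :
    D.branchTranspose ħ i j (fun z => ∑ a ∈ s, f a z) y =
      ∑ a ∈ s, D.branchTranspose ħ i j (f a) y := by
  by_cases h1 : S.adj i j = 1 ∧ y ∈ S.interval i
  · simp only [branchTranspose, h1, and_self, if_true, Finset.mul_sum]
  · simp [branchTranspose, h1]

theorem lettersFun_eq_zero (f : ℝ → ℂ) {n : ℕ} (v : Fin (n + 1) → Fin S.N) {y : ℝ}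
    (hy : y ∉ S.interval (v 0)) : D.lettersFun ħ f n v y = 0 := by
  cases n <;> simp [lettersFun, branchTranspose, hy]

theorem lettersFun_eq_zero_of_not (f : ℝ → ℂ) {n : ℕ} (v : Fin (n + 1) → Fin S.N)
    (hv : ¬ ∀ k : Fin n, S.adj (v k.castSucc) (v k.succ) = 1) (y : ℝ) :
    D.lettersFun ħ f n v y = 0 := by
  induction n generalizing y with
  | zero => exact absurd (fun k => k.elim0) hv
  | succ n ih =>
    rw [lettersFun]
    by_cases h : S.adj (v 0) (v 1) = 1
    · have : ¬ ∀ k : Fin n, S.adj (Fin.tail v k.castSucc) (Fin.tail v k.succ) = 1 := fun hh =>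
        hv fun k => by
          refine Fin.cases ?_ (fun k => ?_) k
          · exact h
          · exact hh k
      rw [D.branchTranspose_congr (g := fun _ => 0) fun _ _ => ih _ this _,
        D.branchTranspose_zero]
    · simp [branchTranspose, h]

/-- All tuples of letters are summed, including inadmissible ones, whose contribution is zero. This
makes the induction a sum over a product. For $n=0$ the tuples only reproduce $f$ on the intervals,
whence the alternative in the hypothesis. -/
theorem transpose_pow_apply (f : 𝓢(ℝ, ℂ)) (n : ℕ) {y : ℝ} (hy : y ∈ S.trap 0 ∨ 1 ≤ n) :
    (D.transpose ħ ^ n) f y = ∑ v, D.lettersFun ħ f n v y := by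
  induction n generalizing y with
  | zero =>
    obtain ⟨i, hi⟩ := mem_iUnion.mp (hy.resolve_right (by norm_num))
    rw [Finset.sum_eq_single (fun _ => i)]
    · simp [lettersFun, hi]
    · intro v _ hv
      refine D.lettersFun_eq_zero _ _ fun h => hv ?_
      funext k
      have hk : k = 0 := Fin.ext (by omega)
      rw [hk]
      by_contra hne
      exact Set.disjoint_left.mp (S.disjoint _ _ hne) h hi
    · simp
  | succ n ih =>
    have e1 : (D.transpose ħ ^ (n + 1)) f = D.transpose ħ ((D.transpose ħ ^ n) f) := by
      rw [pow_succ']; rfl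
    rw [e1, transpose_apply, transposeFun, ← Equiv.sum_comp (Fin.consEquiv fun _ => Fin S.N),
      Fintype.sum_prod_type]
    refine Finset.sum_congr rfl fun i _ => ?_
    have e2 : ∀ j, D.branchTranspose ħ i j ((D.transpose ħ ^ n) f) y =
        ∑ v, D.branchTranspose ħ i j (D.lettersFun ħ f n v) y := fun j => by
      rw [← D.branchTranspose_sum]
      exact D.branchTranspose_congr fun hij hyi =>
        ih (Or.inl (mem_iUnion.mpr ⟨j, mapsTo_φ hij hyi⟩))
    simp only [e2]
    rw [Finset.sum_comm]
    refine Finset.sum_congr rfl fun v _ => ?_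
    -- The next letter must be the first letter of the remaining tuple, because the intervals are
    -- disjoint.
    rw [Finset.sum_eq_single (v 0)]
    · simp [lettersFun, Fin.consEquiv]
    · intro j _ hj
      rw [D.branchTranspose_congr (g := fun _ => 0), D.branchTranspose_zero]
      intro hij hyi
      refine D.lettersFun_eq_zero _ _ fun h => ?_
      exact Set.disjoint_left.mp (S.disjoint _ _ hj) (mapsTo_φ hij hyi) h
    · simp

/-- At least one step is required: for $n=0$ the word operator is the identity, while the tuple also
restricts to an interval. -/
theorem wordTransfer_eq_lettersFun (f : 𝓢(ℝ, ℂ)) {n : ℕ} (hn : 1 ≤ n) {w : ℤ → Fin S.N}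
    {v : Fin (n + 1) → Fin S.N} (hwv : ∀ k : Fin (n + 1), w (k : ℕ) = v k) (y : ℝ) :
    D.wordTransfer ħ w n f y = D.lettersFun ħ f n v y := by
  induction n, hn using Nat.le_induction generalizing w y with
  | base =>
    have h0 : w 0 = v 0 := hwv 0
    have h1 : w 1 = v 1 := hwv 1
    simp only [wordTransfer, ContinuousLinearMap.comp_id, edgeTransfer_apply, lettersFun, h0, h1]
    refine D.branchTranspose_congr fun hij hy => ?_
    have : S.φ (v 0) (v 1) y ∈ S.interval (v 1) := mapsTo_φ hij hy
    have e : Fin.tail v 0 = v 1 := rfl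
    simp [e, this]
  | succ n hn ih =>
    have h0 : w 0 = v 0 := hwv 0
    have h1 : w 1 = v 1 := hwv 1
    simp only [wordTransfer, ContinuousLinearMap.comp_apply, edgeTransfer_apply, lettersFun, h0, h1]
    refine D.branchTranspose_congr fun hij hy => ih (fun k => ?_) _
    have := hwv k.succ
    simpa [Fin.tail] using this

theorem transpose_pow_eq_sum (ψ : 𝓢(ℝ, ℂ)) {n : ℕ} (hn : 1 ≤ n)
    {ext : S.Word n → ℤ → Fin S.N} (hext : ∀ v, S.Extends (ext v) v) :
    (D.transpose ħ ^ n) ψ = ∑ v : S.Word n, D.wordTransfer ħ (ext v) n ψ := by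
  classical
  ext y
  rw [D.transpose_pow_apply ψ n (Or.inr hn)]
  rw [← Finset.sum_subset (Finset.subset_univ (Finset.univ.filter fun v : Fin (n + 1) → Fin S.N =>
      ∀ k : Fin n, S.adj (v k.castSucc) (v k.succ) = 1))]
  · rw [Finset.sum_subtype (p := fun v : Fin (n + 1) → Fin S.N =>
      ∀ k : Fin n, S.adj (v k.castSucc) (v k.succ) = 1) _ (by simp), sum_apply]
    exact Finset.sum_congr rfl fun v _ =>
      (D.wordTransfer_eq_lettersFun ψ hn (hext v).2 y).symm
  · intro v _ hv
    exact D.lettersFun_eq_zero_of_not _ _ (by simpa using hv) y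

theorem transfer_pow_apply (n : ℕ) (u : 𝓢'(ℝ, ℂ)) (ψ : 𝓢(ℝ, ℂ)) :
    (D.transfer ħ ^ n) u ψ = u ((D.transpose ħ ^ n) ψ) := by
  induction n generalizing u with
  | zero => rfl
  | succ n ih =>
    have e1 : (D.transfer ħ ^ (n + 1)) u = (D.transfer ħ ^ n) (D.transfer ħ u) := by
      rw [pow_succ]; rfl
    have e2 : (D.transpose ħ ^ (n + 1)) ψ = D.transpose ħ ((D.transpose ħ ^ n) ψ) := by
      rw [pow_succ']; rfl
    rw [e1, e2, ih]
    rfl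

variable {w : ℤ → Fin S.N} (hw : S.Admissible w)

include hw

/-- The cut-offs telescope to $\chi/(\chi\circ\phi_w)$, the intermediate ones being non-zero where
$\chi(y)\ne0$. Jacobians multiply and phases add. -/
theorem wordTransfer_apply (ψ : 𝓢(ℝ, ℂ)) {n : ℕ} (hn : 1 ≤ n) {y : ℝ}
    (hy : y ∈ S.interval (w 0)) :
    D.wordTransfer ħ w n ψ y = D.ratio w n y * S.dbranch w n y *
      Complex.exp (Complex.I / ħ * ∑ k ∈ Finset.range n, D.phase ħ (S.branch w (k + 1) y)) *
      ψ (S.branch w n y) := by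
  induction n, hn using Nat.le_induction generalizing w y with
  | base =>
    have h1 : S.adj (w 0) (w 1) = 1 := hw 0
    simp [wordTransfer, edgeTransfer_apply, branchTranspose, hy, ratio, dbranch, branch, dφ, h1]
    left
    ring
  | succ n hn ih =>
    have h1 : S.adj (w 0) (w 1) = 1 := hw 0
    have hφ : S.φ (w 0) (w 1) y ∈ S.interval (shift w 1 0) := by simpa using mapsTo_φ h1 hy
    rw [wordTransfer, ContinuousLinearMap.comp_apply, edgeTransfer_apply, branchTranspose,
      if_pos ⟨h1, hy⟩, ih (hw.shift 1) hφ]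
    have hb : ∀ k, S.branch (shift w 1) k (S.φ (w 0) (w 1) y) = S.branch w (k + 1) y := fun k => by
      rw [add_comm k 1, branch_add]
      simp [branch]
    have hd : S.dbranch w (n + 1) y =
        S.dφ (w 0) (w 1) y * S.dbranch (shift w 1) n (S.φ (w 0) (w 1) y) := by
      rw [dbranch, dbranch, Finset.prod_range_succ', mul_comm (S.dφ (w 0) (w 1) y)]
      refine congrArg₂ _ ?_ ?_
      swap
      · simp [branch]
      · refine Finset.prod_congr rfl fun k _ => ?_
        rw [hb]
        simp only [shift_apply]
        push_cast
        rfl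
    rw [hd, Finset.sum_range_succ', mul_add, Complex.exp_add]
    simp only [hb, ratio]
    have e0 : S.branch w (0 + 1) y = S.φ (w 0) (w 1) y := by simp [branch]
    rw [e0]
    by_cases hχ : D.χ y = 0
    · simp [hχ]
    · have h2 := (D.χ_branch_pos hw le_rfl hy hχ).ne'
      have e3 : S.branch w 1 y = S.φ (w 0) (w 1) y := by simp [branch]
      rw [e3] at h2
      have h3 : (D.χ (S.φ (w 0) (w 1) y) : ℂ) ≠ 0 := by exact_mod_cast h2
      have e4 : derivWithin (S.φ (w 0) (w 1)) (S.interval (w 0)) y = S.dφ (w 0) (w 1) y := rfl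
      rw [e4]
      push_cast
      field_simp

omit hw in
theorem wordTransfer_eq_zero (ψ : 𝓢(ℝ, ℂ)) {n : ℕ} (hn : 1 ≤ n) {y : ℝ}
    (hy : y ∉ S.interval (w 0)) : D.wordTransfer ħ w n ψ y = 0 := by
  obtain ⟨n, rfl⟩ := Nat.exists_eq_add_of_le' hn
  simp [wordTransfer, edgeTransfer_apply, branchTranspose, hy]

end TransferData

end

/-! ### Amplitudes of the words and of the states. -/

noncomputable section

namespace HBound

variable {ħ : ℝ} {I : Set ℝ}

/-- One order is lost because the derivative of top order is bounded but need not be continuous. -/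
theorem contDiffOn (hI : UniqueDiffOn ℝ I) (hħ : ħ ≠ 0) {n : ℕ} {b : ℝ → ℝ} {f : ℝ → ℂ}
    (h : HBound ħ I (n + 1) b f) : ContDiffOn ℝ n f I := by
  induction n generalizing f with
  | zero => exact_mod_cast contDiffOn_zero.mpr h.continuousOn
  | succ n ih =>
    obtain ⟨-, g, hg, h1⟩ := h
    have hn : (ħ : ℂ) ≠ 0 := by exact_mod_cast hħ
    have hg' : ContDiffOn ℝ n g I := by
      refine ((ih h1).const_smul ((ħ : ℂ)⁻¹)).congr fun y _ => ?_
      simp [hn]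
    push_cast
    rw [contDiffOn_succ_iff_derivWithin hI]
    refine ⟨fun y hy => (hg y hy).differentiableWithinAt, by simp, ?_⟩
    exact hg'.congr fun y hy => (hg y hy).derivWithin (hI y hy)

end HBound

namespace TransferData

open IFS

variable {S : IFS} (D : TransferData S)

theorem edgeSmooth_τ : S.EdgeSmooth fun x => (D.τ x : ℂ) :=
  EdgeSmooth.of_contDiffOn (Complex.ofRealCLM.contDiff.comp_contDiffOn D.τ_smooth)

theorem edgeSmooth_V : S.EdgeSmooth D.V := EdgeSmooth.of_contDiffOn D.V_smooth

theorem edgeSmooth_phase (ħ : ℝ) : S.EdgeSmooth (D.phase ħ) := fun i j h =>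
  (D.edgeSmooth_τ i j h).sub (contDiffOn_const.mul (D.edgeSmooth_V i j h))

theorem orbitDiff_phase (ħ : ℝ) (w : ℤ → Fin S.N) (k : ℕ) (y : ℝ) :
    S.orbitDiff (D.phase ħ) w k y = S.orbitDiff (fun x => (D.τ x : ℂ)) w k y -
      Complex.I * ħ * S.orbitDiff D.V w k y := by
  simp only [orbitDiff, phase]
  ring

/-- The exponent of the oscillating factors. -/
theorem I_div_mul_phase {ħ : ℝ} (hħ : ħ ≠ 0) (a b : ℂ) :
    Complex.I / ħ * (a - Complex.I * ħ * b) = Complex.I / ħ * a + b := by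
  have : (ħ : ℂ) ≠ 0 := by exact_mod_cast hħ
  field_simp
  linear_combination (-b) * ħ * Complex.I_sq

theorem orbitDiff_ofReal_im (g : ℝ → ℝ) (w : ℤ → Fin S.N) (k : ℕ) (y : ℝ) :
    (S.orbitDiff (fun x => (g x : ℂ)) w k y).im = 0 := by
  simp [orbitDiff]

theorem upsilon_eq {w : ℤ → Fin S.N} (hw : S.Admissible w) (ħ : ℝ) (y : ℝ) :
    D.upsilon ħ w y = S.cocycle (D.phase ħ) w y := by
  rw [upsilon, cocycle]
  congr 2
  funext k
  rw [orbitDiff, branch_point hw]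
  push_cast
  rfl

theorem cocycle_phase {w : ℤ → Fin S.N} (hw : S.Admissible w) (ħ : ℝ) {y : ℝ}
    (hy : y ∈ S.interval (w 0)) :
    S.cocycle (D.phase ħ) w y = S.cocycle (fun x => (D.τ x : ℂ)) w y -
      Complex.I * ħ * S.cocycle D.V w y := by
  simp only [cocycle, orbitDiff_phase]
  rw [(summable_orbitDiff hw hy D.edgeSmooth_τ).tsum_sub
    ((summable_orbitDiff hw hy D.edgeSmooth_V).mul_left _), tsum_mul_left]
  ring

/-- The oscillating factors of the conjugation operators. -/
theorem exists_hbound_exp_upsilon {ħ₀ : ℝ} (hħ₀ : 0 < ħ₀) (n : ℕ) : ∃ C : ℝ, 0 ≤ C ∧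
    ∀ ħ : ℝ, 0 < ħ → ħ ≤ ħ₀ → ∀ w, S.Admissible w →
    HBound ħ (S.interval (w 0)) n (fun _ => C)
      (fun y => Complex.exp (Complex.I / ħ * D.upsilon ħ w y)) ∧
    HBound ħ (S.interval (w 0)) n (fun _ => C)
      (fun y => Complex.exp (-(Complex.I / ħ * D.upsilon ħ w y))) := by
  obtain ⟨A, hA, hAb⟩ := exists_hbound_cocycle D.edgeSmooth_τ (n + 1)
  obtain ⟨B, hB, hBb⟩ := exists_hbound_cocycle D.edgeSmooth_V (n + 1)
  obtain ⟨K, hK, h⟩ := HBound.exists_exp n A B ħ₀ hA hB hħ₀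
  refine ⟨K, hK, fun ħ hħ hħ0 w hw => ⟨?_, ?_⟩⟩
  · refine ((h ħ hħ hħ0 _ _ _ (hAb w hw) (fun y _ => cocycle_ofReal_im w y)
      (hBb w hw)).of_succ).congr fun y hy => ?_
    rw [D.upsilon_eq hw, D.cocycle_phase hw ħ hy, I_div_mul_phase hħ.ne']
  · refine ((h ħ hħ hħ0 _ _ _ (hAb w hw).neg (fun y _ => by
      rw [Complex.neg_im, cocycle_ofReal_im, neg_zero]) (hBb w hw).neg).of_succ).congr
      fun y hy => ?_
    rw [D.upsilon_eq hw, D.cocycle_phase hw ħ hy, I_div_mul_phase hħ.ne']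
    congr 1
    ring

theorem exists_hbound_exp_orbit {ħ₀ : ℝ} (hħ₀ : 0 < ħ₀) (n : ℕ) : ∃ C : ℝ, 0 ≤ C ∧
    ∀ ħ : ℝ, 0 < ħ → ħ ≤ ħ₀ → ∀ w, S.Admissible w → ∀ k,
    HBound ħ (S.interval (w 0)) n (fun _ => C)
      (fun y => Complex.exp (Complex.I / ħ *
        ∑ l ∈ Finset.range k, S.orbitDiff (D.phase ħ) w l y)) := by
  obtain ⟨A, hA, hAb⟩ := exists_hbound_sum_orbitDiff D.edgeSmooth_τ (n + 1)
  obtain ⟨B, hB, hBb⟩ := exists_hbound_sum_orbitDiff D.edgeSmooth_V (n + 1)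
  obtain ⟨K, hK, h⟩ := HBound.exists_exp n A B ħ₀ hA hB hħ₀
  refine ⟨K, hK, fun ħ hħ hħ0 w hw k => ?_⟩
  refine ((h ħ hħ hħ0 _ _ _ (hAb w hw k) (fun y _ => ?_) (hBb w hw k)).of_succ).congr
    fun y hy => ?_
  · rw [Complex.im_sum]
    exact Finset.sum_eq_zero fun l _ => orbitDiff_ofReal_im _ _ _ _
  · simp only [orbitDiff_phase, Finset.sum_sub_distrib, ← Finset.mul_sum]
    rw [I_div_mul_phase hħ.ne']

/-- The normalized derivative of a branch. -/
def slope (S : IFS) (w : ℤ → Fin S.N) (n : ℕ) (y : ℝ) : ℝ :=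
  Real.exp (S.birkhoff S.J n w) * S.dbranch w n y

theorem dbranch_eq (w : ℤ → Fin S.N) (n : ℕ) (y : ℝ) :
    S.dbranch w n y = Real.exp (-S.birkhoff S.J n w) * slope S w n y := by
  rw [slope, ← mul_assoc, ← Real.exp_add, neg_add_cancel, Real.exp_zero, one_mul]

/-- In this form bounds above and below, and on all derivatives, follow from those on the sums of
differences of $J$. -/
theorem slope_eq_exp {w : ℤ → Fin S.N} (hw : S.Admissible w) (n : ℕ) {y : ℝ}
    (hy : y ∈ S.interval (w 0)) : (slope S w n y : ℂ) =
      Complex.exp (-∑ l ∈ Finset.range n, S.orbitDiff (fun x => (S.J x : ℂ)) w l y) := by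
  have h1 : ∑ k ∈ Finset.range n, S.orbitDiff (fun x => (S.J x : ℂ)) w k y =
      ((-Real.log (S.dbranch w n y) - S.birkhoff S.J n w : ℝ) : ℂ) := by
    rw [← sum_J_eq hw n hy, birkhoff_eq, ← Finset.sum_sub_distrib]
    push_cast
    rfl
  rw [h1, ← Complex.ofReal_neg, ← Complex.ofReal_exp, slope]
  congr 1
  rw [neg_sub, sub_neg_eq_add, Real.exp_add, Real.exp_log (dbranch_pos hw n hy)]

theorem exists_hbound_slope (S : IFS) (n : ℕ) : ∃ C : ℝ, 0 ≤ C ∧ ∀ w, S.Admissible w → ∀ k,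
    HBound 1 (S.interval (w 0)) n (fun _ => C) (fun y => (slope S w k y : ℂ)) ∧
    ∀ y ∈ S.interval (w 0), (slope S w k y)⁻¹ ≤ C := by
  obtain ⟨B, hB, h⟩ := exists_hbound_sum_orbitDiff (S := S) edgeSmooth_J (n + 1)
  obtain ⟨K, hK, hexp⟩ := HBound.exists_exp n 0 B 1 le_rfl hB one_pos
  have h0 : ∀ I, HBound 1 I (n + 1) (fun _ => 0) (fun _ => (0 : ℂ)) := fun I =>
    (HBound.const 0).mono fun y _ => by simp
  refine ⟨K, hK, fun w hw k => ⟨?_, fun y hy => ?_⟩⟩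
  · exact ((hexp 1 one_pos le_rfl _ _ _ (h0 _) (fun _ _ => rfl) (h w hw k).neg).of_succ).congr
      fun y hy => by rw [slope_eq_exp hw k hy]; simp
  · have h1 := (hexp 1 one_pos le_rfl _ _ _ (h0 _) (fun _ _ => rfl) (h w hw k)).norm_le y hy
    have h2 : ((slope S w k y)⁻¹ : ℂ) =
        Complex.exp (∑ l ∈ Finset.range k, S.orbitDiff (fun x => (S.J x : ℂ)) w l y) := by
      rw [slope_eq_exp hw k hy, Complex.exp_neg, inv_inv]
    simp only [mul_zero, zero_add] at h1
    rw [← h2, ← Complex.ofReal_inv, Complex.norm_real] at h1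
    exact (le_abs_self _).trans h1

theorem slope_pos {w : ℤ → Fin S.N} (hw : S.Admissible w) (n : ℕ) {y : ℝ}
    (hy : y ∈ S.interval (w 0)) : 0 < slope S w n y :=
  mul_pos (Real.exp_pos _) (dbranch_pos hw n hy)

/-- The amplitude of the contribution of a word. -/
def amplitude (ħ : ℝ) (w : ℤ → Fin S.N) (n : ℕ) (y : ℝ) : ℂ :=
  D.ratio w n y * slope S w n y *
    Complex.exp (Complex.I / ħ * ∑ l ∈ Finset.range n, S.orbitDiff (D.phase ħ) w l y)

/-- Only the exponential oscillates at scale $\hbar$. The cut-off quotient and the normalized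
derivative have bounds for $\hbar=1$, which are rescaled at the cost of powers of $\max(\hbar_0,1)$.
-/
theorem exists_hbound_amplitude {ħ₀ : ℝ} (hħ₀ : 0 < ħ₀) (M : ℕ) : ∃ C : ℝ, 0 ≤ C ∧
    ∀ ħ : ℝ, 0 < ħ → ħ ≤ ħ₀ → ∀ w, S.Admissible w → ∀ n, 1 ≤ n →
    HBound ħ (S.interval (w 0)) M (fun _ => C) (D.amplitude ħ w n) := by
  obtain ⟨A, hA, hAb⟩ := D.exists_hbound_ratio M
  obtain ⟨B, hB, hBb⟩ := exists_hbound_slope S M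
  obtain ⟨K, hK, hKb⟩ := D.exists_hbound_exp_orbit hħ₀ M
  refine ⟨2 ^ M * K * (max ħ₀ 1 ^ M * (2 ^ M * B * A)), by positivity,
    fun ħ hħ hħ0 w hw n hn => ?_⟩
  have h1 := HBound.mul hB (hAb w hw n hn) (hBb w hw n).1
  have h2 := HBound.rescale hħ.le (hħ0.trans (le_max_left ħ₀ 1)) (le_max_right _ _)
    (by positivity) h1
  exact HBound.mul hK h2 (hKb ħ hħ hħ0 w hw n)

theorem sum_phase_eq (ħ : ℝ) (w : ℤ → Fin S.N) (n : ℕ) (y : ℝ) :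
    ∑ k ∈ Finset.range n, D.phase ħ (S.branch w (k + 1) y) =
      S.birkhoff (D.phase ħ) n w + ∑ l ∈ Finset.range n, S.orbitDiff (D.phase ħ) w l y := by
  rw [birkhoff_eq, ← Finset.sum_add_distrib]
  refine Finset.sum_congr rfl fun k _ => ?_
  rw [orbitDiff]
  ring

/-- The exponential factor of a word. -/
def wordFactor (ħ : ℝ) (w : ℤ → Fin S.N) (n : ℕ) : ℂ :=
  Complex.exp (Complex.I / ħ * S.birkhoff (D.phase ħ) n w)

/-- The roof function contributes a unimodular factor because $\tau$ is real. What remains is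
$e^{V_w}$, since $\frac i\hbar(-i\hbar V)=V$. -/
theorem norm_wordFactor {ħ : ℝ} (hħ : ħ ≠ 0) (w : ℤ → Fin S.N) (n : ℕ) :
    ‖D.wordFactor ħ w n‖ = Real.exp (S.birkhoff (fun x => (D.V x).re) n w) := by
  have h1 : S.birkhoff (D.phase ħ) n w = ((S.birkhoff D.τ n w : ℝ) : ℂ) -
      Complex.I * ħ * S.birkhoff D.V n w := by
    simp only [birkhoff, phase, Finset.sum_sub_distrib, ← Finset.mul_sum]
    push_cast
    rfl
  rw [wordFactor, h1, I_div_mul_phase hħ, Complex.norm_exp, Complex.add_re]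
  have h2 : (Complex.I / ħ * ((S.birkhoff D.τ n w : ℝ) : ℂ)).re = 0 := by
    have : Complex.I / ħ * ((S.birkhoff D.τ n w : ℝ) : ℂ) =
        ((S.birkhoff D.τ n w / ħ : ℝ) : ℂ) * Complex.I := by
      push_cast; field_simp
    rw [this]
    simp
  rw [h2, zero_add]
  simp [birkhoff]

theorem wordTransfer_eq {ħ : ℝ} {w : ℤ → Fin S.N} (hw : S.Admissible w) (ψ : 𝓢(ℝ, ℂ)) {n : ℕ}
    (hn : 1 ≤ n) {y : ℝ} (hy : y ∈ S.interval (w 0)) :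
    D.wordTransfer ħ w n ψ y = D.wordFactor ħ w n *
      ((Real.exp (-S.birkhoff S.J n w) : ℝ) : ℂ) *
      (D.amplitude ħ w n y * ψ (S.branch w n y)) := by
  rw [D.wordTransfer_apply hw ψ hn hy, D.sum_phase_eq, mul_add, Complex.exp_add, dbranch_eq,
    amplitude, wordFactor]
  push_cast
  ring

/-! ### The states -/

/-- The amplitude of the stable states. -/
def stableAmplitude (ħ : ℝ) (w : ℤ → Fin S.N) (y : ℝ) : ℂ :=
  S.hderiv w y * Complex.exp (-(Complex.I / ħ * D.upsilon ħ w y))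

theorem exists_hbound_stableAmplitude {ħ₀ : ℝ} (hħ₀ : 0 < ħ₀) (n : ℕ) : ∃ C : ℝ, 0 ≤ C ∧
    ∀ ħ : ℝ, 0 < ħ → ħ ≤ ħ₀ → ∀ w, S.Admissible w →
    HBound ħ (S.interval (w 0)) n (fun _ => C) (D.stableAmplitude ħ w) := by
  obtain ⟨A, hA, hAb⟩ := S.exists_hbound_hderiv n
  obtain ⟨K, hK, hKb⟩ := D.exists_hbound_exp_upsilon hħ₀ n
  exact ⟨2 ^ n * K * (max ħ₀ 1 ^ n * A), by positivity, fun ħ hħ hħ0 w hw =>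
    HBound.mul hK (HBound.rescale hħ.le (hħ0.trans (le_max_left ħ₀ 1)) (le_max_right _ _) hA
      (hAb w hw).1) (hKb ħ hħ hħ0 w hw).2⟩

theorem exists_hbound_hcoord_pow (S : IFS) (n k : ℕ) : ∃ C : ℝ, 0 ≤ C ∧ ∀ w, S.Admissible w →
    HBound 1 (S.interval (w 0)) n (fun _ => C) fun y => (S.hcoord w y : ℂ) ^ k := by
  have h1 : ∃ C : ℝ, 0 ≤ C ∧ ∀ w, S.Admissible w →
      HBound 1 (S.interval (w 0)) n (fun _ => C) fun y => (S.hcoord w y : ℂ) := by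
    obtain ⟨A, hA, hAb⟩ := S.exists_abs_hcoord_le
    obtain ⟨B, hB, hBb⟩ := S.exists_hbound_hderiv n
    refine ⟨max A B, le_max_of_le_left hA, fun w hw => ?_⟩
    have h0 : ∀ y ∈ S.interval (w 0), ‖(S.hcoord w y : ℂ)‖ ≤ max A B := fun y hy => by
      rw [Complex.norm_real]
      exact (hAb w hw y hy).trans (le_max_left _ _)
    cases n with
    | zero => exact h0
    | succ n =>
      exact ⟨h0, _, fun y hy => (hasDerivWithinAt_hcoord hw hy).ofReal_comp,
        (((hBb w hw).1.of_succ).congr fun y _ => by simp).mono fun y _ => le_max_right _ _⟩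
  obtain ⟨C, hC, h⟩ := h1
  induction k with
  | zero => exact ⟨1, zero_le_one, fun w _ =>
      ((HBound.const (1 : ℂ)).congr fun y _ => pow_zero _).mono fun y _ => by simp⟩
  | succ k ih =>
    obtain ⟨B, hB, hBb⟩ := ih
    exact ⟨2 ^ n * C * B, by positivity, fun w hw =>
      (HBound.mul hC (hBb w hw) (h w hw)).congr fun y _ => pow_succ _ _⟩

theorem conjInvTranspose_eq {ħ : ℝ} {w : ℤ → Fin S.N} (hw : S.Admissible w) (k : ℕ) {y : ℝ}
    (hy : y ∈ S.interval (w 0)) :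
    D.conjInvTranspose ħ w (fun z => (z : ℂ) ^ k) y =
      D.stableAmplitude ħ w y * (S.hcoord w y : ℂ) ^ k := by
  have hz : y - S.point w ∈ S.localInterval w := by simpa [localInterval] using hy
  rw [conjInvTranspose, if_pos hy, derivWithin_Hinv hw hy, Hinv_eq hw hz, stableAmplitude]
  congr 4
  ring

theorem exists_hbound_stableState {ħ₀ : ℝ} (hħ₀ : 0 < ħ₀) (n k : ℕ) : ∃ C : ℝ, 0 ≤ C ∧
    ∀ ħ : ℝ, 0 < ħ → ħ ≤ ħ₀ → ∀ w, S.Admissible w →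
    HBound ħ (S.interval (w 0)) n (fun _ => C)
      fun y => D.χ y * D.conjInvTranspose ħ w (fun z => (z : ℂ) ^ k) y := by
  obtain ⟨A, hA, hAb⟩ := D.exists_hbound_stableAmplitude hħ₀ n
  obtain ⟨B, hB, hBb⟩ := exists_hbound_hcoord_pow S n k
  obtain ⟨K, hK, hKb⟩ := D.exists_hbound_χ_comp n
  refine ⟨2 ^ n * A * (max ħ₀ 1 ^ n * (2 ^ n * B * K)), by positivity,
    fun ħ hħ hħ0 w hw => ?_⟩
  have h1 := HBound.mul hB (hKb w hw 0) (hBb w hw)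
  have h2 := HBound.rescale hħ.le (hħ0.trans (le_max_left ħ₀ 1)) (le_max_right _ _)
    (by positivity) h1
  refine (HBound.mul hA h2 (hAb ħ hħ hħ0 w hw)).congr fun y hy => ?_
  rw [D.conjInvTranspose_eq hw k hy, branch_zero]
  ring

end TransferData

end

/-! ### Neighbourhoods of $x_w$ and the unstable states. -/

noncomputable section

open scoped FourierTransform ENNReal

namespace IFS

variable {S : IFS}

/-- The left end point of `core`. -/
def coreLo (S : IFS) (q : ℕ) (w : ℤ → Fin S.N) : ℝ :=
  S.branch (shift w (-q)) q (S.lo (w (-q)))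

/-- The right end point of `core`. -/
def coreHi (S : IFS) (q : ℕ) (w : ℤ → Fin S.N) : ℝ :=
  S.branch (shift w (-q)) q (S.hi (w (-q)))

/-- The interval of the points with the same past of length `q`. -/
def core (S : IFS) (q : ℕ) (w : ℤ → Fin S.N) : Set ℝ := Icc (S.coreLo q w) (S.coreHi q w)

section admissible

variable {w : ℤ → Fin S.N} (hw : S.Admissible w) (q : ℕ)

include hw

theorem coreLo_lt_coreHi : S.coreLo q w < S.coreHi q w := by
  have h := strictMonoOn_branch (hw.shift (-(q : ℤ))) q
  simp only [shift_apply, zero_add] at h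
  exact h (left_mem_Icc.mpr (S.lo_lt_hi _).le) (right_mem_Icc.mpr (S.lo_lt_hi _).le)
    (S.lo_lt_hi _)

theorem image_eq_core : S.branch (shift w (-q)) q '' S.interval (w (-q)) = S.core q w := by
  have h := strictMonoOn_branch (hw.shift (-(q : ℤ))) q
  have hc := (contDiffOn_branch (hw.shift (-(q : ℤ))) q).continuousOn
  simp only [shift_apply, zero_add] at h hc
  exact hc.image_Icc_of_monotoneOn (S.lo_lt_hi _).le h.monotoneOn

theorem core_subset : S.core q w ⊆ S.interval (w 0) := by
  rw [← image_eq_core hw]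
  have h := mapsTo_branch (hw.shift (-(q : ℤ))) q
  simpa using h.image_subset

theorem core_subset_trap : S.core q w ⊆ S.trap q := by
  rw [← image_eq_core hw]
  rintro _ ⟨y, hy, rfl⟩
  exact branch_mem_trap (hw.shift (-(q : ℤ))) q (by simpa using hy)

theorem point_mem_Ioo_core : S.point w ∈ Ioo (S.coreLo q w) (S.coreHi q w) := by
  have hw' := hw.shift (-(q : ℤ))
  have h := strictMonoOn_branch hw' q
  have h1 : S.branch (shift w (-q)) q (S.point (shift w (-q))) = S.point w := by
    rw [branch_point hw', shift_shift]
    simp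
  have h2 := point_mem_interior hw'
  simp only [shift_apply, zero_add] at h h2
  rw [interval, interior_Icc] at h2
  rw [← h1]
  exact ⟨h (left_mem_Icc.mpr (S.lo_lt_hi _).le) (Ioo_subset_Icc_self h2) h2.1,
    h (Ioo_subset_Icc_self h2) (right_mem_Icc.mpr (S.lo_lt_hi _).le) h2.2⟩

theorem uniqueDiffOn_core : UniqueDiffOn ℝ (S.core q w) :=
  uniqueDiffOn_Icc (coreLo_lt_coreHi hw q)

/-- After at least `q` steps the last `q` letters of the past all belong to the word. With $q=a+1$
this places the whole image where $\chi^{-1}$ is bounded. -/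
theorem branch_mem_core {n : ℕ} (hn : q ≤ n) {y : ℝ} (hy : y ∈ S.interval (w 0)) :
    S.branch w n y ∈ S.core q (shift w n) := by
  obtain ⟨k, rfl⟩ := Nat.exists_eq_add_of_le' hn
  rw [← image_eq_core (hw.shift _), branch_add]
  have e : shift (shift w ((k + q : ℕ) : ℤ)) (-q) = shift w k := by
    rw [shift_shift]; congr 1; push_cast; ring
  rw [e]
  refine ⟨_, ?_, rfl⟩
  have := mapsTo_branch hw k hy
  simpa using this

/-- The image of `core` under the linearizing coordinate. -/
theorem image_hcoord_core : S.hcoord w '' S.core q w =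
    Icc (S.hcoord w (S.coreLo q w)) (S.hcoord w (S.coreHi q w)) :=
  ((continuousOn_hcoord hw).mono (core_subset hw q)).image_Icc_of_monotoneOn
    (coreLo_lt_coreHi hw q).le ((strictMonoOn_hcoord hw).monotoneOn.mono (core_subset hw q))

theorem image_hcoord_core_subset : S.hcoord w '' S.core q w ⊆ S.hrange w :=
  image_mono (core_subset hw q)

theorem convex_image_hcoord_core : Convex ℝ (S.hcoord w '' S.core q w) := by
  rw [image_hcoord_core hw]
  exact convex_Icc _ _

theorem mapsTo_hinverse_core : MapsTo (S.hinverse w) (S.hcoord w '' S.core q w) (S.core q w) := by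
  rintro _ ⟨y, hy, rfl⟩
  rwa [hinverse_hcoord hw (core_subset hw q hy)]

theorem image_hcoord_core_mem_nhds : S.hcoord w '' S.core q w ∈ 𝓝 (0 : ℝ) := by
  have h := point_mem_Ioo_core hw q
  have hm := strictMonoOn_hcoord hw
  have hs := core_subset hw q
  have hlt := (coreLo_lt_coreHi hw q).le
  rw [image_hcoord_core hw, ← hcoord_point w]
  exact Icc_mem_nhds (hm (hs (left_mem_Icc.mpr hlt)) (hs (Ioo_subset_Icc_self h)) h.1)
    (hm (hs (Ioo_subset_Icc_self h)) (hs (right_mem_Icc.mpr hlt)) h.2)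

theorem uniqueDiffOn_image_hcoord_core : UniqueDiffOn ℝ (S.hcoord w '' S.core q w) := by
  rw [image_hcoord_core hw]
  have hs := core_subset hw q
  have hlt := coreLo_lt_coreHi hw q
  exact uniqueDiffOn_Icc (strictMonoOn_hcoord hw (hs (left_mem_Icc.mpr hlt.le))
    (hs (right_mem_Icc.mpr hlt.le)) hlt)

end admissible

end IFS

theorem iteratedDerivWithin_of_mem_nhds {f : ℝ → ℂ} {s : Set ℝ} {x : ℝ} (hs : s ∈ 𝓝 x) (n : ℕ) :
    iteratedDerivWithin n f s x = iteratedDeriv n f x := by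
  rw [iteratedDerivWithin, iteratedDeriv, ← iteratedFDerivWithin_univ]
  rw [iteratedFDerivWithin_congr_set (t := univ)]
  filter_upwards [hs] with y hy
  exact propext ⟨fun _ => mem_univ y, fun _ => hy⟩

namespace TransferData

open IFS

variable {S : IFS} (D : TransferData S)

/-- The interval around `x_w` on which the states are tested. -/
def stateSet (w : ℤ → Fin S.N) : Set ℝ := S.hcoord w '' S.core (D.a + 1) w

/-- The test function conjugated to the normal form. -/
def conjugated (ħ : ℝ) (w : ℤ → Fin S.N) (ψ : ℝ → ℂ) (z : ℝ) : ℂ :=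
  D.conjTranspose ħ w (fun y => (D.χ y : ℂ)⁻¹ * ψ y) z

theorem conjugated_eq {ħ : ℝ} {w : ℤ → Fin S.N} (hw : S.Admissible w) (ψ : ℝ → ℂ) {z : ℝ}
    (hz : z ∈ S.hrange w) : D.conjugated ħ w ψ z =
      ((S.hderiv w (S.hinverse w z) : ℂ)⁻¹ *
        Complex.exp (Complex.I / ħ * D.upsilon ħ w (S.hinverse w z)) *
        (D.χ (S.hinverse w z) : ℂ)⁻¹) * ψ (S.hinverse w z) := by
  have h := derivWithin_H hw hz
  rw [← image_Hinv hw] at h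
  rw [conjugated, conjTranspose, h, hinverse]
  push_cast
  ring

theorem conjugated_add (ħ : ℝ) (w : ℤ → Fin S.N) (ψ φ : ℝ → ℂ) (z : ℝ) :
    D.conjugated ħ w (fun y => ψ y + φ y) z = D.conjugated ħ w ψ z + D.conjugated ħ w φ z := by
  simp only [conjugated, conjTranspose]
  ring

theorem conjugated_const_mul (ħ : ℝ) (w : ℤ → Fin S.N) (c : ℂ) (ψ : ℝ → ℂ) (z : ℝ) :
    D.conjugated ħ w (fun y => c * ψ y) z = c * D.conjugated ħ w ψ z := by
  simp only [conjugated, conjTranspose]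
  ring

/-- In the normal form coordinate the test function is $\psi\circ(x_w+H_w)$ times an amplitude. The
factor $\chi^{-1}$ is under control because `stateSet` comes from points of $K_{a+1}$. -/
theorem exists_hbound_conjugated {ħ₀ : ℝ} (hħ₀ : 0 < ħ₀) (n : ℕ) : ∃ C : ℝ, 0 ≤ C ∧
    ∀ ħ : ℝ, 0 < ħ → ħ ≤ ħ₀ → ∀ w, S.Admissible w → ∀ ψ : 𝓢(ℝ, ℂ),
    HBound ħ (D.stateSet w) n (fun z => C * ∑ i ∈ Finset.range (n + 1),
      ħ ^ i * ‖iteratedDeriv i ψ (S.hinverse w z)‖) (D.conjugated ħ w ψ) := by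
  obtain ⟨A, hA, hAb⟩ := S.exists_hbound_hderiv n
  obtain ⟨K, hK, hKb⟩ := D.exists_hbound_exp_upsilon hħ₀ n
  obtain ⟨X, hX, hXb⟩ := D.exists_hbound_χ_comp n
  obtain ⟨c, hc, hcb⟩ := D.exists_inv_χ_le
  obtain ⟨Y, hY, hYb⟩ := HBound.of_inv n X c hc
  obtain ⟨Q, hQ, hQb⟩ := S.exists_hbound_hinverse n
  set r : ℝ := max ħ₀ 1 ^ n with hr
  have hr0 : 0 ≤ r := by positivity
  set E : ℝ := 2 ^ n * (r * Y) * (2 ^ n * K * (r * A)) with hE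
  set G : ℝ := (1 + 2 ^ n * (r * Q)) ^ n * ((n + 1) * E) with hG
  have hE0 : 0 ≤ E := by positivity
  have hG0 : 0 ≤ G := by positivity
  refine ⟨2 ^ n * G * (1 + 2 ^ n * (r * Q)) ^ n, by positivity, fun ħ hħ hħ0 w hw ψ => ?_⟩
  have resc : ∀ {I : Set ℝ} {B : ℝ} {f : ℝ → ℂ}, 0 ≤ B → HBound 1 I n (fun _ => B) f →
      HBound ħ I n (fun _ => r * B) f := fun hB h =>
    HBound.rescale hħ.le (hħ0.trans (le_max_left ħ₀ 1)) (le_max_right _ _) hB h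
  have hsub := core_subset hw (D.a + 1)
  have hinv : HBound 1 (S.core (D.a + 1) w) n (fun _ => Y) fun y => ((D.χ y : ℂ))⁻¹ :=
    hYb 1 _ _ ((hXb w hw 0).mono_set hsub)
      (fun y hy => by
        simpa using (D.χ_pos_of_mem (Nat.lt_succ_self _) (core_subset_trap hw _ hy)).ne')
      fun y hy => hcb _ (core_subset_trap hw _ hy)
  have h1 : HBound ħ (S.core (D.a + 1) w) n (fun _ => E) fun y =>
      (S.hderiv w y : ℂ)⁻¹ * Complex.exp (Complex.I / ħ * D.upsilon ħ w y) * (D.χ y : ℂ)⁻¹ :=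
    HBound.mul (by positivity) ((HBound.mul hK (resc hA (hAb w hw).2)
      (hKb ħ hħ hħ0 w hw).1).mono_set hsub) (resc hY hinv)
  have hst : D.stateSet w ⊆ S.hrange w := image_hcoord_core_subset hw _
  -- The coordinate change is not contracting, so the chain rule is used with $r=1$ and $q$ the
  -- derivative of the inverse coordinate.
  have hq := ((resc hQ (hQb w hw)).mono_set hst).mono_order (m := n - 1) (by omega)
  have hd : ∀ z ∈ D.stateSet w, HasDerivWithinAt (S.hinverse w)
      (1 * (S.hderiv w (S.hinverse w z))⁻¹) (D.stateSet w) z := fun z hz => by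
    rw [one_mul]
    exact (hasDerivWithinAt_hinverse' hw (hst hz)).mono hst
  have h2 := HBound.comp_const hħ (by positivity) zero_le_one le_rfl (uniqueDiffOn_core hw _)
    (mapsTo_hinverse_core hw _) hd h1 hq
  have h3 := HBound.comp (J := univ) hħ.le zero_le_one (by positivity) (mapsTo_univ _ _) hd
    (n := n) (F := fun i => iteratedDeriv i ψ) (fun i _ z _ => by
      rw [iteratedDeriv_succ]
      exact ((ψ.smooth ⊤).differentiable_iteratedDeriv i
        (WithTop.coe_lt_coe.mpr (ENat.natCast_lt_top i)) z).hasDerivAt.hasDerivWithinAt) hq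
  simp only [iteratedDeriv_zero] at h3
  refine ((HBound.mul hG0 h3 h2).congr fun z hz => ?_).mono fun z hz => le_of_eq ?_
  · rw [D.conjugated_eq hw _ (hst hz)]
    ring
  · simp only [one_mul]
    ring

section unstable

variable {ħ : ℝ} {w : ℤ → Fin S.N}

theorem isUnstableState_iff {k : ℕ} {U : 𝓢'(ℝ, ℂ)} : D.IsUnstableState ħ k w U ↔
    ∀ ψ : 𝓢(ℝ, ℂ), U ψ = (k.factorial : ℂ)⁻¹ * iteratedDeriv k (D.conjugated ħ w ψ) 0 :=
  Iff.rfl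

variable (hħ : 0 < ħ) (hw : S.Admissible w)

include hw

theorem uniqueDiffOn_stateSet : UniqueDiffOn ℝ (D.stateSet w) :=
  uniqueDiffOn_image_hcoord_core hw _

theorem stateSet_mem_nhds : D.stateSet w ∈ 𝓝 (0 : ℝ) := image_hcoord_core_mem_nhds hw _

include hħ

theorem contDiffAt_conjugated (ψ : 𝓢(ℝ, ℂ)) (k : ℕ) :
    ContDiffAt ℝ k (D.conjugated ħ w ψ) 0 := by
  obtain ⟨C, -, h⟩ := D.exists_hbound_conjugated hħ (k + 1)
  exact ((h ħ hħ le_rfl w hw ψ).contDiffOn (D.uniqueDiffOn_stateSet hw)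
    hħ.ne').contDiffAt (D.stateSet_mem_nhds hw)

/-- The conjugated test function is smooth near $0$, which is interior to `stateSet`. Its $k$-th
derivative there is bounded by the sup seminorms of $\psi$ up to order $k$, which gives continuity.
-/
theorem exists_isUnstableState (k : ℕ) : ∃ U : 𝓢'(ℝ, ℂ), D.IsUnstableState ħ k w U := by
  obtain ⟨C, hC, h⟩ := D.exists_hbound_conjugated hħ k
  refine ⟨ContinuousLinearMap.toPointwiseConvergenceCLM _ _ _ _
    (SchwartzMap.mkCLMtoNormedSpace (𝕜 := ℂ) (σ := RingHom.id ℂ)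
      (fun ψ : 𝓢(ℝ, ℂ) => (k.factorial : ℂ)⁻¹ * iteratedDeriv k (D.conjugated ħ w ψ) 0)
      (fun ψ φ => ?_) (fun c ψ => ?_) ?_), fun ψ => rfl⟩
  · have e : D.conjugated ħ w (ψ + φ : 𝓢(ℝ, ℂ)) =
        fun z => D.conjugated ħ w ψ z + D.conjugated ħ w φ z :=
      funext fun z => D.conjugated_add ħ w ψ φ z
    rw [e, iteratedDeriv_fun_add (D.contDiffAt_conjugated hħ hw ψ k)
      (D.contDiffAt_conjugated hħ hw φ k), mul_add]
  · have e : D.conjugated ħ w (c • ψ : 𝓢(ℝ, ℂ)) = fun z => c * D.conjugated ħ w ψ z :=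
      funext fun z => D.conjugated_const_mul ħ w c ψ z
    rw [e, iteratedDeriv_const_mul_field]
    simp only [RingHom.id_apply, smul_eq_mul]
    ring
  · refine ⟨(Finset.range (k + 1)).image fun j => ((0 : ℕ), j),
      ‖(k.factorial : ℂ)⁻¹‖ * ((ħ ^ k)⁻¹ * (C * ∑ i ∈ Finset.range (k + 1), ħ ^ i)),
      by positivity, fun ψ => ?_⟩
    have h1 := (h ħ hħ le_rfl w hw ψ).iteratedDerivWithin_le
      (D.uniqueDiffOn_stateSet hw) le_rfl 0 (mem_of_mem_nhds (D.stateSet_mem_nhds hw))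
    rw [iteratedDerivWithin_of_mem_nhds (D.stateSet_mem_nhds hw), abs_of_pos hħ] at h1
    rw [norm_mul, mul_assoc ‖_‖, mul_assoc (_)⁻¹]
    refine mul_le_mul_of_nonneg_left ?_ (norm_nonneg _)
    rw [le_inv_mul_iff₀ (by positivity), mul_assoc, Finset.sum_mul]
    refine h1.trans (mul_le_mul_of_nonneg_left (Finset.sum_le_sum fun i hi => ?_) hC)
    refine mul_le_mul_of_nonneg_left ?_ (by positivity)
    have h2 := SchwartzMap.le_seminorm' ℂ 0 i ψ (S.hinverse w 0)
    rw [pow_zero, one_mul] at h2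
    refine h2.trans ?_
    have : schwartzSeminormFamily ℂ ℝ ℂ (0, i) ≤ ((Finset.range (k + 1)).image
        fun j => ((0 : ℕ), j)).sup (schwartzSeminormFamily ℂ ℝ ℂ) :=
      Finset.le_sup (f := schwartzSeminormFamily ℂ ℝ ℂ) (Finset.mem_image_of_mem _ hi)
    exact this ψ

end unstable

/-- Sup norms of semiclassical derivatives. -/
theorem _root_.ofReal_pow_mul_norm_iteratedDeriv_le {ħ : ℝ} (hħ : 0 < ħ) {i n : ℕ} (hi : i ≤ n)
    (ψ : 𝓢(ℝ, ℂ)) (x : ℝ) :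
    ENNReal.ofReal (ħ ^ i * ‖iteratedDeriv i ψ x‖) ≤ wienerENorm ħ n ψ := by
  have h1 := enorm_semideriv_iterate_le ħ ψ i x
  rw [semideriv_iterate_apply, ← ofReal_norm, norm_mul, norm_pow, Complex.norm_real,
    Real.norm_eq_abs, abs_of_pos hħ] at h1
  exact h1.trans (wienerENorm_mono_order ħ (by exact_mod_cast hi) ψ)

/-- Each of the $k$ ordinary derivatives costs one $\hbar^{-1}$; the semiclassical derivatives of
$\psi$ are bounded in sup norm by the Wiener norm. -/
theorem exists_enorm_unstable_le {ħ₀ : ℝ} (hħ₀ : 0 < ħ₀) (k : ℕ) : ∃ C : ℝ, 0 ≤ C ∧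
    ∀ ħ : ℝ, 0 < ħ → ħ ≤ ħ₀ → ∀ w, S.Admissible w → ∀ U, D.IsUnstableState ħ k w U →
    ∀ ψ : 𝓢(ℝ, ℂ), ‖U ψ‖ₑ ≤ ENNReal.ofReal (C * (ħ ^ k)⁻¹) * wienerENorm ħ k ψ := by
  obtain ⟨C, hC, h⟩ := D.exists_hbound_conjugated hħ₀ k
  refine ⟨C * (k + 1), by positivity, fun ħ hħ hħ0 w hw U hU ψ => ?_⟩
  have h1 := (h ħ hħ hħ0 w hw ψ).iteratedDerivWithin_le
      (D.uniqueDiffOn_stateSet hw) le_rfl 0 (mem_of_mem_nhds (D.stateSet_mem_nhds hw))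
  rw [iteratedDerivWithin_of_mem_nhds (D.stateSet_mem_nhds hw), abs_of_pos hħ] at h1
  have h2 : ‖U ψ‖ ≤ (ħ ^ k)⁻¹ * (C * ∑ i ∈ Finset.range (k + 1),
      ħ ^ i * ‖iteratedDeriv i ψ (S.hinverse w 0)‖) := by
    rw [(D.isUnstableState_iff.mp hU) ψ, norm_mul, norm_inv, Complex.norm_natCast]
    have h3 : ((k.factorial : ℝ))⁻¹ ≤ 1 :=
      inv_le_one_of_one_le₀ (by exact_mod_cast Nat.one_le_iff_ne_zero.mpr k.factorial_ne_zero)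
    refine (mul_le_of_le_one_left (norm_nonneg _) h3).trans ?_
    rwa [le_inv_mul_iff₀ (by positivity)]
  rw [← ofReal_norm]
  refine (ENNReal.ofReal_le_ofReal h2).trans ?_
  rw [← mul_assoc, ENNReal.ofReal_mul (by positivity),
    ENNReal.ofReal_sum_of_nonneg fun i _ => by positivity]
  have h4 : ∑ i ∈ Finset.range (k + 1), ENNReal.ofReal (ħ ^ i *
      ‖iteratedDeriv i ψ (S.hinverse w 0)‖) ≤ ENNReal.ofReal (k + 1) * wienerENorm ħ k ψ := by
    refine (Finset.sum_le_card_nsmul _ _ _ fun i hi =>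
      ofReal_pow_mul_norm_iteratedDeriv_le hħ (Finset.mem_range_succ_iff.mp hi) ψ _).trans_eq ?_
    rw [Finset.card_range, nsmul_eq_mul, ← ENNReal.ofReal_natCast]
    push_cast
    rfl
  refine (mul_le_mul_right h4 _).trans_eq ?_
  rw [← mul_assoc, ← ENNReal.ofReal_mul (by positivity)]
  congr 2
  ring

/-! ### The stable states -/

open Classical in
/-- The part of the cut-off function on one interval. -/
def localχ (i : Fin S.N) (y : ℝ) : ℂ := if y ∈ S.interval i then (D.χ y : ℂ) else 0

theorem contDiff_localχ (i : Fin S.N) : ContDiff ℝ ∞ (D.localχ i) := by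
  have hχ0 : ∀ x, x ∉ S.trap 0 → D.χ x = 0 := fun x hx => by
    by_contra h
    exact hx (S.trap_subset _ (D.mem_trap_of_χ_ne h))
  have hcl : IsClosed (⋃ k ∈ {k | k ≠ i}, S.interval k) :=
    (Set.toFinite _).isClosed_biUnion fun k _ => isClosed_Icc
  rw [contDiff_iff_contDiffAt]
  intro y
  by_cases hy : y ∈ S.interval i
  · refine ContDiffAt.congr_of_eventuallyEq
      (Complex.ofRealCLM.contDiff.comp D.χ_smooth).contDiffAt ?_
    have : (⋃ k ∈ {k | k ≠ i}, S.interval k)ᶜ ∈ 𝓝 y := by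
      refine hcl.isOpen_compl.mem_nhds ?_
      simp only [mem_compl_iff, mem_iUnion, not_exists]
      exact fun k hk hk' => Set.disjoint_left.mp (S.disjoint k i hk) hk' hy
    filter_upwards [this] with z hz
    by_cases hzi : z ∈ S.interval i
    · simp [localχ, hzi]
    · have : z ∉ S.trap 0 := by
        intro h0
        obtain ⟨k, hk⟩ := mem_iUnion.mp h0
        by_cases e : k = i
        · exact hzi (e ▸ hk)
        · exact hz (mem_biUnion (by exact e) hk)
      simp [localχ, hzi, hχ0 z this]
  · refine (contDiffAt_const (c := (0 : ℂ))).congr_of_eventuallyEq ?_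
    filter_upwards [(isClosed_Icc (a := S.lo i) (b := S.hi i)).isOpen_compl.mem_nhds hy]
      with z hz
    have : z ∉ S.interval i := hz
    simp [localχ, this]

/-- The amplitude is smooth on the closed interval, and restricting $\chi$ to one interval keeps it
smooth, as the intervals are separated. Their product is smooth on the line with compact support. -/
theorem exists_isStableState {ħ : ℝ} (hħ : 0 < ħ) {w : ℤ → Fin S.N} (hw : S.Admissible w)
    (k : ℕ) : ∃ s : 𝓢(ℝ, ℂ), D.IsStableState ħ k w s := by
  set f : ℝ → ℂ := fun y => D.stableAmplitude ħ w y * (S.hcoord w y : ℂ) ^ k with hf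
  have h1 : ContDiffOn ℝ ∞ f (S.interval (w 0)) := by
    refine contDiffOn_infty.mpr fun n => ?_
    obtain ⟨A, -, hA⟩ := D.exists_hbound_stableAmplitude hħ (n + 1)
    obtain ⟨B, -, hB⟩ := exists_hbound_hcoord_pow S (n + 1) k
    exact ((hA ħ hħ le_rfl w hw).contDiffOn (S.uniqueDiffOn_interval _) hħ.ne').mul
      ((hB w hw).contDiffOn (S.uniqueDiffOn_interval _) one_ne_zero)
  have h0 : ∀ x, x ∉ Icc (S.lo (w 0)) (S.hi (w 0)) → D.localχ (w 0) x = 0 := fun x hx => by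
    have : x ∉ S.interval (w 0) := hx
    simp [localχ, this]
  have hts : tsupport (D.localχ (w 0)) ⊆ S.interval (w 0) := by
    refine closure_minimal ?_ isClosed_Icc
    intro y hy; by_contra h; exact hy (h0 y h)
  have h2 : ContDiff ℝ ∞ fun y => D.localχ (w 0) y * f y := contDiff_infty.mpr fun n =>
    CutComp.contDiff_cut (S.lo_lt_hi _) n (D.contDiff_localχ _) h0 fun x hx => h1 x (hts hx)
  have h3 : HasCompactSupport fun y => D.localχ (w 0) y * f y :=
    HasCompactSupport.intro (S.isCompact_interval (w 0)) fun y hy => by simp [h0 y hy]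
  refine ⟨h3.toSchwartzMap h2, fun y => ?_⟩
  change D.localχ (w 0) y * f y = _
  by_cases hy : y ∈ S.interval (w 0)
  · rw [D.conjInvTranspose_eq hw k hy]
    simp [localχ, hy, hf]
  · simp [localχ, conjInvTranspose, hy]

end TransferData

end

noncomputable section

open scoped FourierTransform ENNReal

/-! ### Taylor remainders -/

/-- The Taylor remainder of order `p` at `0` of a function with derivatives `F`. -/
def taylorRem (p : ℕ) (F : ℕ → ℝ → ℂ) (z : ℝ) : ℂ :=
  F 0 z - ∑ k ∈ Finset.range p, (k.factorial : ℂ)⁻¹ * F k 0 * (z : ℂ) ^ k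

theorem hasDerivWithinAt_taylorRem {Z : Set ℝ} {F : ℕ → ℝ → ℂ} {z : ℝ} (p : ℕ)
    (h : HasDerivWithinAt (F 0) (F 1 z) Z z) :
    HasDerivWithinAt (taylorRem (p + 1) F) (taylorRem p (fun i => F (i + 1)) z) Z z := by
  have e : taylorRem (p + 1) F = fun z => F 0 z - (∑ k ∈ Finset.range p,
      ((k + 1).factorial : ℂ)⁻¹ * F (k + 1) 0 * (z : ℂ) ^ (k + 1) +
        (Nat.factorial 0 : ℂ)⁻¹ * F 0 0 * (z : ℂ) ^ 0) := by
    funext z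
    rw [taylorRem, Finset.sum_range_succ']
  rw [e, taylorRem]
  refine h.sub ?_
  have h1 : HasDerivWithinAt (fun z : ℝ => (z : ℂ)) 1 Z z := (hasDerivWithinAt_id z Z).ofReal_comp
  have h2 : HasDerivWithinAt (fun z : ℝ => ∑ k ∈ Finset.range p,
      ((k + 1).factorial : ℂ)⁻¹ * F (k + 1) 0 * (z : ℂ) ^ (k + 1))
      (∑ k ∈ Finset.range p, (k.factorial : ℂ)⁻¹ * F (k + 1) 0 * (z : ℂ) ^ k) Z z := by
    refine HasDerivWithinAt.fun_sum fun k _ => ?_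
    refine ((h1.pow (k + 1)).const_mul _).congr_deriv ?_
    rw [Nat.factorial_succ]
    have h3 : ((k : ℂ) + 1) ≠ 0 := by exact_mod_cast Nat.succ_ne_zero k
    have h4 : (k.factorial : ℂ) ≠ 0 := by exact_mod_cast k.factorial_ne_zero
    push_cast
    field_simp
  simpa using h2.add_const ((Nat.factorial 0 : ℂ)⁻¹ * F 0 0 * (z : ℂ) ^ 0)

/-- Induction through the derivative of the remainder and the mean value inequality. The factorial
is given away, since only the power of $|z|$ matters. -/
theorem norm_taylorRem_le {Z : Set ℝ} (hZ : Convex ℝ Z) (h0 : (0 : ℝ) ∈ Z) {B : ℝ} (p : ℕ) :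
    ∀ {F : ℕ → ℝ → ℂ}, (∀ i < p, ∀ z ∈ Z, HasDerivWithinAt (F i) (F (i + 1) z) Z z) →
    (∀ z ∈ Z, ‖F p z‖ ≤ B) → ∀ z ∈ Z, ‖taylorRem p F z‖ ≤ |z| ^ p * B := by
  induction p with
  | zero => intro F _ hB z hz; simpa [taylorRem] using hB z hz
  | succ p ih =>
    intro F hF hB z hz
    have ih' := ih (F := fun i => F (i + 1)) (fun i hi => hF (i + 1) (by omega)) hB
    have hB0 : 0 ≤ B := (norm_nonneg _).trans (hB z hz)
    -- The mean value inequality is applied on the part of $Z$ with $|x|\le|z|$, where the bound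
    -- $|x|^pB$ is at most $|z|^pB$.
    have hd : ∀ x ∈ Z ∩ Icc (-|z|) |z|, HasDerivWithinAt (taylorRem (p + 1) F)
        (taylorRem p (fun i => F (i + 1)) x) (Z ∩ Icc (-|z|) |z|) x := fun x hx =>
      (hasDerivWithinAt_taylorRem p (hF 0 (by omega) x hx.1)).mono inter_subset_left
    have hb : ∀ x ∈ Z ∩ Icc (-|z|) |z|, ‖taylorRem p (fun i => F (i + 1)) x‖ ≤ |z| ^ p * B :=
      fun x hx => (ih' x hx.1).trans
        (mul_le_mul_of_nonneg_right (pow_le_pow_left₀ (abs_nonneg _) (abs_le.mpr hx.2) p) hB0)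
    have h00 : (0 : ℝ) ∈ Z ∩ Icc (-|z|) |z| := ⟨h0, by simp, abs_nonneg z⟩
    have hz' : z ∈ Z ∩ Icc (-|z|) |z| := ⟨hz, abs_le.mp le_rfl⟩
    have := (hZ.inter (convex_Icc _ _)).norm_image_sub_le_of_norm_hasDerivWithin_le hd hb h00 hz'
    have e0 : taylorRem (p + 1) F 0 = 0 := by
      rw [taylorRem, Finset.sum_range_succ']
      simp
    rw [e0, sub_zero, sub_zero, Real.norm_eq_abs] at this
    refine this.trans_eq ?_
    ring

/-- Differentiation lowers the order of the remainder by one. With truncated subtraction the tower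
continues beyond $p$, where the polynomial has disappeared and the remainder is the derivative
itself. -/
theorem hasDerivWithinAt_taylorRem_tower {Z : Set ℝ} {F : ℕ → ℝ → ℂ} (p : ℕ) {i : ℕ} {z : ℝ}
    (h : HasDerivWithinAt (F i) (F (i + 1) z) Z z) :
    HasDerivWithinAt (taylorRem (p - i) fun j => F (i + j))
      (taylorRem (p - (i + 1)) (fun j => F (i + 1 + j)) z) Z z := by
  by_cases hip : i < p
  · have e : p - i = p - (i + 1) + 1 := by omega
    have e2 : (fun j => F (i + 1 + j)) = fun j => F (i + (j + 1)) := by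
      funext j; congr 1; omega
    rw [e, e2]
    exact hasDerivWithinAt_taylorRem (F := fun j => F (i + j)) _ h
  · have e1 : p - i = 0 := by omega
    have e2 : p - (i + 1) = 0 := by omega
    have e3 : ∀ G : ℕ → ℝ → ℂ, taylorRem 0 G = G 0 := fun G => by
      funext x; simp [taylorRem]
    rw [e1, e2, e3, e3]
    exact h

/-! ### Sobolev norms of functions supported in an interval -/

theorem norm_semideriv_iterate_le {ħ : ℝ} {I : Set ℝ} (hI : UniqueDiffOn ℝ I)
    (hcl : IsClosed I) {M : ℕ} {b : ℝ → ℝ} {f : 𝓢(ℝ, ℂ)} (hf : ∀ y, y ∉ I → f y = 0)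
    (h : HBound ħ I M b f) {j : ℕ} (hj : j ≤ M) (y : ℝ) :
    ‖(semideriv ħ)^[j] f y‖ ≤ I.indicator b y := by
  rw [semideriv_iterate_apply]
  by_cases hy : y ∈ I
  · rw [indicator_of_mem hy, norm_mul, norm_pow, Complex.norm_real, Real.norm_eq_abs]
    have h1 := h.iteratedDerivWithin_le hI hj y hy
    rwa [iteratedDerivWithin_eq_iteratedDeriv hI ((f.smooth j).contDiffAt) hy] at h1
  · rw [indicator_of_notMem hy]
    have h0 : (f : ℝ → ℂ) =ᶠ[𝓝 y] fun _ => 0 := by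
      filter_upwards [hcl.isOpen_compl.mem_nhds hy] with z hz using hf z hz
    rw [(h0.iteratedDeriv j).eq_of_nhds, iteratedDeriv_const]
    simp

theorem sobolevENorm_le_of_hbound {ħ : ℝ} {I : Set ℝ} (hI : UniqueDiffOn ℝ I)
    (hcl : IsClosed I) {M : ℕ} {b : ℝ → ℝ} {f : 𝓢(ℝ, ℂ)} (hf : ∀ y, y ∉ I → f y = 0)
    (h : HBound ħ I M b f) :
    sobolevENorm ħ M f ≤ 2 ^ M * (2 * eLpNorm (I.indicator b) 2 volume) := by
  refine (sobolevENorm_natCast_le ħ M f).trans ?_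
  rw [two_mul]
  gcongr
  · exact eLpNorm_mono_real (norm_semideriv_iterate_le hI hcl hf h (Nat.zero_le M))
  · exact eLpNorm_mono_real (norm_semideriv_iterate_le hI hcl hf h le_rfl)

namespace IFS

variable {S : IFS}

theorem exists_sobolevENorm_le (S : IFS) (M : ℕ) : ∃ K : ℝ, 0 ≤ K ∧ ∀ (ħ : ℝ)
    (i : Fin S.N) (B : ℝ), 0 ≤ B → ∀ f : 𝓢(ℝ, ℂ), (∀ y, y ∉ S.interval i → f y = 0) →
    HBound ħ (S.interval i) M (fun _ => B) f → sobolevENorm ħ M f ≤ ENNReal.ofReal (K * B) := by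
  obtain ⟨ℓ, hℓ, hlen⟩ := S.exists_length_le
  refine ⟨2 ^ M * (2 * ℓ ^ (1 / 2 : ℝ)), by positivity, fun ħ i B hB f hf h => ?_⟩
  refine (sobolevENorm_le_of_hbound (S.uniqueDiffOn_interval i) isClosed_Icc hf h).trans ?_
  have h1 : eLpNorm ((S.interval i).indicator fun _ => B) 2 volume ≤
      ENNReal.ofReal (B * ℓ ^ (1 / 2 : ℝ)) := by
    refine (eLpNorm_indicator_const_le B 2).trans ?_
    rw [ENNReal.ofReal_mul hB, Real.enorm_eq_ofReal hB,
      ← ENNReal.ofReal_rpow_of_nonneg hℓ (by norm_num)]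
    have e : (2 : ℝ≥0∞).toReal = 2 := by simp
    rw [e]
    gcongr
    · rw [interval, Real.volume_Icc]
      refine ENNReal.ofReal_le_ofReal ((le_abs_self _).trans (hlen i _ ?_ _ ?_))
      · exact right_mem_Icc.mpr (S.lo_lt_hi i).le
      · exact left_mem_Icc.mpr (S.lo_lt_hi i).le
  calc _ ≤ 2 ^ M * (2 * ENNReal.ofReal (B * ℓ ^ (1 / 2 : ℝ))) := by gcongr
    _ = _ := by
      rw [show (2 : ℝ≥0∞) = ENNReal.ofReal 2 by simp, ← ENNReal.ofReal_pow (by norm_num),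
        ← ENNReal.ofReal_mul (by norm_num), ← ENNReal.ofReal_mul (by norm_num)]
      congr 1
      ring

/-- Change of variables along a branch. -/
theorem exists_eLpNorm_comp_branch_le (S : IFS) : ∃ C : ℝ, 0 ≤ C ∧ ∀ w, S.Admissible w →
    ∀ (n : ℕ) (g : ℝ → ℂ),
    eLpNorm ((S.interval (w 0)).indicator fun y => g (S.branch w n y)) 2 volume ≤
      ENNReal.ofReal (C * Real.exp (S.birkhoff S.J n w / 2)) * eLpNorm g 2 volume := by
  obtain ⟨C, hC, h⟩ := TransferData.exists_hbound_slope S 0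
  refine ⟨Real.sqrt C, Real.sqrt_nonneg C, fun w hw n g => ?_⟩
  have sq : ∀ (f : ℝ → ℂ) (μ : Measure ℝ), eLpNorm f 2 μ ^ 2 = ∫⁻ x, ‖f x‖ₑ ^ 2 ∂μ := fun f μ => by
    have h := eLpNorm_nnreal_pow_eq_lintegral (μ := μ) (p := 2) (f := f) (by norm_num)
    simpa only [NNReal.coe_ofNat, ENNReal.rpow_ofNat, ENNReal.coe_ofNat] using h
  have hm : MeasurableSet (S.interval (w 0)) := measurableSet_Icc
  rw [← ENNReal.pow_le_pow_left_iff two_ne_zero, mul_pow,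
    eLpNorm_indicator_eq_eLpNorm_restrict hm, sq, sq, ← ENNReal.ofReal_pow (by positivity),
    mul_pow, Real.sq_sqrt hC, ← Real.exp_nat_mul]
  have e1 : ((2 : ℕ) : ℝ) * (S.birkhoff S.J n w / 2) = S.birkhoff S.J n w := by push_cast; ring
  rw [e1]
  calc ∫⁻ y in S.interval (w 0), ‖g (S.branch w n y)‖ₑ ^ 2
      ≤ ∫⁻ y in S.interval (w 0), ENNReal.ofReal (C * Real.exp (S.birkhoff S.J n w)) *
        (ENNReal.ofReal |S.dbranch w n y| * ‖g (S.branch w n y)‖ₑ ^ 2) := by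
        refine setLIntegral_mono' hm fun y hy => ?_
        rw [← mul_assoc, ← ENNReal.ofReal_mul (by positivity)]
        refine le_mul_of_one_le_left (by positivity) ?_
        rw [ENNReal.one_le_ofReal, abs_of_pos (dbranch_pos hw n hy)]
        have h1 := (h w hw n).2 y hy
        have h2 := TransferData.slope_pos hw n hy
        rw [inv_le_iff_one_le_mul₀ h2, TransferData.slope] at h1
        linarith
    _ = ENNReal.ofReal (C * Real.exp (S.birkhoff S.J n w)) *
        ∫⁻ x in S.branch w n '' S.interval (w 0), ‖g x‖ₑ ^ 2 := by
        rw [lintegral_const_mul' _ _ ENNReal.ofReal_ne_top,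
          lintegral_image_eq_lintegral_abs_deriv_mul hm
            (fun y hy => hasDerivWithinAt_branch hw n hy) (strictMonoOn_branch hw n).injOn]
    _ ≤ _ := mul_le_mul_right (setLIntegral_le_lintegral _ _) _

theorem birkhoff_J_nonneg {w : ℤ → Fin S.N} (hw : S.Admissible w) (n : ℕ) :
    0 ≤ S.birkhoff S.J n w := by
  have h1 := exp_neg_birkhoff_J hw n
  have h2 : S.dbranch w n (S.point w) ≤ 1 := (dbranch_le hw n (point_mem hw)).trans
    (pow_le_one₀ S.rate_pos.le S.rate_lt_one.le)
  rw [← h1, Real.exp_le_one_iff] at h2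
  linarith

/-- Needed for the words too short for the normal form: over a bounded number of steps the expansion
is bounded. -/
theorem exists_exp_birkhoff_J_le (S : IFS) (q : ℕ) : ∃ κ : ℝ, 1 ≤ κ ∧ ∀ w, S.Admissible w →
    ∀ n ≤ q, Real.exp (S.birkhoff S.J n w) ≤ κ := by
  obtain ⟨B, hB, h⟩ := exists_hbound_comp_branch (n := 0) (S.exists_hbound_dbranch_const _)
    (F := fun i j y => (S.J (S.φ i j y) : ℂ)) edgeSmooth_J
  refine ⟨Real.exp (q * B), Real.one_le_exp (by positivity), fun w hw n hn => ?_⟩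
  rw [Real.exp_le_exp, birkhoff_eq]
  refine (Finset.sum_le_card_nsmul (Finset.range n) _ B fun k _ => ?_).trans ?_
  · have := h w hw k _ (point_mem hw)
    rw [Complex.norm_real] at this
    exact (le_abs_self _).trans this
  · rw [Finset.card_range, nsmul_eq_mul]
    gcongr

end IFS

end

/-! ### Sobolev bounds for the operator of one word. -/

noncomputable section

open scoped FourierTransform ENNReal

theorem MeasureTheory.eLpNorm_indicator_sum_le {I : Set ℝ} (hI : MeasurableSet I) {n : ℕ}
    {c : ℕ → ℝ} (hc : ∀ i, 0 ≤ c i) {g : ℕ → ℝ → ℂ} (hg : ∀ i, ContinuousOn (g i) I) :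
    eLpNorm (I.indicator fun y => ∑ i ∈ Finset.range n, c i * ‖g i y‖) 2 volume ≤
      ∑ i ∈ Finset.range n, ENNReal.ofReal (c i) * eLpNorm (I.indicator (g i)) 2 volume := by
  have hm : ∀ i, AEStronglyMeasurable (I.indicator (g i)) volume := fun i =>
    (aestronglyMeasurable_indicator_iff hI).mpr ((hg i).aestronglyMeasurable hI)
  have e : (I.indicator fun y => ∑ i ∈ Finset.range n, c i * ‖g i y‖) =
      ∑ i ∈ Finset.range n, fun y => ‖(c i • I.indicator (g i)) y‖ := by
    funext y
    rw [Finset.sum_apply]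
    by_cases hy : y ∈ I
    · simp only [indicator_of_mem hy, Pi.smul_apply, norm_smul, Real.norm_eq_abs,
        abs_of_nonneg (hc _)]
    · simp [indicator_of_notMem hy]
  rw [e]
  refine (eLpNorm_sum_le (fun i _ => ((hm i).const_smul (c i)).norm) (by norm_num)).trans ?_
  refine Finset.sum_le_sum fun i _ => ?_
  rw [eLpNorm_norm, eLpNorm_const_smul, Real.enorm_eq_ofReal (hc i)]

namespace TransferData

open IFS

variable {S : IFS} (D : TransferData S)

/-- Leibniz and chain rules: every derivative that falls on $\psi\circ\phi_w$ brings the contraction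
$e^{-J_w}$, hence the powers in the sum. Negative orders of decay in $\hbar$ do not occur, because
all derivatives are semiclassical. -/
theorem exists_sobolevENorm_wordTransfer_le {ħ₀ : ℝ} (hħ₀ : 0 < ħ₀) (M : ℕ) :
    ∃ C : ℝ, 0 ≤ C ∧ ∀ ħ : ℝ, 0 < ħ → ħ ≤ ħ₀ → ∀ w, S.Admissible w → ∀ n, 1 ≤ n →
    ∀ ψ : 𝓢(ℝ, ℂ), sobolevENorm ħ M (D.wordTransfer ħ w n ψ) ≤
      ENNReal.ofReal (C * (‖D.wordFactor ħ w n‖ * Real.exp (-S.birkhoff S.J n w / 2))) *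
      ∑ i ∈ Finset.range (M + 1), ENNReal.ofReal (Real.exp (-S.birkhoff S.J n w) ^ i) *
        sobolevENorm ħ i ψ := by
  obtain ⟨A, hA, hAb⟩ := D.exists_hbound_amplitude hħ₀ M
  obtain ⟨B, hB, hBb⟩ := exists_hbound_slope S (M - 1)
  obtain ⟨K, hK, hKb⟩ := S.exists_eLpNorm_comp_branch_le
  set B' := max ħ₀ 1 ^ (M - 1) * B with hB'
  have hB'0 : 0 ≤ B' := by positivity
  set E := 2 ^ M * A * (1 + 2 ^ M * B') ^ M with hE
  have hE0 : 0 ≤ E := by positivity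
  refine ⟨2 ^ M * (2 * (E * K)), by positivity, fun ħ hħ hħ0 w hw n hn ψ => ?_⟩
  set r := Real.exp (-S.birkhoff S.J n w) with hr
  have hr0 : 0 < r := Real.exp_pos _
  set F := D.wordFactor ħ w n with hF
  have hcomp : HBound ħ (S.interval (w 0)) M (fun y => (1 + 2 ^ M * B') ^ M *
      ∑ i ∈ Finset.range (M + 1), (r * ħ) ^ i * ‖iteratedDeriv i ψ (S.branch w n y)‖)
      fun y => ψ (S.branch w n y) := by
    have := HBound.comp hħ.le hr0.le hB'0 (φ := S.branch w n) (q := slope S w n)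
      (mapsTo_univ _ (S.interval (w 0))) (fun y hy => by
        have := hasDerivWithinAt_branch hw n hy
        rwa [dbranch_eq] at this) (n := M) (F := fun i => iteratedDeriv i ψ) (fun i _ z _ => ?_)
      (HBound.rescale hħ.le (hħ0.trans (le_max_left ħ₀ 1)) (le_max_right _ _) hB (hBb w hw n).1)
    · simpa only [iteratedDeriv_zero] using this
    · have h1 : Differentiable ℝ (iteratedDeriv i ψ) :=
        (ψ.smooth (i + 1)).differentiable_iteratedDeriv i (by exact_mod_cast Nat.lt_succ_self i)
      rw [iteratedDeriv_succ]
      exact (h1 z).hasDerivAt.hasDerivWithinAt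
  have hf : HBound ħ (S.interval (w 0)) M (fun y => ∑ i ∈ Finset.range (M + 1),
      (‖F‖ * r * E * r ^ i) * ‖(semideriv ħ)^[i] ψ (S.branch w n y)‖)
      (D.wordTransfer ħ w n ψ) := by
    refine (((HBound.mul hA hcomp (hAb ħ hħ hħ0 w hw n hn)).const_mul (F * (r : ℂ))).congr
      fun y hy => ?_).mono fun y hy => le_of_eq ?_
    · rw [D.wordTransfer_eq hw ψ hn hy]
      ring
    · rw [norm_mul, Complex.norm_real, Real.norm_eq_abs, abs_of_pos hr0, Finset.mul_sum,
        Finset.mul_sum, Finset.mul_sum]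
      refine Finset.sum_congr rfl fun i _ => ?_
      rw [semideriv_iterate_apply, norm_mul, norm_pow, Complex.norm_real, Real.norm_eq_abs,
        abs_of_pos hħ, hE]
      ring
  refine (sobolevENorm_le_of_hbound (S.uniqueDiffOn_interval _) isClosed_Icc
    (fun y hy => D.wordTransfer_eq_zero ψ hn hy) hf).trans ?_
  have h2 := eLpNorm_indicator_sum_le (I := S.interval (w 0)) measurableSet_Icc (n := M + 1)
    (c := fun i => ‖F‖ * r * E * r ^ i) (fun i => by positivity)
    (g := fun i y => (semideriv ħ)^[i] ψ (S.branch w n y)) (fun i =>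
      ((semideriv ħ)^[i] ψ).continuous.comp_continuousOn (contDiffOn_branch hw n).continuousOn)
  have h3 : ∀ i, eLpNorm ((S.interval (w 0)).indicator fun y =>
      (semideriv ħ)^[i] ψ (S.branch w n y)) 2 volume ≤
      ENNReal.ofReal (K * Real.exp (S.birkhoff S.J n w / 2)) * sobolevENorm ħ i ψ := fun i =>
    (hKb w hw n fun x => (semideriv ħ)^[i] ψ x).trans
      (mul_le_mul_right (eLpNorm_semideriv_iterate_le ħ ψ i) _)
  calc _ ≤ 2 ^ M * (2 * ∑ i ∈ Finset.range (M + 1), ENNReal.ofReal (‖F‖ * r * E * r ^ i) *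
        (ENNReal.ofReal (K * Real.exp (S.birkhoff S.J n w / 2)) * sobolevENorm ħ i ψ)) := by
        gcongr
        exact h2.trans (Finset.sum_le_sum fun i _ => mul_le_mul_right (h3 i) _)
    _ = _ := by
        rw [show (2 : ℝ≥0∞) = ENNReal.ofReal 2 by simp, ← ENNReal.ofReal_pow (by norm_num),
          Finset.mul_sum, Finset.mul_sum, Finset.mul_sum]
        refine Finset.sum_congr rfl fun i _ => ?_
        rw [← mul_assoc, ← mul_assoc, ← mul_assoc, ← mul_assoc,
          ← ENNReal.ofReal_mul (by positivity), ← ENNReal.ofReal_mul (by positivity),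
          ← ENNReal.ofReal_mul (by positivity),
          ← mul_assoc (ENNReal.ofReal _) (ENNReal.ofReal _) (sobolevENorm ħ i ψ),
          ← ENNReal.ofReal_mul (by positivity)]
        congr 2
        -- The prefactor is $e^{-J_w}$ and the change of variables in $L^2$ costs $e^{J_w/2}$.
        have e : Real.exp (-S.birkhoff S.J n w / 2) = r * Real.exp (S.birkhoff S.J n w / 2) := by
          rw [hr, ← Real.exp_add]; congr 1; ring
        rw [e]
        ring

/-- The contribution of a word on high frequencies. -/
theorem exists_wordTransfer_high_le {ħ₀ : ℝ} (hħ₀ : 0 < ħ₀) {m : ℝ} (hm : 0 < m) :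
    ∃ C : ℝ, 0 ≤ C ∧ ∀ ħ : ℝ, 0 < ħ → ħ ≤ ħ₀ → ∀ w, S.Admissible w → ∀ n, 1 ≤ n →
    ∀ L : ℝ, 0 < L → L ≤ Real.exp (S.birkhoff S.J n w) →
    ∀ ψ : 𝓢(ℝ, ℂ), (∀ η, bracket ħ η < L → 𝓕⁻ ψ η = 0) →
    sobolevENorm ħ m (D.wordTransfer ħ w n ψ) ≤
      ENNReal.ofReal (C * (‖D.wordFactor ħ w n‖ * Real.exp (-S.birkhoff S.J n w / 2)) *
        L ^ (-m)) * sobolevENorm ħ m ψ := by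
  obtain ⟨M, hM⟩ := exists_nat_gt m
  obtain ⟨C₀, hC₀, h₀⟩ := D.exists_sobolevENorm_wordTransfer_le hħ₀ 0
  obtain ⟨C₁, hC₁, h₁⟩ := D.exists_sobolevENorm_wordTransfer_le hħ₀ M
  obtain ⟨K, hK, hint⟩ := exists_interpolation m M hm hM
  set C := max C₀ (C₁ * (M + 1)) with hC
  have hC0 : 0 ≤ C := hC₀.trans (le_max_left _ _)
  refine ⟨C * K, by positivity, fun ħ hħ hħ0 w hw n hn L hL hLJ ψ hψ => ?_⟩
  set G := ‖D.wordFactor ħ w n‖ * Real.exp (-S.birkhoff S.J n w / 2) with hG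
  have hG0 : 0 ≤ G := by positivity
  set r := Real.exp (-S.birkhoff S.J n w) with hr
  have hrL : r * L ≤ 1 := by
    calc r * L ≤ r * Real.exp (S.birkhoff S.J n w) := by gcongr
      _ = 1 := by rw [hr, ← Real.exp_add, neg_add_cancel, Real.exp_zero]
  have := hint ħ hħ L hL (ENNReal.ofReal (C * G)) (D.wordTransfer ħ w n)
    (fun ψ φ => map_add _ ψ φ) (fun ψ _ => ?_) (fun ψ hψ => ?_) ψ hψ
  · refine this.trans_eq ?_
    rw [← ENNReal.ofReal_mul (by positivity)]
    congr 2
    ring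
  -- The end point $L^2$, obtained from the same estimate with no derivatives.
  · have := h₀ ħ hħ hħ0 w hw n hn ψ
    simp only [zero_add, Finset.range_one, Finset.sum_singleton, pow_zero, ENNReal.ofReal_one,
      one_mul, Nat.cast_zero] at this
    refine this.trans ?_
    gcongr
    exact le_max_left _ _
  · refine (h₁ ħ hħ hħ0 w hw n hn ψ).trans ?_
    -- The end point of order $M$: on frequencies at least $L$ the $H_\hbar^i$ norm gains $L^{i-M}$,
    -- and $r^iL^i\le1$ because $L\le r^{-1}$.
    have h2 : ∀ i ∈ Finset.range (M + 1), ENNReal.ofReal (r ^ i) * sobolevENorm ħ i ψ ≤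
        ENNReal.ofReal (L ^ (-(M : ℝ))) * sobolevENorm ħ M ψ := fun i hi => by
      have hiM : i ≤ M := by simpa [Nat.lt_succ_iff] using hi
      refine (mul_le_mul_right (sobolevENorm_le_of_high hL
        (by exact_mod_cast hiM : (i : ℝ) ≤ M) hψ) _).trans ?_
      rw [← mul_assoc, ← ENNReal.ofReal_mul (by positivity)]
      gcongr
      rw [sub_eq_add_neg, Real.rpow_add hL, Real.rpow_natCast, ← mul_assoc, ← mul_pow]
      exact mul_le_of_le_one_left (by positivity) (pow_le_one₀ (by positivity) hrL)
    refine (mul_le_mul_right (Finset.sum_le_card_nsmul _ _ _ h2) _).trans ?_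
    rw [Finset.card_range, nsmul_eq_mul, ← mul_assoc, ← mul_assoc, ← ENNReal.ofReal_natCast,
      ← ENNReal.ofReal_mul (by positivity)]
    have h3 : C₁ * G * ((M + 1 : ℕ) : ℝ) ≤ C * G := by
      push_cast
      calc C₁ * G * (M + 1) = C₁ * (M + 1) * G := by ring
        _ ≤ C * G := by gcongr; exact le_max_right _ _
    exact mul_le_mul_left (mul_le_mul_left (ENNReal.ofReal_le_ofReal h3) _) _

end TransferData

end

/-! ### Taylor expansion of one word in normal form. -/

noncomputable section

open scoped FourierTransform ENNReal

theorem wienerENorm_ne_top {ħ : ℝ} (hħ : 0 < ħ) (s : ℝ) (ψ : 𝓢(ℝ, ℂ)) :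
    wienerENorm ħ s ψ ≠ ⊤ := by
  obtain ⟨C, -, h⟩ := exists_wienerENorm_le s (s + 1) (by norm_num)
  exact ((h ħ hħ ψ).trans_lt
    (ENNReal.mul_lt_top ENNReal.ofReal_lt_top (sobolevENorm_lt_top _ _ _))).ne

/-- Taylor remainders in rescaled coordinates: the powers of the scale `r` gained from the order
`p` of vanishing compensate derivatives of order at most `p`, and the derivatives of higher order
may grow at the rate `r⁻¹`. -/
theorem HBound.taylorRem_comp {ħ r A B K X : ℝ} {I Z : Set ℝ} {p M : ℕ} (hħ : 0 < ħ) (hK : ħ ≤ K)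
    (hK1 : 1 ≤ K) (hr : 0 < r) (hA : 1 ≤ A) (hB : 0 ≤ B) (hX : 0 ≤ X)
    (hZ : Convex ℝ Z) (h0 : (0 : ℝ) ∈ Z) {G : ℕ → ℝ → ℂ}
    (hG : ∀ i < M + p, ∀ z ∈ Z, HasDerivWithinAt (G i) (G (i + 1) z) Z z)
    (hGb : ∀ i ≤ M + p, ∀ z ∈ Z, ħ ^ i * ‖G i z‖ ≤ X * r⁻¹ ^ (i - p))
    {φ q : ℝ → ℝ} (hφ : MapsTo φ I Z) (hd : ∀ y ∈ I, HasDerivWithinAt φ (r * q y) I y)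
    (hφr : ∀ y ∈ I, |φ y| ≤ r * A) (hq : HBound ħ I (M - 1) (fun _ => B) fun y => (q y : ℂ)) :
    HBound ħ I M (fun _ => (1 + 2 ^ M * B) ^ M * ((M + 1) * (r ^ p * (A * (K / ħ)) ^ p * X)))
      fun y => taylorRem p G (φ y) := by
  have hKħ : 1 ≤ K / ħ := (one_le_div hħ).mpr hK
  have key := HBound.comp hħ.le hr.le hB hφ hd (n := M)
    (F := fun i => taylorRem (p - i) fun j => G (i + j))
    (fun i hi z hz => hasDerivWithinAt_taylorRem_tower p (hG i (by omega) z hz)) hq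
  have e : taylorRem (p - 0) (fun j => G (0 + j)) = taylorRem p G := by simp
  simp only [e] at key
  refine key.mono fun y hy => ?_
  refine mul_le_mul_of_nonneg_left ?_ (by positivity)
  have hz := hφ hy
  have h1 : ∀ i ∈ Finset.range (M + 1), (r * ħ) ^ i *
      ‖taylorRem (p - i) (fun j => G (i + j)) (φ y)‖ ≤ r ^ p * (A * (K / ħ)) ^ p * X := by
    intro i hi
    have hiM : i ≤ M := by simpa [Nat.lt_succ_iff] using hi
    -- Below order $p$ the chain rule gives $r^i$ and the vanishing of the remainder gives
    -- $|\varphi(y)|^{p-i}\lesssim r^{p-i}$, together $r^p$. The price is $\hbar^{-p}$, because the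
    -- bound on $G_p$ is semiclassical.
    by_cases hip : i < p
    · have hp : i + (p - i) = p := by omega
      have h2 := norm_taylorRem_le hZ h0 (F := fun j => G (i + j)) (B := X * (ħ ^ p)⁻¹) (p - i)
        (fun j hj z hz => hG (i + j) (by omega) z hz) (fun z hz => by
          have := hGb p (by omega) z hz
          rw [Nat.sub_self, pow_zero, mul_one] at this
          rw [hp, ← div_eq_mul_inv, le_div_iff₀ (by positivity)]
          linarith) _ hz
      have h3 : |φ y| ^ (p - i) ≤ r ^ (p - i) * A ^ p :=
        calc |φ y| ^ (p - i) ≤ (r * A) ^ (p - i) :=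
              pow_le_pow_left₀ (abs_nonneg _) (hφr y hy) _
          _ = r ^ (p - i) * A ^ (p - i) := mul_pow _ _ _
          _ ≤ r ^ (p - i) * A ^ p := by gcongr; omega
      have h4 : ħ ^ i ≤ K ^ p := (pow_le_pow_left₀ hħ.le hK i).trans
        (pow_le_pow_right₀ hK1 hip.le)
      calc _ ≤ (r * ħ) ^ i * (r ^ (p - i) * A ^ p * (X * (ħ ^ p)⁻¹)) := by
            refine mul_le_mul_of_nonneg_left (h2.trans ?_) (by positivity)
            gcongr
        _ = ħ ^ i * (r ^ (i + (p - i)) * A ^ p * X * (ħ ^ p)⁻¹) := by rw [pow_add]; ring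
        _ ≤ K ^ p * (r ^ p * A ^ p * X * (ħ ^ p)⁻¹) := by rw [hp]; gcongr
        _ = _ := by rw [mul_pow, div_pow]; ring
    -- From order $p$ on there is no polynomial left, and the permitted growth $r^{-(i-p)}$ leaves
    -- $r^p$ out of $r^i$.
    · have hp0 : p - i = 0 := by omega
      have hp : i = p + (i - p) := by omega
      have h2 : taylorRem (p - i) (fun j => G (i + j)) (φ y) = G i (φ y) := by
        simp [hp0, taylorRem]
      rw [h2, mul_pow, mul_assoc]
      calc r ^ i * (ħ ^ i * ‖G i (φ y)‖) ≤ r ^ i * (X * r⁻¹ ^ (i - p)) := by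
            exact mul_le_mul_of_nonneg_left (hGb i (by omega) _ hz) (by positivity)
        _ = r ^ p * 1 ^ p * X := by
            rw [show r ^ i = r ^ p * r ^ (i - p) by rw [← pow_add, ← hp], inv_pow]
            field_simp
            simp
        _ ≤ _ := by gcongr; exact one_le_mul_of_one_le_of_one_le hA hKħ
  refine (Finset.sum_le_card_nsmul _ _ _ h1).trans_eq ?_
  rw [Finset.card_range, nsmul_eq_mul]
  push_cast
  ring

namespace TransferData

open IFS

variable {S : IFS} (D : TransferData S)

theorem exists_norm_iteratedDerivWithin_conjugated_le {ħ₀ : ℝ} (hħ₀ : 0 < ħ₀) (N : ℕ) :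
    ∃ C : ℝ, 0 ≤ C ∧ ∀ ħ : ℝ, 0 < ħ → ħ ≤ ħ₀ → ∀ w, S.Admissible w → ∀ ψ : 𝓢(ℝ, ℂ),
    ∀ j ≤ N, ∀ z ∈ D.stateSet w, ħ ^ j *
      ‖iteratedDerivWithin j (D.conjugated ħ w ψ) (D.stateSet w) z‖ ≤
      C * (wienerENorm ħ j ψ).toReal := by
  choose C hC h using fun j => D.exists_hbound_conjugated hħ₀ j
  refine ⟨∑ j ∈ Finset.range (N + 1), C j * (j + 1),
    Finset.sum_nonneg fun j _ => mul_nonneg (hC j) (by positivity),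
    fun ħ hħ hħ0 w hw ψ j hj z hz => ?_⟩
  have h1 := (h j ħ hħ hħ0 w hw ψ).iteratedDerivWithin_le (D.uniqueDiffOn_stateSet hw) le_rfl z hz
  rw [abs_of_pos hħ] at h1
  refine h1.trans ?_
  have h2 : ∑ i ∈ Finset.range (j + 1), ħ ^ i * ‖iteratedDeriv i ψ (S.hinverse w z)‖ ≤
      (j + 1) * (wienerENorm ħ j ψ).toReal := by
    refine (Finset.sum_le_card_nsmul _ _ (wienerENorm ħ j ψ).toReal fun i hi => ?_).trans_eq ?_
    · rw [← ENNReal.ofReal_le_iff_le_toReal (wienerENorm_ne_top hħ _ _)]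
      exact ofReal_pow_mul_norm_iteratedDeriv_le hħ
        (by simpa [Nat.lt_succ_iff] using hi) ψ _
    · rw [Finset.card_range, nsmul_eq_mul]
      push_cast
      ring
  calc _ ≤ C j * ((j + 1) * (wienerENorm ħ j ψ).toReal) := mul_le_mul_of_nonneg_left h2 (hC j)
    _ = C j * (j + 1) * (wienerENorm ħ j ψ).toReal := by ring
    _ ≤ _ := by
      gcongr
      exact Finset.single_le_sum (f := fun j => C j * ((j : ℝ) + 1))
        (fun j _ => mul_nonneg (hC j) (by positivity)) (by simpa [Nat.lt_succ_iff] using hj)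

/-- The normal form of the contribution of a word. -/
theorem wordTransfer_eq_conjugated {ħ : ℝ} {w : ℤ → Fin S.N} (hw : S.Admissible w) (ψ : 𝓢(ℝ, ℂ))
    {n : ℕ} (hn : D.a + 1 ≤ n) {y : ℝ} (hy : y ∈ S.interval (w 0)) :
    D.wordTransfer ħ w n ψ y = D.wordFactor ħ w n *
      ((Real.exp (-S.birkhoff S.J n w) : ℝ) : ℂ) * ((D.χ y * D.stableAmplitude ħ w y) *
        D.conjugated ħ (shift w n) ψ (Real.exp (-S.birkhoff S.J n w) * S.hcoord w y)) := by
  have hw' := hw.shift n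
  have hy' : S.branch w n y ∈ S.interval (shift w n 0) := by simpa using mapsTo_branch hw n hy
  rw [D.wordTransfer_eq hw ψ (by omega) hy, ← hcoord_branch hw hy n,
    D.conjugated_eq hw' ψ ⟨_, hy', rfl⟩, hinverse_hcoord hw' hy', amplitude, stableAmplitude,
    D.upsilon_eq hw, D.upsilon_eq hw', cocycle_branch hw hy (D.edgeSmooth_phase ħ) n,
    hderiv_branch hw hy n, ratio, slope, mul_add, Complex.exp_add, Complex.exp_neg]
  have h1 : (S.hderiv (shift w n) (S.branch w n y) : ℂ) ≠ 0 := by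
    exact_mod_cast (hderiv_pos _ _).ne'
  have h2 := Complex.exp_ne_zero (Complex.I / ħ * S.cocycle (D.phase ħ) w y)
  push_cast
  field_simp

/-- The contribution of a word to the remainder of the expansion, on test functions. -/
def wordRemainder (ħ : ℝ) (n d : ℕ) (U : ℕ → (ℤ → Fin S.N) → 𝓢'(ℝ, ℂ))
    (s : ℕ → (ℤ → Fin S.N) → 𝓢(ℝ, ℂ)) (w : ℤ → Fin S.N) (ψ : 𝓢(ℝ, ℂ)) : 𝓢(ℝ, ℂ) :=
  D.wordTransfer ħ w n ψ - D.wordFactor ħ w n • ∑ k ∈ Finset.range (d + 1),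
    ((Real.exp (-((k : ℝ) + 1) * S.birkhoff S.J n w) : ℝ) : ℂ) • U k (shift w n) ψ • s k w

section remainder

variable {ħ : ℝ} {d : ℕ} {U : ℕ → (ℤ → Fin S.N) → 𝓢'(ℝ, ℂ)} {s : ℕ → (ℤ → Fin S.N) → 𝓢(ℝ, ℂ)}

theorem wordRemainder_add (n : ℕ) (w : ℤ → Fin S.N) (ψ φ : 𝓢(ℝ, ℂ)) :
    D.wordRemainder ħ n d U s w (ψ + φ) =
      D.wordRemainder ħ n d U s w ψ + D.wordRemainder ħ n d U s w φ := by
  simp only [wordRemainder, map_add, add_smul, smul_add, Finset.sum_add_distrib]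
  abel

theorem wordRemainder_eq_zero (hs : ∀ k ≤ d, ∀ w, S.Admissible w → D.IsStableState ħ k w (s k w))
    {w : ℤ → Fin S.N} (hw : S.Admissible w) {n : ℕ} (hn : 1 ≤ n) (ψ : 𝓢(ℝ, ℂ)) {y : ℝ}
    (hy : y ∉ S.interval (w 0)) : D.wordRemainder ħ n d U s w ψ y = 0 := by
  have h1 : ∀ k ∈ Finset.range (d + 1), s k w y = 0 := fun k hk => by
    rw [hs k (by simpa [Nat.lt_succ_iff] using hk) w hw y, conjInvTranspose, if_neg hy, mul_zero]
  simp only [wordRemainder, sub_apply, smul_apply, sum_apply,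
    D.wordTransfer_eq_zero ψ hn hy]
  rw [Finset.sum_eq_zero fun k hk => by rw [h1 k hk]; simp]
  simp

/-- The remainder is a Taylor remainder in the normal form coordinates. -/
theorem wordRemainder_eq_taylorRem
    (hU : ∀ k ≤ d, ∀ w, S.Admissible w → D.IsUnstableState ħ k w (U k w))
    (hs : ∀ k ≤ d, ∀ w, S.Admissible w → D.IsStableState ħ k w (s k w))
    {w : ℤ → Fin S.N} (hw : S.Admissible w) {n : ℕ} (hn : D.a + 1 ≤ n) (ψ : 𝓢(ℝ, ℂ)) {y : ℝ}
    (hy : y ∈ S.interval (w 0)) : D.wordRemainder ħ n d U s w ψ y = D.wordFactor ħ w n *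
      ((Real.exp (-S.birkhoff S.J n w) : ℝ) : ℂ) * ((D.χ y * D.stableAmplitude ħ w y) *
        taylorRem (d + 1) (fun i => iteratedDerivWithin i (D.conjugated ħ (shift w n) ψ)
          (D.stateSet (shift w n))) (Real.exp (-S.birkhoff S.J n w) * S.hcoord w y)) := by
  have hw' := hw.shift n
  simp only [wordRemainder, sub_apply, smul_apply, sum_apply,
    smul_eq_mul]
  rw [D.wordTransfer_eq_conjugated hw ψ hn hy, taylorRem, iteratedDerivWithin_zero]
  have h1 : ∀ k ∈ Finset.range (d + 1),
      ((Real.exp (-((k : ℝ) + 1) * S.birkhoff S.J n w) : ℝ) : ℂ) *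
        (U k (shift w n) ψ * s k w y) =
      ((Real.exp (-S.birkhoff S.J n w) : ℝ) : ℂ) * (D.χ y * D.stableAmplitude ħ w y) *
      ((k.factorial : ℂ)⁻¹ * iteratedDerivWithin k (D.conjugated ħ (shift w n) ψ)
          (D.stateSet (shift w n)) 0 *
        ((Real.exp (-S.birkhoff S.J n w) * S.hcoord w y : ℝ) : ℂ) ^ k) := fun k hk => by
    have hkd : k ≤ d := by simpa [Nat.lt_succ_iff] using hk
    rw [D.isUnstableState_iff.mp (hU k hkd _ hw') ψ, hs k hkd w hw y,
      D.conjInvTranspose_eq hw k hy, iteratedDerivWithin_of_mem_nhds (D.stateSet_mem_nhds hw')]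
    have e : Real.exp (-((k : ℝ) + 1) * S.birkhoff S.J n w) =
        Real.exp (-S.birkhoff S.J n w) * Real.exp (-S.birkhoff S.J n w) ^ k := by
      rw [← Real.exp_nat_mul, ← Real.exp_add]; congr 1; ring
    rw [e]
    push_cast
    ring
  rw [Finset.sum_congr rfl h1, ← Finset.mul_sum]
  ring

end remainder

end TransferData

end

/-! ### The remainder on low frequencies. -/

noncomputable section

open scoped FourierTransform ENNReal

namespace TransferData

open IFS

variable {S : IFS} (D : TransferData S)

/-- Taylor expansion in the normal form coordinates, on low frequencies. -/
theorem exists_hbound_wordRemainder_low {ħ₀ : ℝ} (hħ₀ : 0 < ħ₀) (d M : ℕ) : ∃ C : ℝ, 0 ≤ C ∧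
    ∀ ħ : ℝ, 0 < ħ → ħ ≤ ħ₀ → ∀ (U : ℕ → (ℤ → Fin S.N) → 𝓢'(ℝ, ℂ))
    (s : ℕ → (ℤ → Fin S.N) → 𝓢(ℝ, ℂ)),
    (∀ k ≤ d, ∀ w, S.Admissible w → D.IsUnstableState ħ k w (U k w)) →
    (∀ k ≤ d, ∀ w, S.Admissible w → D.IsStableState ħ k w (s k w)) →
    ∀ w, S.Admissible w → ∀ n, D.a + 1 ≤ n → ∀ ψ : 𝓢(ℝ, ℂ),
    (∀ η, 3 * Real.exp (S.birkhoff S.J n w) < bracket ħ η → 𝓕⁻ ψ η = 0) →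
    HBound ħ (S.interval (w 0)) M (fun _ => C * (‖D.wordFactor ħ w n‖ *
      Real.exp (-S.birkhoff S.J n w) ^ (d + 2)) * (ħ ^ (d + 1))⁻¹ *
      (wienerENorm ħ (d + 1 : ℕ) ψ).toReal) (D.wordRemainder ħ n d U s w ψ) := by
  obtain ⟨E, hE, hEb⟩ := D.exists_hbound_stableAmplitude hħ₀ M
  obtain ⟨X, hX, hXb⟩ := D.exists_hbound_χ_comp M
  obtain ⟨C, hC, hCb⟩ := D.exists_norm_iteratedDerivWithin_conjugated_le hħ₀ (M + (d + 1) + 1)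
  obtain ⟨A, hA, hAb⟩ := S.exists_abs_hcoord_le
  obtain ⟨B, hB, hBb⟩ := S.exists_hbound_hderiv (M - 1)
  set A' := max A 1 with hA'
  set K := max ħ₀ 1 with hK
  have hK0 : 0 < K := lt_of_lt_of_le one_pos (le_max_right _ _)
  set B' := K ^ (M - 1) * B with hB'
  have hB'0 : 0 ≤ B' := by positivity
  refine ⟨2 ^ M * (2 ^ M * E * (K ^ M * X)) * ((1 + 2 ^ M * B') ^ M * ((M + 1) *
    ((A' * K) ^ (d + 1) * (C * 3 ^ M)))), by positivity, fun ħ hħ hħ0 U s hU hs w hw n hn ψ hψ => ?_⟩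
  have hw' := hw.shift n
  set r := Real.exp (-S.birkhoff S.J n w) with hr
  have hr0 : 0 < r := Real.exp_pos _
  set W := (wienerENorm ħ (d + 1 : ℕ) ψ).toReal with hW
  have hW0 : 0 ≤ W := ENNReal.toReal_nonneg
  have hrinv : Real.exp (S.birkhoff S.J n w) = r⁻¹ := by rw [hr, Real.exp_neg, inv_inv]
  rw [hrinv] at hψ
  set G : ℕ → ℝ → ℂ := fun i => iteratedDerivWithin i (D.conjugated ħ (shift w n) ψ)
    (D.stateSet (shift w n)) with hG
  have hGd : ∀ i < M + (d + 1), ∀ z ∈ D.stateSet (shift w n),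
      HasDerivWithinAt (G i) (G (i + 1) z) (D.stateSet (shift w n)) z := fun i hi z hz => by
    obtain ⟨c, -, hc⟩ := D.exists_hbound_conjugated hħ₀ (M + (d + 1))
    exact (hc ħ hħ hħ0 _ hw' ψ).hasDerivWithinAt_iteratedDerivWithin
      (D.uniqueDiffOn_stateSet hw') hħ.ne' hi z hz
  -- Up to order $d+1$ the Wiener norms are monotone in the order. Beyond it the frequency bound
  -- $3r^{-1}$ costs $(3r^{-1})^{i-(d+1)}$, and $3^M$ dominates the powers of $3$ because $i\le
  -- M+d+1$.
  have hGb : ∀ i ≤ M + (d + 1), ∀ z ∈ D.stateSet (shift w n),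
      ħ ^ i * ‖G i z‖ ≤ C * 3 ^ M * W * r⁻¹ ^ (i - (d + 1)) := fun i hi z hz => by
    refine (hCb ħ hħ hħ0 _ hw' ψ i (by omega) z hz).trans ?_
    have h1 : (wienerENorm ħ i ψ).toReal ≤ 3 ^ M * W * r⁻¹ ^ (i - (d + 1)) := by
      rcases le_total i (d + 1) with hid | hid
      · have h2 : (wienerENorm ħ i ψ).toReal ≤ W :=
          ENNReal.toReal_mono (wienerENorm_ne_top hħ _ _)
            (wienerENorm_mono_order ħ (by exact_mod_cast hid) ψ)
        rw [Nat.sub_eq_zero_of_le hid, pow_zero, mul_one]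
        exact h2.trans (le_mul_of_one_le_left hW0 (one_le_pow₀ (by norm_num)))
      · have h2 := wienerENorm_le_of_low (s := i) (t := (d + 1 : ℕ)) (by exact_mod_cast hid) hψ
        rw [← Nat.cast_sub hid, Real.rpow_natCast] at h2
        have h3 := ENNReal.toReal_mono
          (ENNReal.mul_ne_top ENNReal.ofReal_ne_top (wienerENorm_ne_top hħ _ _)) h2
        rw [ENNReal.toReal_mul, ENNReal.toReal_ofReal (by positivity), mul_pow] at h3
        refine h3.trans ?_
        calc 3 ^ (i - (d + 1)) * r⁻¹ ^ (i - (d + 1)) * W ≤ 3 ^ M * r⁻¹ ^ (i - (d + 1)) * W := by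
              gcongr
              · norm_num
              · omega
          _ = _ := by ring
    calc _ ≤ C * (3 ^ M * W * r⁻¹ ^ (i - (d + 1))) := mul_le_mul_of_nonneg_left h1 hC
      _ = _ := by ring
  have hT := HBound.taylorRem_comp (I := S.interval (w 0)) (Z := D.stateSet (shift w n))
    (p := d + 1) (M := M) (A := A') (K := K) (X := C * 3 ^ M * W) (B := B') (r := r) hħ
    (hħ0.trans (le_max_left ħ₀ 1)) (le_max_right _ _) hr0 (le_max_right _ _) hB'0 (by positivity)
    (convex_image_hcoord_core hw' _) (mem_of_mem_nhds (D.stateSet_mem_nhds hw')) hGd hGb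
    -- By exact linearization $r$ times the coordinate of $y$ is the coordinate of $\phi_w(y)$. It
    -- lies in `stateSet` because $n\ge a+1$.
    (φ := fun y => r * S.hcoord w y) (q := S.hderiv w)
    (fun y hy => by
      simp only
      rw [hr, ← hcoord_branch hw hy n]
      exact ⟨_, branch_mem_core hw _ hn hy, rfl⟩)
    (fun y hy => (hasDerivWithinAt_hcoord hw hy).const_mul r)
    (fun y hy => by
      rw [abs_mul, abs_of_pos hr0]
      exact mul_le_mul_of_nonneg_left ((hAb w hw y hy).trans (le_max_left _ _)) hr0.le)
    (HBound.rescale hħ.le (hħ0.trans (le_max_left ħ₀ 1)) (le_max_right _ _) hB (hBb w hw).1)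
  have hχ := HBound.rescale hħ.le (hħ0.trans (le_max_left ħ₀ 1)) (le_max_right _ _) hX (hXb w hw 0)
  have h1 := HBound.mul hE hχ (hEb ħ hħ hħ0 w hw)
  have h2 := HBound.mul (by positivity) h1 hT
  refine ((h2.const_mul (D.wordFactor ħ w n * (r : ℂ))).congr fun y hy => ?_).mono
    fun y hy => le_of_eq ?_
  · rw [D.wordRemainder_eq_taylorRem hU hs hw hn ψ hy, branch_zero]
  · rw [norm_mul, Complex.norm_real, Real.norm_eq_abs, abs_of_pos hr0, ← hK]
    ring

/-- The $H_\hbar^m$ norm is bounded by an integer order $M>m$, hence by the pointwise estimates on a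
bounded interval. Replacing the Wiener norm of order $d+1$ by the $H_\hbar^m$ norm costs
$\hbar^{-1/2}$, in addition to $\hbar^{-(d+1)}$ from the Taylor remainder. -/
theorem exists_wordRemainder_low_le {ħ₀ : ℝ} (hħ₀ : 0 < ħ₀) {m : ℝ} {d : ℕ}
    (hd : (d : ℝ) < m - 3 / 2) : ∃ C : ℝ, 0 ≤ C ∧
    ∀ ħ : ℝ, 0 < ħ → ħ ≤ ħ₀ → ∀ (U : ℕ → (ℤ → Fin S.N) → 𝓢'(ℝ, ℂ))
    (s : ℕ → (ℤ → Fin S.N) → 𝓢(ℝ, ℂ)),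
    (∀ k ≤ d, ∀ w, S.Admissible w → D.IsUnstableState ħ k w (U k w)) →
    (∀ k ≤ d, ∀ w, S.Admissible w → D.IsStableState ħ k w (s k w)) →
    ∀ w, S.Admissible w → ∀ n, D.a + 1 ≤ n → ∀ ψ : 𝓢(ℝ, ℂ),
    (∀ η, 3 * Real.exp (S.birkhoff S.J n w) < bracket ħ η → 𝓕⁻ ψ η = 0) →
    sobolevENorm ħ m (D.wordRemainder ħ n d U s w ψ) ≤ ENNReal.ofReal (C * ħ ^ (-((d : ℝ) + 3 / 2)) *
      (‖D.wordFactor ħ w n‖ * Real.exp (-S.birkhoff S.J n w) ^ (d + 2))) * sobolevENorm ħ m ψ := by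
  obtain ⟨M, hM⟩ := exists_nat_gt m
  obtain ⟨C, hC, h⟩ := D.exists_hbound_wordRemainder_low hħ₀ d M
  obtain ⟨K, hK, hKb⟩ := S.exists_sobolevENorm_le M
  obtain ⟨c, hc, hcb⟩ := exists_wienerENorm_le (d + 1 : ℕ) m (by push_cast; linarith)
  refine ⟨K * C * c, by positivity, fun ħ hħ hħ0 U s hU hs w hw n hn ψ hψ => ?_⟩
  have h1 := hKb ħ (w 0) _ (by positivity) _
    (fun y hy => D.wordRemainder_eq_zero hs hw (by omega) ψ hy)
    (h ħ hħ hħ0 U s hU hs w hw n hn ψ hψ)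
  refine ((sobolevENorm_mono_order ħ hM.le _).trans h1).trans ?_
  rw [← mul_assoc, ENNReal.ofReal_mul (by positivity),
    ENNReal.ofReal_toReal (wienerENorm_ne_top hħ _ _)]
  refine (mul_le_mul_right (hcb ħ hħ ψ) _).trans_eq ?_
  rw [← mul_assoc, ← ENNReal.ofReal_mul (by positivity)]
  have e : ħ ^ (-((d : ℝ) + 3 / 2)) = (ħ ^ (d + 1))⁻¹ * ħ ^ (-(1 / 2 : ℝ)) := by
    rw [← Real.rpow_natCast, ← Real.rpow_neg hħ.le, ← Real.rpow_add hħ]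
    congr 1
    push_cast
    ring
  rw [e]
  congr 2
  ring

end TransferData

end

/-! ### The remainder on high frequencies, and one word in total. -/

noncomputable section

open scoped FourierTransform ENNReal

namespace TransferData

open IFS

variable {S : IFS} (D : TransferData S)

theorem exists_sobolevENorm_stable_le {ħ₀ : ℝ} (hħ₀ : 0 < ħ₀) (m : ℝ) (k : ℕ) : ∃ C : ℝ, 0 ≤ C ∧
    ∀ ħ : ℝ, 0 < ħ → ħ ≤ ħ₀ → ∀ w, S.Admissible w → ∀ s, D.IsStableState ħ k w s →
    sobolevENorm ħ m s ≤ ENNReal.ofReal C := by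
  obtain ⟨M, hM⟩ := exists_nat_gt m
  obtain ⟨C, hC, h⟩ := D.exists_hbound_stableState hħ₀ M k
  obtain ⟨K, hK, hKb⟩ := S.exists_sobolevENorm_le M
  refine ⟨K * C, by positivity, fun ħ hħ hħ0 w hw s hs => ?_⟩
  refine (sobolevENorm_mono_order ħ hM.le _).trans (hKb ħ (w 0) C hC s (fun y hy => ?_)
    ((h ħ hħ hħ0 w hw).congr fun y _ => hs y))
  rw [hs y, conjInvTranspose, if_neg hy, mul_zero]

/-- The states lose only $\hbar^{-k-1/2}$; since $\hbar$ is bounded, this is dominated by the loss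
in the Taylor remainder. -/
theorem inv_pow_le_mul_rpow {ħ K : ℝ} (hħ : 0 < ħ) (hK : ħ ≤ K) {k d : ℕ} (hkd : k ≤ d) :
    (ħ ^ k)⁻¹ * ħ ^ (-(1 / 2 : ℝ)) ≤ K ^ (d + 1 - k) * ħ ^ (-((d : ℝ) + 3 / 2)) := by
  have e : ħ ^ (-((d : ℝ) + 3 / 2)) = (ħ ^ (d + 1))⁻¹ * ħ ^ (-(1 / 2 : ℝ)) := by
    rw [← Real.rpow_natCast, ← Real.rpow_neg hħ.le, ← Real.rpow_add hħ]
    congr 1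
    push_cast
    ring
  rw [e, ← mul_assoc]
  gcongr
  rw [inv_le_iff_one_le_mul₀ (by positivity), ← div_eq_mul_inv, div_mul_eq_mul_div,
    one_le_div (by positivity)]
  calc ħ ^ (d + 1) = ħ ^ (d + 1 - k) * ħ ^ k := by rw [← pow_add]; congr 1; omega
    _ ≤ K ^ (d + 1 - k) * ħ ^ k := by gcongr

theorem ofReal_mul₅ {p q r s t : ℝ} (hp : 0 ≤ p) (hq : 0 ≤ q) (hr : 0 ≤ r) (hs : 0 ≤ s) :
    ENNReal.ofReal (p * q * r * s * t) = ENNReal.ofReal p * ENNReal.ofReal q * ENNReal.ofReal r *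
      ENNReal.ofReal s * ENNReal.ofReal t := by
  rw [ENNReal.ofReal_mul (by positivity), ENNReal.ofReal_mul (by positivity),
    ENNReal.ofReal_mul (by positivity), ENNReal.ofReal_mul hp]

/-- The rank one operators on high frequencies. -/
theorem exists_rankOne_high_le {ħ₀ : ℝ} (hħ₀ : 0 < ħ₀) {m : ℝ} {d : ℕ}
    (hd : (d : ℝ) < m - 3 / 2) {κ : ℝ} (hκ : 0 < κ) {k : ℕ} (hkd : k ≤ d) : ∃ C : ℝ, 0 ≤ C ∧
    ∀ ħ : ℝ, 0 < ħ → ħ ≤ ħ₀ → ∀ w, S.Admissible w → ∀ w', S.Admissible w' →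
    ∀ U, D.IsUnstableState ħ k w' U → ∀ s, D.IsStableState ħ k w s →
    ∀ r : ℝ, 0 < r → ∀ L : ℝ, 0 < L → r⁻¹ ≤ κ * L → ∀ ψ : 𝓢(ℝ, ℂ),
    (∀ η, bracket ħ η < L → 𝓕⁻ ψ η = 0) →
    sobolevENorm ħ m (((r ^ (k + 1) : ℝ) : ℂ) • U ψ • s) ≤
      ENNReal.ofReal (C * (ħ ^ (-((d : ℝ) + 3 / 2)) * r ^ (d + 2))) * sobolevENorm ħ m ψ := by
  obtain ⟨A, hA, hAb⟩ := D.exists_enorm_unstable_le hħ₀ k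
  obtain ⟨B, hB, hBb⟩ := D.exists_sobolevENorm_stable_le hħ₀ m k
  obtain ⟨c, hc, hcb⟩ := exists_wienerENorm_le (d + 1 : ℕ) m (by push_cast; linarith)
  refine ⟨B * A * c * ħ₀ ^ (d + 1 - k) * κ ^ (d + 1 - k), by positivity,
    fun ħ hħ hħ0 w hw w' hw' U hU s hs r hr L hL hLr ψ hψ => ?_⟩
  rw [sobolevENorm_smul, sobolevENorm_smul, ← ofReal_norm, Complex.norm_real, Real.norm_eq_abs,
    abs_of_pos (by positivity)]
  -- Raising the order from $k$ to $d+1$ gains $L^{-(d+1-k)}\le(\kappa r)^{d+1-k}$, which completes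
  -- $r^{k+1}$ to $r^{d+2}$.
  have h1 := wienerENorm_le_of_high (s := k) (t := (d + 1 : ℕ)) hL
    (by exact_mod_cast hkd.trans d.le_succ) hψ
  have e : L ^ ((k : ℝ) - (d + 1 : ℕ)) = (L⁻¹) ^ (d + 1 - k) := by
    rw [← neg_sub, ← Nat.cast_sub (by omega), Real.rpow_neg hL.le, Real.rpow_natCast, inv_pow]
  rw [e] at h1
  have hLi : L⁻¹ ≤ κ * r := by
    rw [inv_le_iff_one_le_mul₀ hL]
    rw [inv_le_iff_one_le_mul₀ hr] at hLr
    linarith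
  calc ENNReal.ofReal (r ^ (k + 1)) * (‖U ψ‖ₑ * sobolevENorm ħ m s)
      ≤ ENNReal.ofReal (r ^ (k + 1)) * ((ENNReal.ofReal (A * (ħ ^ k)⁻¹) *
        (ENNReal.ofReal (L⁻¹ ^ (d + 1 - k)) *
        (ENNReal.ofReal (c * ħ ^ (-(1 / 2 : ℝ))) * sobolevENorm ħ m ψ))) * ENNReal.ofReal B) := by
        gcongr
        · exact (hAb ħ hħ hħ0 w' hw' U hU ψ).trans
            (mul_le_mul_right (h1.trans (mul_le_mul_right (hcb ħ hħ ψ) _)) _)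
        · exact hBb ħ hħ hħ0 w hw s hs
    _ = ENNReal.ofReal (r ^ (k + 1) * (A * (ħ ^ k)⁻¹) * L⁻¹ ^ (d + 1 - k) *
        (c * ħ ^ (-(1 / 2 : ℝ))) * B) * sobolevENorm ħ m ψ := by
        rw [ofReal_mul₅ (by positivity) (by positivity) (by positivity) (by positivity)]
        ring
    _ ≤ _ := by
        refine mul_le_mul_left (ENNReal.ofReal_le_ofReal ?_) _
        calc r ^ (k + 1) * (A * (ħ ^ k)⁻¹) * L⁻¹ ^ (d + 1 - k) * (c * ħ ^ (-(1 / 2 : ℝ))) * B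
            = (B * A * c) * ((ħ ^ k)⁻¹ * ħ ^ (-(1 / 2 : ℝ))) *
              (r ^ (k + 1) * L⁻¹ ^ (d + 1 - k)) := by ring
          _ ≤ (B * A * c) * (ħ₀ ^ (d + 1 - k) * ħ ^ (-((d : ℝ) + 3 / 2))) *
              (r ^ (k + 1) * (κ * r) ^ (d + 1 - k)) := by
              refine mul_le_mul (mul_le_mul_of_nonneg_left (inv_pow_le_mul_rpow hħ hħ0 hkd)
                (by positivity)) ?_ (by positivity) (by positivity)
              gcongr
          _ = _ := by
              have e2 : r ^ (d + 2) = r ^ (k + 1) * r ^ (d + 1 - k) := by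
                rw [← pow_add]; congr 1; omega
              rw [mul_pow, e2]
              ring

/-- The operator of the word and the rank one terms are estimated separately, each being small
enough on these frequencies. The constant $\kappa$ allows a threshold $L$ below $e^{J_w}$, as is
needed for short words. -/
theorem exists_wordRemainder_high_le {ħ₀ : ℝ} (hħ₀ : 0 < ħ₀) {m : ℝ} {d : ℕ}
    (hd : (d : ℝ) < m - 3 / 2) {κ : ℝ} (hκ : 0 < κ) : ∃ C : ℝ, 0 ≤ C ∧
    ∀ ħ : ℝ, 0 < ħ → ħ ≤ ħ₀ → ∀ (U : ℕ → (ℤ → Fin S.N) → 𝓢'(ℝ, ℂ))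
    (s : ℕ → (ℤ → Fin S.N) → 𝓢(ℝ, ℂ)),
    (∀ k ≤ d, ∀ w, S.Admissible w → D.IsUnstableState ħ k w (U k w)) →
    (∀ k ≤ d, ∀ w, S.Admissible w → D.IsStableState ħ k w (s k w)) →
    ∀ w, S.Admissible w → ∀ n, 1 ≤ n → ∀ L : ℝ, 0 < L → L ≤ Real.exp (S.birkhoff S.J n w) →
    Real.exp (S.birkhoff S.J n w) ≤ κ * L → ∀ ψ : 𝓢(ℝ, ℂ),
    (∀ η, bracket ħ η < L → 𝓕⁻ ψ η = 0) →
    sobolevENorm ħ m (D.wordRemainder ħ n d U s w ψ) ≤ ENNReal.ofReal (C * ħ ^ (-((d : ℝ) + 3 / 2)) *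
      (‖D.wordFactor ħ w n‖ * Real.exp (-S.birkhoff S.J n w) ^ (d + 2))) * sobolevENorm ħ m ψ := by
  have hm : 0 < m := by linarith [(Nat.cast_nonneg d : (0 : ℝ) ≤ d)]
  obtain ⟨A, hA, hAb⟩ := D.exists_wordTransfer_high_le hħ₀ hm
  have hrank : ∀ k, ∃ C : ℝ, 0 ≤ C ∧ (k ≤ d → ∀ ħ : ℝ, 0 < ħ → ħ ≤ ħ₀ → ∀ w, S.Admissible w →
      ∀ w', S.Admissible w' → ∀ U, D.IsUnstableState ħ k w' U → ∀ s, D.IsStableState ħ k w s →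
      ∀ r : ℝ, 0 < r → ∀ L : ℝ, 0 < L → r⁻¹ ≤ κ * L → ∀ ψ : 𝓢(ℝ, ℂ),
      (∀ η, bracket ħ η < L → 𝓕⁻ ψ η = 0) →
      sobolevENorm ħ m (((r ^ (k + 1) : ℝ) : ℂ) • U ψ • s) ≤
        ENNReal.ofReal (C * (ħ ^ (-((d : ℝ) + 3 / 2)) * r ^ (d + 2))) * sobolevENorm ħ m ψ) := by
    intro k
    by_cases hkd : k ≤ d
    · obtain ⟨C, hC, h⟩ := D.exists_rankOne_high_le hħ₀ hd hκ hkd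
      exact ⟨C, hC, fun _ => h⟩
    · exact ⟨0, le_rfl, fun h => absurd h hkd⟩
  choose B hB hBb using hrank
  refine ⟨A * κ ^ m * ħ₀ ^ ((d : ℝ) + 3 / 2) + ∑ k ∈ Finset.range (d + 1), B k,
    add_nonneg (by positivity) (Finset.sum_nonneg fun k _ => hB k),
    fun ħ hħ hħ0 U s hU hs w hw n hn L hL hLJ hJL ψ hψ => ?_⟩
  set r := Real.exp (-S.birkhoff S.J n w) with hr
  have hr0 : 0 < r := Real.exp_pos _
  have hr1 : r ≤ 1 := by
    rw [hr, Real.exp_le_one_iff]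
    linarith [birkhoff_J_nonneg hw n]
  have hrinv : Real.exp (S.birkhoff S.J n w) = r⁻¹ := by rw [hr, Real.exp_neg, inv_inv]
  set Φ := ‖D.wordFactor ħ w n‖ with hΦ
  set H := ħ ^ (-((d : ℝ) + 3 / 2)) with hH
  have hH0 : 0 < H := by positivity
  have h1 : sobolevENorm ħ m (D.wordTransfer ħ w n ψ) ≤
      ENNReal.ofReal (A * κ ^ m * ħ₀ ^ ((d : ℝ) + 3 / 2) * H * (Φ * r ^ (d + 2))) *
        sobolevENorm ħ m ψ := by
    refine (hAb ħ hħ hħ0 w hw n hn L hL hLJ ψ hψ).trans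
      (mul_le_mul_left (ENNReal.ofReal_le_ofReal ?_) _)
    have e1 : L ^ (-m) ≤ κ ^ m * r ^ m := by
      rw [Real.rpow_neg hL.le, ← Real.inv_rpow hL.le, ← Real.mul_rpow hκ.le hr0.le]
      refine Real.rpow_le_rpow (by positivity) ?_ hm.le
      rw [inv_le_iff_one_le_mul₀ hL]
      rw [hrinv, inv_le_iff_one_le_mul₀ hr0] at hJL
      linarith
    have e2 : Real.exp (-S.birkhoff S.J n w / 2) = r ^ (1 / 2 : ℝ) := by
      rw [hr, ← Real.exp_mul]; congr 1; ring
    -- Since $r\le1$, this uses $m+\frac12\ge d+2$, another consequence of $d<m-\frac32$.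
    have e3 : r ^ (1 / 2 : ℝ) * r ^ m ≤ r ^ (d + 2) := by
      rw [← Real.rpow_add hr0, ← Real.rpow_natCast]
      refine Real.rpow_le_rpow_of_exponent_ge hr0 hr1 ?_
      push_cast
      linarith
    -- The operator of the word has no loss in $\hbar$; the constant $\hbar_0^{d+3/2}$ is inserted
    -- to reach the common form of the bound.
    have e4 : 1 ≤ ħ₀ ^ ((d : ℝ) + 3 / 2) * H := by
      rw [hH, Real.rpow_neg hħ.le, ← div_eq_mul_inv, one_le_div (by positivity)]
      exact Real.rpow_le_rpow hħ.le hħ0 (by positivity)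
    calc A * (Φ * Real.exp (-S.birkhoff S.J n w / 2)) * L ^ (-m)
        ≤ A * (Φ * r ^ (1 / 2 : ℝ)) * (κ ^ m * r ^ m) := by rw [e2]; gcongr
      _ = A * κ ^ m * 1 * (Φ * (r ^ (1 / 2 : ℝ) * r ^ m)) := by ring
      _ ≤ A * κ ^ m * (ħ₀ ^ ((d : ℝ) + 3 / 2) * H) * (Φ * r ^ (d + 2)) := by gcongr
      _ = _ := by ring
  have h2 : sobolevENorm ħ m (D.wordFactor ħ w n • ∑ k ∈ Finset.range (d + 1),
      ((Real.exp (-((k : ℝ) + 1) * S.birkhoff S.J n w) : ℝ) : ℂ) • U k (shift w n) ψ • s k w) ≤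
      ENNReal.ofReal ((∑ k ∈ Finset.range (d + 1), B k) * H * (Φ * r ^ (d + 2))) *
        sobolevENorm ħ m ψ := by
    rw [sobolevENorm_smul, ← ofReal_norm, ← hΦ]
    have h3 : ∀ k ∈ Finset.range (d + 1), sobolevENorm ħ m
        (((Real.exp (-((k : ℝ) + 1) * S.birkhoff S.J n w) : ℝ) : ℂ) •
          U k (shift w n) ψ • s k w) ≤
        ENNReal.ofReal (B k * (H * r ^ (d + 2))) * sobolevENorm ħ m ψ := fun k hk => by
      have hkd : k ≤ d := by simpa [Nat.lt_succ_iff] using hk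
      have e : Real.exp (-((k : ℝ) + 1) * S.birkhoff S.J n w) = r ^ (k + 1) := by
        rw [hr, ← Real.exp_nat_mul]; congr 1; push_cast; ring
      rw [e]
      exact hBb k hkd ħ hħ hħ0 w hw _ (hw.shift n) _ (hU k hkd _ (hw.shift n)) _ (hs k hkd w hw)
        r hr0 L hL (hrinv ▸ hJL) ψ hψ
    refine (mul_le_mul_right ((sobolevENorm_sum_le _ _ _ _).trans (Finset.sum_le_sum h3)) _).trans ?_
    rw [← Finset.sum_mul, ← ENNReal.ofReal_sum_of_nonneg fun k _ => mul_nonneg (hB k)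
      (by positivity), ← mul_assoc, ← ENNReal.ofReal_mul (norm_nonneg _), ← Finset.sum_mul]
    refine le_of_eq ?_
    congr 2
    ring
  rw [wordRemainder, sub_eq_add_neg]
  refine (sobolevENorm_add_le _ _ _ _).trans ?_
  rw [sobolevENorm_neg]
  refine (add_le_add h1 h2).trans_eq ?_
  have h4 : 0 ≤ ∑ k ∈ Finset.range (d + 1), B k := Finset.sum_nonneg fun k _ => hB k
  rw [← add_mul, ← ENNReal.ofReal_add (by positivity) (by positivity)]
  congr 2
  ring

/-- The contribution of a word to the remainder. -/
theorem exists_wordRemainder_le {ħ₀ : ℝ} (hħ₀ : 0 < ħ₀) {m : ℝ} {d : ℕ}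
    (hd : (d : ℝ) < m - 3 / 2) : ∃ C : ℝ, 0 ≤ C ∧
    ∀ ħ : ℝ, 0 < ħ → ħ ≤ ħ₀ → ∀ (U : ℕ → (ℤ → Fin S.N) → 𝓢'(ℝ, ℂ))
    (s : ℕ → (ℤ → Fin S.N) → 𝓢(ℝ, ℂ)),
    (∀ k ≤ d, ∀ w, S.Admissible w → D.IsUnstableState ħ k w (U k w)) →
    (∀ k ≤ d, ∀ w, S.Admissible w → D.IsStableState ħ k w (s k w)) →
    ∀ w, S.Admissible w → ∀ n, 1 ≤ n → ∀ ψ : 𝓢(ℝ, ℂ),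
    sobolevENorm ħ m (D.wordRemainder ħ n d U s w ψ) ≤ ENNReal.ofReal (C * ħ ^ (-((d : ℝ) + 3 / 2)) *
      (‖D.wordFactor ħ w n‖ * Real.exp (-S.birkhoff S.J n w) ^ (d + 2))) * sobolevENorm ħ m ψ := by
  obtain ⟨κ, hκ, hκb⟩ := S.exists_exp_birkhoff_J_le D.a
  obtain ⟨A, hA, hAb⟩ := D.exists_wordRemainder_low_le hħ₀ hd
  obtain ⟨B, hB, hBb⟩ := D.exists_wordRemainder_high_le hħ₀ hd (κ := κ) (by linarith)
  refine ⟨A + B, by positivity, fun ħ hħ hħ0 U s hU hs w hw n hn ψ => ?_⟩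
  have hJ1 : 1 ≤ Real.exp (S.birkhoff S.J n w) := Real.one_le_exp (birkhoff_J_nonneg hw n)
  -- From length $a+1$ on the normal form is available, and $\psi$ is split at frequency $e^{J_w}$,
  -- so that $L=e^{J_w}$ and any $\kappa\ge1$ are admissible for the high part.
  by_cases hna : D.a + 1 ≤ n
  · obtain ⟨ψ₁, ψ₂, rfl, hn1, hn2, hlow, hhigh⟩ :=
      exists_freq_split hħ (Real.exp (S.birkhoff S.J n w)) ψ
    rw [D.wordRemainder_add]
    refine (sobolevENorm_add_le _ _ _ _).trans ?_
    refine (add_le_add (hAb ħ hħ hħ0 U s hU hs w hw n hna ψ₁ hlow)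
      (hBb ħ hħ hħ0 U s hU hs w hw n hn _ (by positivity) le_rfl
        (le_mul_of_one_le_left (by positivity) hκ) ψ₂ hhigh)).trans ?_
    refine (add_le_add (mul_le_mul_right (sobolevENorm_mono hn1) _)
      (mul_le_mul_right (sobolevENorm_mono hn2) _)).trans_eq ?_
    rw [← add_mul, ← ENNReal.ofReal_add (by positivity) (by positivity)]
    congr 2
    ring
  -- A word of length at most $a$: with $L=1$ every frequency is high, and $e^{J_w}\le\kappa$.
  · refine (hBb ħ hħ hħ0 U s hU hs w hw n hn 1 one_pos hJ1
      (by rw [mul_one]; exact hκb w hw n (by omega)) ψ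
      fun η hη => absurd hη (not_lt.mpr (one_le_bracket _ _))).trans ?_
    gcongr
    linarith

end TransferData

end

/-! ### Summation over the words and the theorem. -/

noncomputable section

open scoped FourierTransform ENNReal

namespace TransferData

open IFS

variable {S : IFS} (D : TransferData S)

theorem edgeSmooth_pressure (c : ℝ) :
    S.EdgeSmooth fun x => (((D.V x).re - c * S.J x : ℝ) : ℂ) := by
  intro i j h
  have h1 := Complex.ofRealCLM.contDiff.comp_contDiffOn
    (Complex.reCLM.contDiff.comp_contDiffOn (D.edgeSmooth_V i j h))
  have h2 := (edgeSmooth_J i j h).const_smul (c : ℂ)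
  refine (h1.sub h2).congr fun y _ => ?_
  simp

/-- The bound for one word is exactly a summand of the partition function whose growth rate is the
pressure in the theorem. -/
theorem norm_wordFactor_mul {ħ : ℝ} (hħ : ħ ≠ 0) (w : ℤ → Fin S.N) (n d : ℕ) :
    ‖D.wordFactor ħ w n‖ * Real.exp (-S.birkhoff S.J n w) ^ (d + 2) =
      Real.exp (S.birkhoff (fun x => (D.V x).re - ((d : ℝ) + 2) * S.J x) n w) := by
  rw [D.norm_wordFactor hħ, ← Real.exp_nat_mul, ← Real.exp_add]
  congr 1
  simp only [birkhoff, Finset.sum_sub_distrib, ← Finset.mul_sum]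
  push_cast
  ring

/-- The state is bounded on the Wiener space of order $k$, into which $H_\hbar^m$ embeds for
$m>k+\frac12$; duality does the rest. -/
theorem memHSobolev_unstable {ħ : ℝ} (hħ : 0 < ħ) {m : ℝ} {k : ℕ} (hk : (k : ℝ) + 1 / 2 < m)
    {w : ℤ → Fin S.N} (hw : S.Admissible w) {U : 𝓢'(ℝ, ℂ)} (hU : D.IsUnstableState ħ k w U) :
    MemHSobolev ħ (-m) U := by
  obtain ⟨C, hC, h⟩ := D.exists_enorm_unstable_le hħ k
  obtain ⟨c, hc, hcb⟩ := exists_wienerENorm_le k m (by linarith)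
  refine (memHSobolev_of_bound (A := C * (ħ ^ k)⁻¹ * (c * ħ ^ (-(1 / 2 : ℝ)))) (by positivity)
    fun ψ => (h ħ hħ le_rfl w hw U hU ψ).trans ?_).1
  rw [ENNReal.ofReal_mul (p := C * (ħ ^ k)⁻¹) (by positivity), mul_assoc]
  exact mul_le_mul_right (hcb ħ hħ ψ) _

/-- On test functions the roles in $|\mathcal U\rangle\langle\mathcal S|$ are exchanged: the
transpose evaluates $\mathcal U$ on $\psi$ and multiplies the Schwartz function $\mathcal S$. The
remainder thus becomes a sum over words that stays within Schwartz functions. -/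
theorem transfer_sub_expansion_apply {ħ : ℝ} {n d : ℕ} (hn : 1 ≤ n)
    {ext : S.Word n → ℤ → Fin S.N} (hext : ∀ v, S.Extends (ext v) v)
    (U : ℕ → (ℤ → Fin S.N) → 𝓢'(ℝ, ℂ)) (s : ℕ → (ℤ → Fin S.N) → 𝓢(ℝ, ℂ)) (u : 𝓢'(ℝ, ℂ))
    (ψ : 𝓢(ℝ, ℂ)) :
    ((((D.transfer ħ ^ n : 𝓢'(ℝ, ℂ) →L[ℂ] 𝓢'(ℝ, ℂ)) : 𝓢'(ℝ, ℂ) →ₗ[ℂ] 𝓢'(ℝ, ℂ)) -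
      D.expansion ħ n d ext U s) u) ψ = u (∑ v, D.wordRemainder ħ n d U s (ext v) ψ) := by
  have h1 : (D.expansion ħ n d ext U s u) ψ = ∑ v : S.Word n, D.wordFactor ħ (ext v) n *
      ∑ k ∈ Finset.range (d + 1),
        ((Real.exp (-((k : ℝ) + 1) * S.birkhoff S.J n (ext v)) : ℝ) : ℂ) *
          (u (s k (ext v)) * U k (shift (ext v) n) ψ) := by
    simp only [expansion, LinearMap.sum_apply, LinearMap.smul_apply, sum_apply, smul_apply,
      rankOne, LinearMap.coe_mk, AddHom.coe_mk, smul_eq_mul, wordFactor]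
  have h2 : (((D.transfer ħ ^ n : 𝓢'(ℝ, ℂ) →L[ℂ] 𝓢'(ℝ, ℂ)) : 𝓢'(ℝ, ℂ) →ₗ[ℂ] 𝓢'(ℝ, ℂ)) u) ψ =
      ∑ v : S.Word n, u (D.wordTransfer ħ (ext v) n ψ) := by
    rw [← map_sum, ← D.transpose_pow_eq_sum ψ hn hext, ← D.transfer_pow_apply]
    rfl
  rw [LinearMap.sub_apply, sub_apply, h1, h2, map_sum, ← Finset.sum_sub_distrib]
  refine Finset.sum_congr rfl fun v _ => ?_
  simp only [wordRemainder, map_sub, map_smul, map_sum, smul_eq_mul]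
  congr 2
  exact Finset.sum_congr rfl fun k _ => by ring

end TransferData

end

theorem theorem6p6 (S : IFS) (D : TransferData S) (m : ℝ) (d : ℕ) (hd : (d : ℝ) < m - 3 / 2)
    (ħ₀ : ℝ) (hħ₀ : 0 < ħ₀) :
    ∃ P : ℝ, S.IsPressure (fun x => (D.V x).re - ((d : ℝ) + 2) * S.J x) P ∧
    ∃ C : ℝ, 0 < C ∧ ∃ R : ℕ → ℝ, Tendsto R atTop (𝓝 0) ∧
    ∀ ħ : ℝ, 0 < ħ → ħ < ħ₀ →
    ∃ (U : ℕ → (ℤ → Fin S.N) → 𝓢'(ℝ, ℂ)) (s : ℕ → (ℤ → Fin S.N) → 𝓢(ℝ, ℂ)),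
      (∀ k ≤ d, ∀ w, S.Admissible w →
        D.IsUnstableState ħ k w (U k w) ∧ MemHSobolev ħ (-m) (U k w) ∧
        D.IsStableState ħ k w (s k w) ∧
        MemHSobolev ħ m (SchwartzMap.toTemperedDistributionCLM ℝ ℂ volume (s k w))) ∧
      ∀ n : ℕ, 1 ≤ n → ∀ ext : S.Word n → ℤ → Fin S.N, (∀ v, S.Extends (ext v) v) →
        HSobolevOpNormLE ħ (-m)
          (((D.transfer ħ ^ n : 𝓢'(ℝ, ℂ) →L[ℂ] 𝓢'(ℝ, ℂ)) : 𝓢'(ℝ, ℂ) →ₗ[ℂ] 𝓢'(ℝ, ℂ)) -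
            D.expansion ħ n d ext U s)
          (C * ħ ^ (-((d : ℝ) + 3 / 2)) * Real.exp (n * (P + R n))) := by
  classical
  obtain ⟨P, hP, R, hR, hsum⟩ := IFS.exists_pressure (D.edgeSmooth_pressure ((d : ℝ) + 2))
  obtain ⟨C, hC, hCb⟩ := D.exists_wordRemainder_le hħ₀ hd
  -- The estimates only provide $C\ge0$; adding $1$ makes the constant positive.
  refine ⟨P, hP, C + 1, by positivity, R, hR, fun ħ hħ hħ0 => ?_⟩
  choose! U hU using fun (k : ℕ) (w : ℤ → Fin S.N) (hw : S.Admissible w) =>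
    D.exists_isUnstableState hħ hw k
  choose! s hs using fun (k : ℕ) (w : ℤ → Fin S.N) (hw : S.Admissible w) =>
    D.exists_isStableState hħ hw k
  refine ⟨U, s, fun k hk w hw => ⟨hU k w hw, D.memHSobolev_unstable hħ ?_ hw (hU k w hw),
    hs k w hw, memHSobolev_schwartz _ _ _⟩, fun n hn ext hext => ?_⟩
  · have : (k : ℝ) ≤ d := by exact_mod_cast hk
    linarith
  refine hSobolevOpNormLE_of_transpose (by positivity) _
    (fun ψ => ∑ v, D.wordRemainder ħ n d U s (ext v) ψ)
    (fun u ψ => D.transfer_sub_expansion_apply hn hext U s u ψ) fun ψ => ?_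
  refine (sobolevENorm_sum_le _ _ _ _).trans ((Finset.sum_le_sum fun v _ =>
    hCb ħ hħ hħ0.le U s (fun k _ => hU k) (fun k _ => hs k) _ (hext v).1 n hn ψ).trans ?_)
  rw [← Finset.sum_mul, ← ENNReal.ofReal_sum_of_nonneg fun v _ => by positivity,
    ← Finset.mul_sum]
  refine mul_le_mul_left (ENNReal.ofReal_le_ofReal ?_) _
  simp only [D.norm_wordFactor_mul hħ.ne']
  have h1 := hsum n hn ext hext
  rw [IFS.partitionSum] at h1
  gcongr
  · linarith
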